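/- Let $M$ be a connected smooth manifold (Hausdorff, second countable, without boundary) with a smooth Riemannian metric $g$, let $TM=\mathcal H\oplus\mathcal V$ be a $g$-orthogonal splitting into smooth subbundles (of constant rank), with $\mathcal V$ integrable, and let $\mathrm{pr}_{\mathcal H},\mathrm{pr}_{\mathcal V}$ be the projections. With $\nabla$ the Levi-Civita connection of $g$, define the connection $$\mathring\nabla_A Z=\mathrm{pr}_{\mathcal H}\nabla_{\mathrm{pr}_{\mathcal H}A}\,\mathrm{pr}_{\mathcal H}Z+\mathrm{pr}_{\mathcal V}\nabla_{\mathrm{pr}_{\mathcal V}A}\,\mathrm{pr}_{\mathcal V}Z+\mathrm{pr}_{\mathcal H}[\mathrm{pr}_{\mathcal V}A,\mathrm{pr}_{\mathcal H}Z]+\mathrm{pr}_{\mathcal V}[\mathrm{pr}_{\mathcal H}A,\mathrm{pr}_{\mathcal V}Z],$$ and assume $\mathring\nabla g=0$ (that is, $\mathcal V$ defines a totally geodesic Riemannian foliation). Let $\Omega(M)$ be the smooth differential forms. A form has degree $(a,b)$ if it is a sum of products $\alpha\wedge\beta$ with $\alpha\in\Gamma(\bigwedge^a\mathrm{Ann}(\mathcal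 V))$ and $\beta\in\Gamma(\bigwedge^b\mathrm{Ann}(\mathcal H))$ (only the zero form if $a<0$ or $b<0$). Write $d^{a,b}$ for the component of degree $(a,b)$ of the exterior derivative $d$, and $\delta^{a,b}$ for the component of degree $(a,b)$ of the codifferential $\delta$, where $\delta$ is the formal dual of $d$ with respect to the $L^2$ inner product of forms induced by $g$: for every $\eta\in\Omega(M)$, $\delta\eta$ is the smooth form with $\langle d\alpha,\eta\rangle=\langle\alpha,\delta\eta\rangle$ for all compactly supported $\alpha\in\Omega(M)$. Let $\Delta f=\mathrm{div}\,\mathrm{grad} f$ be the Laplace–Beltrami operator of $g$ and $\Delta_{\mathbf h}f=\mathrm{div}(\mathrm{pr}_{\mathcal H}\,\mathrm{grad} f)$ the sub-Laplacian, where the divergence is relative to the Riemannian volume of $g$. Then $\delta$ exists, and for every $\eta\in\Omega(M)$ $$\delta^{-1,0}d^{0,1}\eta=-d^{0,1}\delta^{-1,0}\eta,\qquad \delta^{0,-1}d^{1,0}\eta=-d^{1,0}\delta^{0,-1}\eta,$$ and for every $f\in C^\infty(M)$ $$\Delta_{\mathbf h}\Delta f=\Delta\Delta_{\mathbf h}f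 .$$ -/

import Mathlib

open scoped Manifold ContDiff

namespace GradedForms

open MeasureTheory Bundle

/-! ## Bigraded parts of an alternating form on a vector space -/

section Algebra

variable {W : Type*} [AddCommGroup W] [Module ℝ W] [TopologicalSpace W] {k : ℕ}

/-- The `(a, b)`-part of a `k`-form `θ` with respect to a pair `P`, `Q` of complementary
projections: the sum, over all ways to choose `a` slots of `θ` with exactly `b` slots remaining,
of `θ` with `P` inserted in the chosen slots and `Q` in the remaining ones.
It vanishes unless `0 ≤ a`, `0 ≤ b` and `a + b = k`. -/
noncomputable def bigradedMultilinear (P Q : W →L[ℝ] W) (a b : ℤ) (θ : W [⋀^Fin k]→L[ℝ] ℝ) :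
    ContinuousMultilinearMap ℝ (fun _ : Fin k => W) ℝ :=
  ∑ s : Finset (Fin k) with ((s.card : ℤ) = a ∧ (sᶜ.card : ℤ) = b),
    θ.toContinuousMultilinearMap.compContinuousLinearMap (fun i => if i ∈ s then P else Q)

theorem bigradedMultilinear_apply (P Q : W →L[ℝ] W) (a b : ℤ) (θ : W [⋀^Fin k]→L[ℝ] ℝ)
    (v : Fin k → W) :
    bigradedMultilinear P Q a b θ v =
      ∑ s : Finset (Fin k) with ((s.card : ℤ) = a ∧ (sᶜ.card : ℤ) = b),
        θ (fun i => if i ∈ s then P (v i) else Q (v i)) := by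
  simp only [bigradedMultilinear, ContinuousMultilinearMap.sum_apply,
    ContinuousMultilinearMap.compContinuousLinearMap_apply]
  refine Finset.sum_congr rfl fun s _ => ?_
  change θ _ = θ _
  congr 1
  funext i
  split_ifs <;> rfl

theorem bigradedMultilinear_eq_zero (P Q : W →L[ℝ] W) (a b : ℤ) (θ : W [⋀^Fin k]→L[ℝ] ℝ)
    (v : Fin k → W) (i j : Fin k) (hv : v i = v j) (hij : i ≠ j) :
    bigradedMultilinear P Q a b θ v = 0 := by
  classical
  rw [bigradedMultilinear_apply]
  set σ : Equiv.Perm (Fin k) := Equiv.swap i j with hσ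
  have hvσ : ∀ l, v (σ l) = v l := by
    intro l
    rcases eq_or_ne l i with rfl | hi
    · simp [hσ, hv]
    · rcases eq_or_ne l j with rfl | hj
      · simp [hσ, hv]
      · rw [hσ, Equiv.swap_apply_of_ne_of_ne hi hj]
  have hmem : ∀ (s : Finset (Fin k)) (l : Fin k),
      l ∈ s.map σ.toEmbedding ↔ σ l ∈ s := by
    intro s l
    rw [Finset.mem_map_equiv]
    simp [hσ]
  have hval : ∀ s : Finset (Fin k),
      θ (fun l => if l ∈ s.map σ.toEmbedding then P (v l) else Q (v l)) =
        - θ (fun l => if l ∈ s then P (v l) else Q (v l)) := by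
    intro s
    have := θ.toAlternatingMap.map_swap
      (fun l => if l ∈ s then P (v l) else Q (v l)) hij
    have h2 : (fun l => if l ∈ s.map σ.toEmbedding then P (v l) else Q (v l)) =
        (fun l => if l ∈ s then P (v l) else Q (v l)) ∘ σ := by
      funext l
      simp only [Function.comp, hmem, hvσ]
    rw [h2]
    exact this
  refine Finset.sum_involution (fun s _ => s.map σ.toEmbedding) ?_ ?_ ?_ ?_
  · intro s _
    rw [hval]
    ring
  · intro s _ hne heq
    apply hne
    have := hval s
    rw [heq] at this
    linarith
  · intro s hs
    simp only [Finset.mem_filter, Finset.mem_univ, true_and, Finset.card_compl,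
      Finset.card_map] at hs ⊢
    exact hs
  · intro s _
    ext l
    rw [hmem, hmem]
    simp [hσ]

/-- The `(a, b)`-part of an alternating form. -/
noncomputable def bigradedPart (P Q : W →L[ℝ] W) (a b : ℤ) (θ : W [⋀^Fin k]→L[ℝ] ℝ) :
    W [⋀^Fin k]→L[ℝ] ℝ :=
  { bigradedMultilinear P Q a b θ with
    map_eq_zero_of_eq' := fun v i j hv hij =>
      bigradedMultilinear_eq_zero P Q a b θ v i j hv hij }

end Algebra

/-! ## Calculus on a manifold -/

variable {n : ℕ} {M : Type*} [TopologicalSpace M] [ChartedSpace (EuclideanSpace ℝ (Fin n)) M]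

section Calculus

variable (n M) in
/-- The space `Ω(M)` of (not necessarily smooth) differential forms on `M`. An element is a family
of a `k`-form for every `k`; only finitely many degrees matter, since the `k`-forms with
`k > dim M` vanish. -/
abbrev Form : Type _ :=
  ∀ (k : ℕ) (x : M), TangentSpace 𝓘(ℝ, EuclideanSpace ℝ (Fin n)) x [⋀^Fin k]→L[ℝ] ℝ

variable (n M) in
/-- Vector fields on `M`, not necessarily smooth. -/
abbrev VField : Type _ := ∀ x : M, TangentSpace 𝓘(ℝ, EuclideanSpace ℝ (Fin n)) x

/-- Smooth functions. -/
def IsSmoothFun (f : M → ℝ) : Prop :=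
  ContMDiff 𝓘(ℝ, EuclideanSpace ℝ (Fin n)) 𝓘(ℝ, ℝ) ∞ f

/-- The derivative `X f` of a function along a vector field. -/
noncomputable def dirDeriv (X : VField n M) (f : M → ℝ) (x : M) : ℝ :=
  mfderiv 𝓘(ℝ, EuclideanSpace ℝ (Fin n)) 𝓘(ℝ, ℝ) f x (X x)

/-- The `i`-th coordinate vector field of the preferred chart at `c`
(meaningful on the domain of that chart). -/
noncomputable def coordField (c : M) (i : Fin n) : VField n M := fun x =>
  mfderiv 𝓘(ℝ, EuclideanSpace ℝ (Fin n)) 𝓘(ℝ, EuclideanSpace ℝ (Fin n))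
    (extChartAt 𝓘(ℝ, EuclideanSpace ℝ (Fin n)) c).symm
    (extChartAt 𝓘(ℝ, EuclideanSpace ℝ (Fin n)) c x) (EuclideanSpace.single i (1 : ℝ))

/-- The expression of a `k`-form in the preferred chart at `c`: its pull-back under the inverse of
the chart. -/
noncomputable def formInChart (c : M) {k : ℕ}
    (θ : ∀ x : M, TangentSpace 𝓘(ℝ, EuclideanSpace ℝ (Fin n)) x [⋀^Fin k]→L[ℝ] ℝ)
    (y : EuclideanSpace ℝ (Fin n)) : EuclideanSpace ℝ (Fin n) [⋀^Fin k]→L[ℝ] ℝ :=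
  (θ ((extChartAt 𝓘(ℝ, EuclideanSpace ℝ (Fin n)) c).symm y)).compContinuousLinearMap
    (mfderiv 𝓘(ℝ, EuclideanSpace ℝ (Fin n)) 𝓘(ℝ, EuclideanSpace ℝ (Fin n))
      (extChartAt 𝓘(ℝ, EuclideanSpace ℝ (Fin n)) c).symm y)

/-- Smooth forms: all expressions in charts are smooth. -/
def IsSmoothForm (η : Form n M) : Prop :=
  ∀ (k : ℕ) (c : M), ContDiffOn ℝ ∞ (formInChart c (η k))
    (extChartAt 𝓘(ℝ, EuclideanSpace ℝ (Fin n)) c).target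

/-- Forms of compact support. -/
def IsCompactlySupported (η : Form n M) : Prop :=
  ∃ K : Set M, IsCompact K ∧ ∀ (k : ℕ) (x : M), x ∉ K → η k x = 0

/-- The exterior derivative of a `k`-form; at `x` it is computed in the preferred chart at `x`. -/
noncomputable def extDOfDegree {k : ℕ}
    (θ : ∀ x : M, TangentSpace 𝓘(ℝ, EuclideanSpace ℝ (Fin n)) x [⋀^Fin k]→L[ℝ] ℝ) (x : M) :
    TangentSpace 𝓘(ℝ, EuclideanSpace ℝ (Fin n)) x [⋀^Fin (k + 1)]→L[ℝ] ℝ :=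
  (extDeriv (formInChart x θ)
    (extChartAt 𝓘(ℝ, EuclideanSpace ℝ (Fin n)) x x)).compContinuousLinearMap
    (mfderiv 𝓘(ℝ, EuclideanSpace ℝ (Fin n)) 𝓘(ℝ, EuclideanSpace ℝ (Fin n))
      (extChartAt 𝓘(ℝ, EuclideanSpace ℝ (Fin n)) x) x)

/-- The exterior derivative on `Ω(M)`. -/
noncomputable def extD (η : Form n M) : Form n M
  | 0 => 0
  | k + 1 => extDOfDegree (η k)

variable (n M) in
/-- Countably many preferred charts cover a second countable manifold. -/
theorem exists_chart_cover [SecondCountableTopology M] [Nonempty M] :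
    ∃ c : ℕ → M, ⋃ i, (extChartAt 𝓘(ℝ, EuclideanSpace ℝ (Fin n)) (c i)).source = Set.univ := by
  obtain ⟨s, hs, hsU⟩ := TopologicalSpace.countable_cover_nhds
    (f := fun x : M => (extChartAt 𝓘(ℝ, EuclideanSpace ℝ (Fin n)) x).source)
    (fun x => extChartAt_source_mem_nhds x)
  have hne : s.Nonempty := by
    rcases Set.eq_empty_or_nonempty s with rfl | h
    · simp only [Set.mem_empty_iff_false, Set.iUnion_of_empty, Set.iUnion_empty] at hsU
      exact absurd hsU.symm Set.univ_nonempty.ne_empty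
    · exact h
  obtain ⟨c, rfl⟩ := hs.exists_eq_range hne
  exact ⟨c, by simpa using hsU⟩

variable (n M) in
/-- The centres of countably many charts that cover `M`. -/
noncomputable def chartCentre [SecondCountableTopology M] [Nonempty M] : ℕ → M :=
  (exists_chart_cover n M).choose

variable [IsManifold 𝓘(ℝ, EuclideanSpace ℝ (Fin n)) ∞ M]

/-- Smooth vector fields. -/
def IsSmoothVField (X : VField n M) : Prop :=
  ContMDiff 𝓘(ℝ, EuclideanSpace ℝ (Fin n)) (𝓘(ℝ, EuclideanSpace ℝ (Fin n))).tangent ∞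
    (fun x => (⟨x, X x⟩ : TangentBundle 𝓘(ℝ, EuclideanSpace ℝ (Fin n)) M))

/-- Smooth subbundles of the tangent bundle: of constant rank `r`, and with smooth local
frames. -/
def IsSmoothSubbundle
    (D : ∀ x : M, Submodule ℝ (TangentSpace 𝓘(ℝ, EuclideanSpace ℝ (Fin n)) x)) : Prop :=
  ∃ r : ℕ, ∀ x₀ : M, ∃ U ∈ nhds x₀, ∃ X : Fin r → VField n M,
    (∀ i, ContMDiffOn 𝓘(ℝ, EuclideanSpace ℝ (Fin n)) (𝓘(ℝ, EuclideanSpace ℝ (Fin n))).tangent ∞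
      (fun x => (⟨x, X i x⟩ : TangentBundle 𝓘(ℝ, EuclideanSpace ℝ (Fin n)) M)) U) ∧
    ∀ x ∈ U, LinearIndependent ℝ (fun i => X i x) ∧
      Submodule.span ℝ (Set.range fun i => X i x) = D x

/-- Integrability (involutivity) of a subbundle. -/
def IsIntegrable
    (D : ∀ x : M, Submodule ℝ (TangentSpace 𝓘(ℝ, EuclideanSpace ℝ (Fin n)) x)) : Prop :=
  ∀ X Y : VField n M, IsSmoothVField X → IsSmoothVField Y →
    (∀ x, X x ∈ D x) → (∀ x, Y x ∈ D x) →
    ∀ x, VectorField.mlieBracket 𝓘(ℝ, EuclideanSpace ℝ (Fin n)) X Y x ∈ D x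

end Calculus

/-! ## Riemannian geometry -/

section Riemannian

variable [IsManifold 𝓘(ℝ, EuclideanSpace ℝ (Fin n)) ∞ M]

variable (n M) in
/-- Smooth Riemannian metrics on `M`. -/
abbrev Metric : Type _ :=
  ContMDiffRiemannianMetric 𝓘(ℝ, EuclideanSpace ℝ (Fin n)) ∞ (EuclideanSpace ℝ (Fin n))
    (fun x : M => TangentSpace 𝓘(ℝ, EuclideanSpace ℝ (Fin n)) x)

/-- The matrix `(g_{ij})` of the metric in the preferred chart at `c`. -/
noncomputable def gram (g : Metric n M) (c x : M) : Matrix (Fin n) (Fin n) ℝ :=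
  Matrix.of fun i j => g.inner x (coordField c i x) (coordField c j x)

/-- The Riemannian density `√det(g_{ij})` in the preferred chart at `c`. -/
noncomputable def density (g : Metric n M) (c x : M) : ℝ := √(gram g c x).det

/-- The tangent vector at `x` that corresponds to the covector with values `p i` on the coordinate
vectors of the chart at `x`, i.e. the vector `v` with `g(v, ∂_i) = p i` for all `i`. -/
noncomputable def raise (g : Metric n M) (x : M) (p : Fin n → ℝ) :
    TangentSpace 𝓘(ℝ, EuclideanSpace ℝ (Fin n)) x :=
  ∑ i, ∑ j, ((gram g x x)⁻¹ i j * p i) • coordField x j x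

/-- The right-hand side of the Koszul formula, i.e. `g(∇_X Y, Z)` for the Levi-Civita
connection `∇`. -/
noncomputable def koszul (g : Metric n M) (X Y Z : VField n M) (x : M) : ℝ :=
  (1 / 2) *
    (dirDeriv X (fun y => g.inner y (Y y) (Z y)) x
      + dirDeriv Y (fun y => g.inner y (X y) (Z y)) x
      - dirDeriv Z (fun y => g.inner y (X y) (Y y)) x
      + g.inner x (VectorField.mlieBracket 𝓘(ℝ, EuclideanSpace ℝ (Fin n)) X Y x) (Z x)
      - g.inner x (VectorField.mlieBracket 𝓘(ℝ, EuclideanSpace ℝ (Fin n)) X Z x) (Y x)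
      - g.inner x (VectorField.mlieBracket 𝓘(ℝ, EuclideanSpace ℝ (Fin n)) Y Z x) (X x))

/-- The Levi-Civita connection: `∇_X Y` at `x` is the vector whose inner products with the
coordinate vectors `∂_i` at `x` are given by the Koszul formula. -/
noncomputable def leviCivita (g : Metric n M) (X Y : VField n M) : VField n M := fun x =>
  raise g x (fun i => koszul g X Y (coordField x i) x)

/-- The gradient `♯ df`. -/
noncomputable def grad (g : Metric n M) (f : M → ℝ) : VField n M := fun x =>
  raise g x (fun i => dirDeriv (coordField x i) f x)

/-- The divergence relative to the Riemannian volume, `(√det g)⁻¹ ∑ ∂_i (√det g · X^i)`, computed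
at `x` in the preferred chart at `x`. -/
noncomputable def divergence (g : Metric n M) (X : VField n M) (x : M) : ℝ :=
  (density g x x)⁻¹ * LinearMap.trace ℝ (EuclideanSpace ℝ (Fin n))
    (fderiv ℝ (fun y : EuclideanSpace ℝ (Fin n) =>
      density g x ((extChartAt 𝓘(ℝ, EuclideanSpace ℝ (Fin n)) x).symm y) •
        (mfderiv 𝓘(ℝ, EuclideanSpace ℝ (Fin n)) 𝓘(ℝ, EuclideanSpace ℝ (Fin n))
          (extChartAt 𝓘(ℝ, EuclideanSpace ℝ (Fin n)) x)
          ((extChartAt 𝓘(ℝ, EuclideanSpace ℝ (Fin n)) x).symm y)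
          (X ((extChartAt 𝓘(ℝ, EuclideanSpace ℝ (Fin n)) x).symm y)) :
            EuclideanSpace ℝ (Fin n)))
      (extChartAt 𝓘(ℝ, EuclideanSpace ℝ (Fin n)) x x) :
        EuclideanSpace ℝ (Fin n) →ₗ[ℝ] EuclideanSpace ℝ (Fin n))

/-- The Laplace–Beltrami operator. -/
noncomputable def laplacian (g : Metric n M) (f : M → ℝ) : M → ℝ :=
  divergence g (grad g f)

/-- The inner product of `k`-covectors at `x` induced by `g`, for which the wedge products
`e^{i₁} ∧ ⋯ ∧ e^{i_k}`, `i₁ < ⋯ < i_k`, of an orthonormal coframe are orthonormal. -/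
noncomputable def formInner (g : Metric n M) {k : ℕ} (x : M)
    (α β : TangentSpace 𝓘(ℝ, EuclideanSpace ℝ (Fin n)) x [⋀^Fin k]→L[ℝ] ℝ) : ℝ :=
  ((k.factorial : ℝ))⁻¹ * ∑ a : Fin k → Fin n, ∑ b : Fin k → Fin n,
    (∏ l, (gram g x x)⁻¹ (a l) (b l)) *
      α (fun l => coordField x (a l) x) * β (fun l => coordField x (b l) x)

/-- The Riemannian volume measure: `M` is cut into countably many pieces, each in the domain of a
chart, and on each piece the measure is `√det(g_{ij})` times Lebesgue measure in the chart. -/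
noncomputable def riemVolume [SecondCountableTopology M] [Nonempty M] [MeasurableSpace M]
    (g : Metric n M) : Measure M :=
  Measure.sum fun i : ℕ =>
    Measure.map (extChartAt 𝓘(ℝ, EuclideanSpace ℝ (Fin n)) (chartCentre n M i)).symm
      (((volume : Measure (EuclideanSpace ℝ (Fin n))).restrict
        ((extChartAt 𝓘(ℝ, EuclideanSpace ℝ (Fin n)) (chartCentre n M i)).target ∩
          (extChartAt 𝓘(ℝ, EuclideanSpace ℝ (Fin n)) (chartCentre n M i)).symm ⁻¹'
            disjointed (fun j =>
              (extChartAt 𝓘(ℝ, EuclideanSpace ℝ (Fin n)) (chartCentre n M j)).source) i)).withDensity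
        (fun y => ENNReal.ofReal (density g (chartCentre n M i)
          ((extChartAt 𝓘(ℝ, EuclideanSpace ℝ (Fin n)) (chartCentre n M i)).symm y))))

section FormalDual

variable [SecondCountableTopology M] [Nonempty M] [MeasurableSpace M]

/-- The `L²` inner product `⟨α, β⟩ = ∫_M α ∧ ⋆β` of forms, one of which has compact support. -/
noncomputable def l2Inner (g : Metric n M) (α β : Form n M) : ℝ :=
  ∫ x, ∑ k ∈ Finset.range (n + 1), formInner g x (α k x) (β k x) ∂(riemVolume g)

/-- `ξ` is the value at `η` of the formal dual of the operator `T`. -/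
def IsFormalDualAt (g : Metric n M) (T : Form n M → Form n M) (η ξ : Form n M) : Prop :=
  IsSmoothForm ξ ∧ ∀ α : Form n M, IsSmoothForm α → IsCompactlySupported α →
    l2Inner g (T α) η = l2Inner g α ξ

open Classical in
/-- The formal dual of an operator on forms (and `0` where there is none). -/
noncomputable def formalDual (g : Metric n M) (T : Form n M → Form n M) (η : Form n M) :
    Form n M :=
  if h : ∃ ξ, IsFormalDualAt g T η ξ then h.choose else 0

/-- The codifferential `δ`: the formal dual of the exterior derivative. -/
noncomputable def codiff (g : Metric n M) : Form n M → Form n M := formalDual g extD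

end FormalDual

/-! ## Orthogonal splittings -/

/-- An orthogonal splitting `TM = H ⊕ V` of the tangent bundle into smooth subbundles. -/
structure Splitting (g : Metric n M) where
  /-- The horizontal bundle. -/
  H : ∀ x : M, Submodule ℝ (TangentSpace 𝓘(ℝ, EuclideanSpace ℝ (Fin n)) x)
  /-- The vertical bundle. -/
  V : ∀ x : M, Submodule ℝ (TangentSpace 𝓘(ℝ, EuclideanSpace ℝ (Fin n)) x)
  smooth_H : IsSmoothSubbundle H
  smooth_V : IsSmoothSubbundle V
  isCompl : ∀ x, IsCompl (H x) (V x)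
  orthogonal : ∀ x, ∀ v ∈ H x, ∀ w ∈ V x, g.inner x v w = 0

variable {g : Metric n M} (S : Splitting g)

/-- The projection of `TM` to `H`. -/
noncomputable def Splitting.prH (x : M) :
    TangentSpace 𝓘(ℝ, EuclideanSpace ℝ (Fin n)) x →L[ℝ]
      TangentSpace 𝓘(ℝ, EuclideanSpace ℝ (Fin n)) x :=
  haveI : FiniteDimensional ℝ (TangentSpace 𝓘(ℝ, EuclideanSpace ℝ (Fin n)) x) :=
    inferInstanceAs (FiniteDimensional ℝ (EuclideanSpace ℝ (Fin n)))
  haveI : T2Space (TangentSpace 𝓘(ℝ, EuclideanSpace ℝ (Fin n)) x) :=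
    inferInstanceAs (T2Space (EuclideanSpace ℝ (Fin n)))
  LinearMap.toContinuousLinearMap ((S.H x).projection (S.V x) (S.isCompl x))

/-- The projection of `TM` to `V`. -/
noncomputable def Splitting.prV (x : M) :
    TangentSpace 𝓘(ℝ, EuclideanSpace ℝ (Fin n)) x →L[ℝ]
      TangentSpace 𝓘(ℝ, EuclideanSpace ℝ (Fin n)) x :=
  haveI : FiniteDimensional ℝ (TangentSpace 𝓘(ℝ, EuclideanSpace ℝ (Fin n)) x) :=
    inferInstanceAs (FiniteDimensional ℝ (EuclideanSpace ℝ (Fin n)))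
  haveI : T2Space (TangentSpace 𝓘(ℝ, EuclideanSpace ℝ (Fin n)) x) :=
    inferInstanceAs (T2Space (EuclideanSpace ℝ (Fin n)))
  LinearMap.toContinuousLinearMap ((S.V x).projection (S.H x) (S.isCompl x).symm)

/-- The horizontal part of a vector field. -/
noncomputable def Splitting.hor (X : VField n M) : VField n M := fun x => S.prH x (X x)

/-- The vertical part of a vector field. -/
noncomputable def Splitting.ver (X : VField n M) : VField n M := fun x => S.prV x (X x)

/-- The connection `∇̊_A Z` of the splitting. -/
noncomputable def Splitting.connection (A Z : VField n M) : VField n M := fun x =>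
  S.prH x (leviCivita g (S.hor A) (S.hor Z) x)
    + S.prV x (leviCivita g (S.ver A) (S.ver Z) x)
    + S.prH x (VectorField.mlieBracket 𝓘(ℝ, EuclideanSpace ℝ (Fin n)) (S.ver A) (S.hor Z) x)
    + S.prV x (VectorField.mlieBracket 𝓘(ℝ, EuclideanSpace ℝ (Fin n)) (S.hor A) (S.ver Z) x)

/-- The condition `∇̊ g = 0`. -/
def Splitting.IsMetric : Prop :=
  ∀ A Z W : VField n M, IsSmoothVField A → IsSmoothVField Z → IsSmoothVField W → ∀ x : M,
    dirDeriv A (fun y => g.inner y (Z y) (W y)) x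
      = g.inner x (S.connection A Z x) (W x) + g.inner x (Z x) (S.connection A W x)

/-- The sub-Laplacian `Δ_h f = div ♯^{h*} df`; here `♯^{h*} df` is the horizontal part of the
gradient, and the divergence is relative to the Riemannian volume. -/
noncomputable def Splitting.subLaplacian (f : M → ℝ) : M → ℝ :=
  divergence g (S.hor (grad g f))

/-- The part of degree `(a, b)` of a form: `a` counts the horizontal and `b` the vertical
slots. -/
noncomputable def Splitting.part (a b : ℤ) (η : Form n M) : Form n M := fun k x =>
  bigradedPart (S.prH x) (S.prV x) a b (η k x)

/-- The component of degree `(a, b)` of an operator on forms. -/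
noncomputable def Splitting.component (T : Form n M → Form n M) (a b : ℤ) (η : Form n M) :
    Form n M :=
  ∑ p ∈ Finset.range (n + 1), ∑ q ∈ Finset.range (n + 1),
    S.part (p + a) (q + b) (T (S.part p q η))

/-- The component `d^{a,b}` of the exterior derivative. -/
noncomputable def Splitting.d (a b : ℤ) : Form n M → Form n M := S.component extD a b

/-- The component `δ^{a,b}` of the codifferential. -/
noncomputable def Splitting.δ [SecondCountableTopology M] [Nonempty M] [MeasurableSpace M]
    (a b : ℤ) : Form n M → Form n M := S.component (codiff g) a b

end Riemannian

end GradedForms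

open scoped Manifold ContDiff

namespace GradedForms

open MeasureTheory Bundle

/-! ## Exterior algebra over Euclidean space -/

/-! All assertions are local, so they can be tested in an orthonormal frame each of whose members is
horizontal or vertical. In such a frame a form is a function with values in the exterior algebra.
The exterior multiplications e_a and contractions i_a satisfy the canonical anticommutation
relations, and the coefficientwise derivatives D_a commute with all of them. With the structure
functions C_abc = g([e_a, e_b], e_c) one has d = Σ e_a D_a - ½ Σ C_abc e_a e_b i_c, and δ is the
analogous expression obtained by integration by parts (`FrameOps.d`, `FrameOps.δ`).

The geometry enters only through C. Integrability gives C_abc = 0 for a, b vertical and c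
horizontal. On a vertical and a horizontal argument, ∇̊ is a projected Lie bracket, so ∇̊g = 0 makes
C_abc skew in b, c whenever a has one type and b, c have the other. Hence d is a sum of pieces of
degrees (1,0), (0,1), (2,-1), and δ is a sum of pieces of the opposite degrees (`FrameOps.d_eq`,
`FrameOps.δ_eq`). The (1,1)-part of d² = 0 says that d^{1,0} and d^{0,1} anticommute
(`FrameOps.dPart_anticomm`).

To replace d^{1,0} by δ^{-1,0}, use an algebraic partial Hodge star: conjugation by the product of
the Clifford elements e_a + i_a over horizontal a. Up to sign it exchanges e_a with i_a for
horizontal a and fixes everything else. By skewness it takes d^{1,0} to ±δ^{-1,0} and d^{0,1} to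
±d^{0,1} (`FrameOps.IsSwap.dPart`, `FrameOps.IsSwap.dPart_compl`), and so turns one anticommutation
relation into another. With the two types exchanged, and with a second swap, d^{1,0} and δ^{-1,0}
anticommute with both d^{0,1} and δ^{0,-1}. Therefore the products δ^{-1,0} d^{1,0} and δ^{0,-1}
d^{0,1} commute. On functions these are minus the horizontal and vertical parts of Δ, and Δ is their
sum.

It remains to match this algebra with the global definitions. Chart formulas for d, brackets,
divergence and volume are rewritten in frames. The codifferential exists because the local frame
formulas are formal duals, are unique on overlaps by testing against bump functions, and glue by a
partition of unity. Bigraded components are separated as eigenspaces of the number operators Σ e_a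
i_a. -/

section Exterior

/-- The model space. -/
abbrev Vec (n : ℕ) : Type := EuclideanSpace ℝ (Fin n)

/-- Alternating `k`-forms on the model space. -/
abbrev Cov (n k : ℕ) : Type := Vec n [⋀^Fin k]→L[ℝ] ℝ

/-- Alternating forms of all degrees on the model space. -/
abbrev Tot (n : ℕ) : Type := ∀ k, Cov n k

/-- The standard basis vectors. -/
noncomputable abbrev bvec {n : ℕ} (a : Fin n) : Vec n := EuclideanSpace.single a 1

variable {n k : ℕ}

theorem sum_coord_smul_bvec (v : Vec n) : ∑ a, v a • bvec a = v := by
  have := (EuclideanSpace.basisFun (Fin n) ℝ).sum_repr v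
  simpa using this

theorem map_eq_sum_bvec {F : Type*} [AddCommMonoid F] [Module ℝ F] (f : Vec n →ₗ[ℝ] F)
    (v : Vec n) : f v = ∑ a, v a • f (bvec a) := by
  conv_lhs => rw [← sum_coord_smul_bvec v]
  simp

/-- Values on tuples of basis vectors determine an alternating form. Finite dimensionality makes
linear maps out of these spaces continuous, hence smooth. -/
instance finiteDimensional_cov (n k : ℕ) : FiniteDimensional ℝ (Cov n k) := by
  let b := (EuclideanSpace.basisFun (Fin n) ℝ).toBasis
  let f : Cov n k →ₗ[ℝ] ((Fin k → Fin n) → ℝ) :=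
    { toFun := fun φ c => φ fun l => b (c l)
      map_add' := fun _ _ => rfl
      map_smul' := fun _ _ => rfl }
  refine FiniteDimensional.of_injective f fun φ θ h => ?_
  apply ContinuousAlternatingMap.toAlternatingMap_injective
  refine b.ext_alternating fun v _ => ?_
  exact congrFun h v

theorem cov_ext {φ θ : Cov n k}
    (h : ∀ c : Fin k → Fin n, φ (fun l => bvec (c l)) = θ (fun l => bvec (c l))) : φ = θ := by
  apply ContinuousAlternatingMap.toAlternatingMap_injective
  refine (EuclideanSpace.basisFun (Fin n) ℝ).toBasis.ext_alternating fun v _ => ?_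
  simpa using h v

/-- Pigeonhole on basis indices. This lets sums over degrees stop at `n` although `Tot n` carries
every degree. -/
theorem cov_eq_zero_of_lt (h : n < k) (φ : Cov n k) : φ = 0 := by
  refine cov_ext fun c => ?_
  have : ¬ Function.Injective c := fun hc => by
    have := Fintype.card_le_of_injective c hc
    simp at this
    omega
  refine φ.map_eq_zero_of_not_injective _ fun hinj => this fun i j hij => hinj ?_
  simp [hij]

/-- Exterior multiplication by a covector. -/
noncomputable def wedgeLeft (l : Vec n →L[ℝ] ℝ) : Cov n k →ₗ[ℝ] Cov n (k + 1) where
  toFun φ := ContinuousAlternatingMap.alternatizeUncurryFin (l.smulRight φ)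
  map_add' φ θ := by
    rw [← ContinuousAlternatingMap.alternatizeUncurryFin_add]
    congr 1
    ext v
    simp
  map_smul' r φ := by
    rw [RingHom.id_apply, ← ContinuousAlternatingMap.alternatizeUncurryFin_smul]
    congr 1
    ext v
    simp
    ring

theorem wedgeLeft_apply (l : Vec n →L[ℝ] ℝ) (φ : Cov n k) (v : Fin (k + 1) → Vec n) :
    wedgeLeft l φ v = ∑ i : Fin (k + 1), (-1) ^ (i : ℕ) * (l (v i) * φ (i.removeNth v)) := by
  change ContinuousAlternatingMap.alternatizeUncurryFin (l.smulRight φ) v = _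
  rw [ContinuousAlternatingMap.alternatizeUncurryFin_apply]
  simp

/-- Expansion of `f` in the dual basis; applied to a derivative it is the formula dφ = Σ dx^a ∧ ∂_a
φ. -/
theorem alternatizeUncurryFin_eq_sum (f : Vec n →L[ℝ] Cov n k) :
    ContinuousAlternatingMap.alternatizeUncurryFin f =
      ∑ a, wedgeLeft (EuclideanSpace.proj a) (f (bvec a)) := by
  have : f = ∑ a, (EuclideanSpace.proj a : Vec n →L[ℝ] ℝ).smulRight (f (bvec a)) := by
    ext1 v
    rw [sum_apply]
    simpa using map_eq_sum_bvec f.toLinearMap v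
  conv_lhs => rw [this]
  exact map_sum (ContinuousAlternatingMap.alternatizeUncurryFinCLM ℝ (Vec n) ℝ) _ _

/-! ### Canonical anticommutation relations -/

theorem wedgeLeft_add_left (l m : Vec n →L[ℝ] ℝ) (φ : Cov n k) :
    wedgeLeft (l + m) φ = wedgeLeft l φ + wedgeLeft m φ := by
  ext v
  simp [wedgeLeft_apply, add_mul, mul_add, Finset.sum_add_distrib]

/-- The bilinear map l ⊗ l ⊗ φ is symmetric in its first two arguments, and alternating twice kills
it. -/
theorem wedgeLeft_self (l : Vec n →L[ℝ] ℝ) (φ : Cov n k) : wedgeLeft l (wedgeLeft l φ) = 0 := by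
  have := ContinuousAlternatingMap.alternatizeUncurryFin_alternatizeUncurryFinCLM_comp_of_symmetric
    (f := l.smulRight (l.smulRight φ)) (fun x y => by
      ext v
      simp
      ring)
  rw [← this]
  change ContinuousAlternatingMap.alternatizeUncurryFin _ = _
  congr 1
  ext1 v
  simp
  rfl

/-- Polarization of l ∧ l ∧ φ = 0 at l + m. -/
theorem wedgeLeft_wedgeLeft (l m : Vec n →L[ℝ] ℝ) (φ : Cov n k) :
    wedgeLeft l (wedgeLeft m φ) = -wedgeLeft m (wedgeLeft l φ) := by
  have h := wedgeLeft_self (l + m) φ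
  simp only [wedgeLeft_add_left, map_add, wedgeLeft_self, zero_add, add_zero] at h
  exact eq_neg_of_add_eq_zero_left ((add_comm _ _).trans h)

theorem curryLeft_curryLeft (x y : Vec n) (φ : Cov n (k + 2)) :
    (φ.curryLeft x).curryLeft y = -(φ.curryLeft y).curryLeft x := by
  have h := φ.curryLeft_same (x + y)
  simp only [map_add, ContinuousAlternatingMap.curryLeft_add, add_apply,
    ContinuousAlternatingMap.curryLeft_same, zero_add, add_zero] at h
  exact eq_neg_of_add_eq_zero_left ((add_comm _ _).trans h)

/-- In the alternating sum the slot 0 feeds x to l. All other slots leave x in the first argument of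
φ, and their index shift costs one sign. -/
theorem curryLeft_wedgeLeft_succ (l : Vec n →L[ℝ] ℝ) (x : Vec n) (φ : Cov n (k + 1)) :
    (wedgeLeft l φ).curryLeft x = l x • φ - wedgeLeft l (φ.curryLeft x) := by
  ext v
  simp only [ContinuousAlternatingMap.curryLeft_apply_apply, wedgeLeft_apply,
    ContinuousAlternatingMap.sub_apply, ContinuousAlternatingMap.smul_apply]
  rw [Fin.sum_univ_succ, sub_eq_add_neg, ← Finset.sum_neg_distrib]
  congr 1
  · simp [Matrix.vecCons]
  · refine Finset.sum_congr rfl fun i _ => ?_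
    have : i.succ.removeNth (Matrix.vecCons x v) = Matrix.vecCons x (i.removeNth v) := by
      ext1 j
      refine Fin.cases ?_ (fun j => ?_) j
      · simp [Fin.removeNth]
      · simp [Fin.removeNth]
    rw [this]
    simp [pow_succ]

theorem curryLeft_wedgeLeft_zero (l : Vec n →L[ℝ] ℝ) (x : Vec n) (φ : Cov n 0) :
    (wedgeLeft l φ).curryLeft x = l x • φ := by
  ext v
  simp only [ContinuousAlternatingMap.curryLeft_apply_apply, wedgeLeft_apply,
    ContinuousAlternatingMap.smul_apply]
  rw [Fin.sum_univ_one]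
  simp only [Fin.val_zero, pow_zero, one_mul, Matrix.cons_val_zero, smul_eq_mul]
  congr 2

/-- Exterior multiplication by the `a`-th standard covector. -/
noncomputable def extMul (a : Fin n) : Tot n →ₗ[ℝ] Tot n where
  toFun φ
    | 0 => 0
    | k + 1 => wedgeLeft (EuclideanSpace.proj a) (φ k)
  map_add' φ θ := by
    ext1 k
    cases k <;> simp
  map_smul' r φ := by
    ext1 k
    cases k <;> simp

/-- Contraction with the `a`-th standard vector. -/
noncomputable def intMul (a : Fin n) : Tot n →ₗ[ℝ] Tot n where
  toFun φ k := (φ (k + 1)).curryLeft (bvec a)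
  map_add' φ θ := by
    ext1 k
    simp
  map_smul' r φ := by
    ext1 k
    simp

@[simp] theorem extMul_zero (a : Fin n) (φ : Tot n) : extMul a φ 0 = 0 := rfl

@[simp] theorem extMul_succ (a : Fin n) (φ : Tot n) (k : ℕ) :
    extMul a φ (k + 1) = wedgeLeft (EuclideanSpace.proj a) (φ k) := rfl

@[simp] theorem intMul_apply (a : Fin n) (φ : Tot n) (k : ℕ) :
    intMul a φ k = (φ (k + 1)).curryLeft (bvec a) := rfl

theorem extMul_extMul (a b : Fin n) (φ : Tot n) :
    extMul a (extMul b φ) = -extMul b (extMul a φ) := by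
  ext1 k
  rcases k with _ | _ | k
  · simp
  · simp
  · simp only [Pi.neg_apply, extMul_succ]
    exact wedgeLeft_wedgeLeft _ _ _

theorem intMul_intMul (a b : Fin n) (φ : Tot n) :
    intMul a (intMul b φ) = -intMul b (intMul a φ) := by
  ext1 k
  exact curryLeft_curryLeft _ _ _

/-- In degree zero the term `extMul b (intMul a φ)` is absent, so that degree needs its own
contraction formula. -/
theorem intMul_extMul (a b : Fin n) (φ : Tot n) :
    intMul a (extMul b φ) = (if a = b then φ else 0) - extMul b (intMul a φ) := by
  have hp : (EuclideanSpace.proj b : Vec n →L[ℝ] ℝ) (bvec a) = if a = b then 1 else 0 := by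
    simp [eq_comm]
  ext1 k
  rcases k with _ | k
  · simp only [intMul_apply, extMul_succ, Pi.sub_apply, extMul_zero, sub_zero]
    rw [curryLeft_wedgeLeft_zero, hp]
    split_ifs <;> simp
  · simp only [intMul_apply, extMul_succ, Pi.sub_apply]
    rw [curryLeft_wedgeLeft_succ, hp]
    split_ifs <;> simp

/-- The inner product of `k`-forms for which the standard coframe is orthonormal. -/
noncomputable def covInner (α β : Cov n k) : ℝ :=
  ((k.factorial : ℝ))⁻¹ * ∑ c : Fin k → Fin n,
    α (fun l => bvec (c l)) * β (fun l => bvec (c l))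

theorem covInner_add_left (α α' β : Cov n k) :
    covInner (α + α') β = covInner α β + covInner α' β := by
  simp [covInner, add_mul, Finset.sum_add_distrib, mul_add]

theorem covInner_smul_left (r : ℝ) (α β : Cov n k) :
    covInner (r • α) β = r * covInner α β := by
  simp only [covInner, ContinuousAlternatingMap.smul_apply, smul_eq_mul, mul_assoc,
    ← Finset.mul_sum]
  ring

theorem covInner_comm (α β : Cov n k) : covInner α β = covInner β α := by
  simp [covInner, mul_comm]

theorem covInner_self_nonneg (α : Cov n k) : 0 ≤ covInner α α := by
  unfold covInner
  have := Finset.sum_nonneg fun (c : Fin k → Fin n) (_ : c ∈ Finset.univ) =>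
    mul_self_nonneg (α fun l => bvec (c l))
  positivity

theorem covInner_self_eq_zero {α : Cov n k} (h : covInner α α = 0) : α = 0 := by
  refine cov_ext fun c => ?_
  unfold covInner at h
  rcases mul_eq_zero.1 h with h | h
  · exact absurd h (by positivity)
  · exact mul_self_eq_zero.1 ((Finset.sum_eq_zero_iff_of_nonneg
      fun _ _ => mul_self_nonneg _).1 h c (Finset.mem_univ c))

/-- The pairing of forms of degree `k` as a bilinear map. -/
noncomputable def covInnerₗ (n k : ℕ) : Cov n k →ₗ[ℝ] Cov n k →ₗ[ℝ] ℝ :=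
  LinearMap.mk₂ ℝ covInner covInner_add_left covInner_smul_left
    (fun α β β' => by
      rw [covInner_comm, covInner_add_left, covInner_comm β, covInner_comm β'])
    (fun r α β => by rw [covInner_comm, covInner_smul_left, covInner_comm]; rfl)

/-- Every slot of the alternating sum contributes the same amount, and there are k + 1 slots, which
turns 1/(k+1)! into 1/k!. -/
theorem covInner_wedgeLeft (a : Fin n) (φ : Cov n k) (θ : Cov n (k + 1)) :
    covInner (wedgeLeft (EuclideanSpace.proj a) φ) θ = covInner φ (θ.curryLeft (bvec a)) := by
  have key : ∀ i : Fin (k + 1), ∑ c : Fin (k + 1) → Fin n,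
      (-1) ^ (i : ℕ) * ((bvec (c i) : Vec n) a * φ (i.removeNth fun l => bvec (c l))) *
        θ (fun l => bvec (c l)) =
      ∑ c : Fin k → Fin n, φ (fun l => bvec (c l)) *
        θ (Matrix.vecCons (bvec a) fun l => bvec (c l)) := by
    intro i
    -- Index tuples are split into the entry at slot i and the rest. Only the entry a survives, and
    -- moving it to the front yields a second sign (-1)^i that cancels the first.
    rw [← (Fin.insertNthEquiv (fun _ => Fin n) i).sum_comp, Fintype.sum_prod_type,
      Finset.sum_eq_single a]
    · refine Finset.sum_congr rfl fun c _ => ?_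
      have h1 : (fun l => (bvec (((Fin.insertNthEquiv (fun _ => Fin n) i) (a, c)) l) : Vec n)) =
          i.insertNth (bvec a) (fun l => bvec (c l)) := by
        ext1 l
        refine Fin.succAboveCases i ?_ (fun l => ?_) l <;> simp
      rw [h1, ContinuousAlternatingMap.map_insertNth, Fin.removeNth_insertNth]
      have h2 : ((-1 : ℝ) ^ (i : ℕ)) * (-1) ^ (i : ℕ) = 1 := by
        rw [← mul_pow]; simp
      simp only [Fin.insertNthEquiv_apply, Fin.insertNth_apply_same, PiLp.single_apply, if_true,
        one_mul]
      rw [zsmul_eq_mul]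
      push_cast
      linear_combination (φ (fun l => bvec (c l)) *
        θ (Matrix.vecCons (bvec a) fun l => bvec (c l))) * h2
    · intro b _ hb
      refine Finset.sum_eq_zero fun c _ => ?_
      simp [Ne.symm hb]
    · simp
  unfold covInner
  simp only [wedgeLeft_apply, ContinuousAlternatingMap.curryLeft_apply_apply, Finset.sum_mul]
  rw [Finset.sum_comm]
  simp only [PiLp.proj_apply]
  rw [Finset.sum_congr rfl fun i _ => key i, Finset.sum_const, Finset.card_univ, Fintype.card_fin,
    nsmul_eq_mul, Nat.factorial_succ]
  push_cast
  have : (k.factorial : ℝ) ≠ 0 := by positivity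
  field_simp

/-- The inner product of forms of all degrees. -/
noncomputable def totInner (φ θ : Tot n) : ℝ := ∑ k ∈ Finset.range (n + 1), covInner (φ k) (θ k)

/-- Adjointness degree by degree, with a shift by one. The unmatched terms vanish: `extMul a φ` has
no part of degree 0, and the part of `θ` of degree n + 1 is zero. -/
theorem totInner_extMul (a : Fin n) (φ θ : Tot n) :
    totInner (extMul a φ) θ = totInner φ (intMul a θ) := by
  unfold totInner
  rw [Finset.sum_range_succ', Finset.sum_range_succ]
  have h1 : covInner (extMul a φ 0) (θ 0) = 0 := by simp [covInner]
  have h2 : intMul a θ n = 0 := by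
    rw [intMul_apply, cov_eq_zero_of_lt (Nat.lt_succ_self n) (θ (n + 1))]
    simp
  have h3 : covInner (φ n) (intMul a θ n) = 0 := by rw [h2]; simp [covInner]
  rw [h1, h3]
  congr 1
  exact Finset.sum_congr rfl fun k _ => covInner_wedgeLeft a (φ k) (θ (k + 1))

theorem totInner_comm (φ θ : Tot n) : totInner φ θ = totInner θ φ := by
  simp only [totInner, covInner_comm]

theorem totInner_add_left (φ φ' θ : Tot n) :
    totInner (φ + φ') θ = totInner φ θ + totInner φ' θ := by
  simp [totInner, covInner_add_left, Finset.sum_add_distrib]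

theorem totInner_smul_left (r : ℝ) (φ θ : Tot n) :
    totInner (r • φ) θ = r * totInner φ θ := by
  simp [totInner, covInner_smul_left, Finset.mul_sum]

theorem totInner_self_nonneg (φ : Tot n) : 0 ≤ totInner φ φ :=
  Finset.sum_nonneg fun _ _ => covInner_self_nonneg _

theorem totInner_self_eq_zero {φ : Tot n} (h : totInner φ φ = 0) : φ = 0 := by
  ext1 k
  by_cases hk : k < n + 1
  · exact covInner_self_eq_zero ((Finset.sum_eq_zero_iff_of_nonneg
      fun _ _ => covInner_self_nonneg _).1 h k (Finset.mem_range.2 hk))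
  · exact cov_eq_zero_of_lt (by omega) _

end Exterior

end GradedForms

namespace GradedForms

open MeasureTheory Bundle

/-! ## The algebra generated by a frame -/

section FrameAlgebra

set_option linter.unusedSectionVars false

variable {N A : Type*} [Fintype N] [DecidableEq N] [Ring A] [Algebra ℝ A]

/-- Exterior and interior multiplications `e a`, `i a` by the members of an orthonormal frame,
derivatives `D a` in the directions of the frame, and its structure functions `C a b c`. -/
structure FrameOps (N A : Type*) [DecidableEq N] [Ring A] where
  e : N → A
  i : N → A
  D : N → A
  C : N → N → N → A
  e_e : ∀ a b, e a * e b = -(e b * e a)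
  i_i : ∀ a b, i a * i b = -(i b * i a)
  i_e : ∀ a b, i a * e b = (if a = b then 1 else 0) - e b * i a
  D_e : ∀ a b, D a * e b = e b * D a
  D_i : ∀ a b, D a * i b = i b * D a
  C_e : ∀ a b c d, C a b c * e d = e d * C a b c
  C_i : ∀ a b c d, C a b c * i d = i d * C a b c
  C_swap : ∀ a b c, C a b c = -C b a c

namespace FrameOps

variable (F : FrameOps N A)

/-- The exterior derivative. -/
noncomputable def d : A :=
  ∑ a, F.e a * F.D a - (1 / 2 : ℝ) • ∑ a, ∑ b, ∑ c, F.C a b c * (F.e a * F.e b * F.i c)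

/-- The divergence of a frame field. -/
noncomputable def div (a : N) : A := ∑ b, F.C b a b

/-- The codifferential. -/
noncomputable def δ : A :=
  -∑ a, F.D a * F.i a - ∑ a, F.div a * F.i a
    - (1 / 2 : ℝ) • ∑ a, ∑ b, ∑ c, F.C a b c * (F.e c * F.i b * F.i a)

variable (S : Finset N)

/-- The rotation of the frame members outside `S` along the frame member `a`. -/
noncomputable def rot (a : N) : A := ∑ b ∈ Sᶜ, ∑ c ∈ Sᶜ, F.C a b c * (F.e b * F.i c)

/-- The part of the exterior derivative in the directions of `S`. -/
noncomputable def dPart : A :=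
  ∑ a ∈ S, F.e a * (F.D a - F.rot S a)
    - (1 / 2 : ℝ) • ∑ a ∈ S, ∑ b ∈ S, ∑ c ∈ S, F.C a b c * (F.e a * F.e b * F.i c)

/-- The part of the exterior derivative that comes from the curvature of `S`. -/
noncomputable def dCross : A :=
  -((1 / 2 : ℝ) • ∑ a ∈ S, ∑ b ∈ S, ∑ c ∈ Sᶜ, F.C a b c * (F.e a * F.e b * F.i c))

/-- The part of the codifferential in the directions of `S`. -/
noncomputable def δPart : A :=
  -∑ a ∈ S, (F.D a - F.rot S a) * F.i a - ∑ a ∈ S, F.div a * F.i a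
    - (1 / 2 : ℝ) • ∑ a ∈ S, ∑ b ∈ S, ∑ c ∈ S, F.C a b c * (F.e c * F.i b * F.i a)

/-- The part of the codifferential that comes from the curvature of `S`. -/
noncomputable def δCross : A :=
  -((1 / 2 : ℝ) • ∑ a ∈ S, ∑ b ∈ S, ∑ c ∈ Sᶜ, F.C a b c * (F.e c * F.i b * F.i a))

/-- The frame rotates infinitesimally by isometries of the complement of `S` along `S`. -/
def IsSkew : Prop := ∀ a ∈ S, ∀ b ∈ Sᶜ, ∀ c ∈ Sᶜ, F.C a b c = -F.C a c b

variable {F S}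

theorem IsSkew.diag (h : F.IsSkew S) {a b : N} (ha : a ∈ S) (hb : b ∈ Sᶜ) : F.C a b b = 0 := by
  have h1 := h a ha b hb b hb
  have h2 : (2 : ℝ) • F.C a b b = 0 := by
    rw [two_smul]
    exact add_eq_zero_iff_eq_neg.2 h1
  exact (smul_eq_zero.1 h2).resolve_left two_ne_zero

/-- A sum over triples splits according to membership. -/
theorem sum_triple_split (S : Finset N) (f : N → N → N → A) :
    ∑ a, ∑ b, ∑ c, f a b c =
      (∑ a ∈ S, ∑ b ∈ S, ∑ c ∈ S, f a b c) + (∑ a ∈ S, ∑ b ∈ S, ∑ c ∈ Sᶜ, f a b c)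
      + (∑ a ∈ S, ∑ b ∈ Sᶜ, ∑ c ∈ S, f a b c) + (∑ a ∈ S, ∑ b ∈ Sᶜ, ∑ c ∈ Sᶜ, f a b c)
      + (∑ a ∈ Sᶜ, ∑ b ∈ S, ∑ c ∈ S, f a b c) + (∑ a ∈ Sᶜ, ∑ b ∈ S, ∑ c ∈ Sᶜ, f a b c)
      + (∑ a ∈ Sᶜ, ∑ b ∈ Sᶜ, ∑ c ∈ S, f a b c) + (∑ a ∈ Sᶜ, ∑ b ∈ Sᶜ, ∑ c ∈ Sᶜ, f a b c) := by
  have h1 (g : N → A) : ∑ a, g a = ∑ a ∈ S, g a + ∑ a ∈ Sᶜ, g a :=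
    (Finset.sum_add_sum_compl S g).symm
  simp only [h1, Finset.sum_add_distrib]
  abel

/-- The two orders of a mixed pair (a in S, b outside) contribute equally, which absorbs the factor
½. With c outside S they form the rotation term of `dPart S`, with c in S that of `dPart Sᶜ`. The
terms with a, b outside and c inside vanish by integrability. -/
theorem d_eq (hint : ∀ a ∈ Sᶜ, ∀ b ∈ Sᶜ, ∀ c ∈ S, F.C a b c = 0) :
    F.d = F.dPart S + F.dPart Sᶜ + F.dCross S := by
  have h0 : ∑ a ∈ Sᶜ, ∑ b ∈ Sᶜ, ∑ c ∈ S, F.C a b c * (F.e a * F.e b * F.i c) = 0 :=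
    Finset.sum_eq_zero fun a ha => Finset.sum_eq_zero fun b hb => Finset.sum_eq_zero fun c hc => by
      rw [hint a ha b hb c hc, zero_mul]
  have hswap (a b c : N) : F.C b a c * (F.e b * F.e a * F.i c) =
      F.C a b c * (F.e a * F.e b * F.i c) := by
    rw [F.C_swap b a c, F.e_e b a]; simp
  have h1 : ∑ a ∈ Sᶜ, ∑ b ∈ S, ∑ c ∈ Sᶜ, F.C a b c * (F.e a * F.e b * F.i c) =
      ∑ a ∈ S, ∑ b ∈ Sᶜ, ∑ c ∈ Sᶜ, F.C a b c * (F.e a * F.e b * F.i c) := by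
    rw [Finset.sum_comm]
    simp only [hswap]
  have h2 : ∑ a ∈ S, ∑ b ∈ Sᶜ, ∑ c ∈ S, F.C a b c * (F.e a * F.e b * F.i c) =
      ∑ a ∈ Sᶜ, ∑ b ∈ S, ∑ c ∈ S, F.C a b c * (F.e a * F.e b * F.i c) := by
    rw [Finset.sum_comm]
    simp only [hswap]
  have hr (T : Finset N) : ∑ a ∈ T, F.e a * F.rot T a =
      ∑ a ∈ T, ∑ b ∈ Tᶜ, ∑ c ∈ Tᶜ, F.C a b c * (F.e a * F.e b * F.i c) := by
    simp only [rot, Finset.mul_sum]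
    refine Finset.sum_congr rfl fun a _ => Finset.sum_congr rfl fun b _ =>
      Finset.sum_congr rfl fun c _ => ?_
    rw [← mul_assoc, ← F.C_e, mul_assoc, mul_assoc]
  have hD : ∑ a, F.e a * F.D a = ∑ a ∈ S, F.e a * F.D a + ∑ a ∈ Sᶜ, F.e a * F.D a :=
    (Finset.sum_add_sum_compl S _).symm
  simp only [d, dPart, dCross, mul_sub, Finset.sum_sub_distrib, hr, compl_compl]
  rw [sum_triple_split S, h0, h1, h2, hD]
  module

/-- As for `d`, except that the mixed cubic terms appear with the roles of b and c exchanged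
relative to `rot`. Skewness of the structure functions accounts for this exchange. -/
theorem δ_eq (hint : ∀ a ∈ Sᶜ, ∀ b ∈ Sᶜ, ∀ c ∈ S, F.C a b c = 0) (hS : F.IsSkew S)
    (hS' : F.IsSkew Sᶜ) :
    F.δ = F.δPart S + F.δPart Sᶜ + F.δCross S := by
  have h0 : ∑ a ∈ Sᶜ, ∑ b ∈ Sᶜ, ∑ c ∈ S, F.C a b c * (F.e c * F.i b * F.i a) = 0 :=
    Finset.sum_eq_zero fun a ha => Finset.sum_eq_zero fun b hb => Finset.sum_eq_zero fun c hc => by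
      rw [hint a ha b hb c hc, zero_mul]
  have hswap (a b c : N) : F.C b a c * (F.e c * F.i a * F.i b) =
      F.C a b c * (F.e c * F.i b * F.i a) := by
    rw [F.C_swap b a c, mul_assoc, F.i_i a b]; simp [mul_assoc]
  have h1 : ∑ a ∈ Sᶜ, ∑ b ∈ S, ∑ c ∈ Sᶜ, F.C a b c * (F.e c * F.i b * F.i a) =
      ∑ a ∈ S, ∑ b ∈ Sᶜ, ∑ c ∈ Sᶜ, F.C a b c * (F.e c * F.i b * F.i a) := by
    rw [Finset.sum_comm]
    simp only [hswap]
  have h2 : ∑ a ∈ S, ∑ b ∈ Sᶜ, ∑ c ∈ S, F.C a b c * (F.e c * F.i b * F.i a) =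
      ∑ a ∈ Sᶜ, ∑ b ∈ S, ∑ c ∈ S, F.C a b c * (F.e c * F.i b * F.i a) := by
    rw [Finset.sum_comm]
    simp only [hswap]
  have hr (T : Finset N) (hT : F.IsSkew T) : ∑ a ∈ T, F.rot T a * F.i a =
      -∑ a ∈ T, ∑ b ∈ Tᶜ, ∑ c ∈ Tᶜ, F.C a b c * (F.e c * F.i b * F.i a) := by
    rw [← Finset.sum_neg_distrib]
    refine Finset.sum_congr rfl fun a ha => ?_
    rw [rot, Finset.sum_comm, Finset.sum_mul, ← Finset.sum_neg_distrib]
    refine Finset.sum_congr rfl fun b hb => ?_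
    rw [Finset.sum_mul, ← Finset.sum_neg_distrib]
    refine Finset.sum_congr rfl fun c hc => ?_
    rw [hT a ha c hc b hb]
    simp [mul_assoc]
  have hD : ∑ a, F.D a * F.i a = ∑ a ∈ S, F.D a * F.i a + ∑ a ∈ Sᶜ, F.D a * F.i a :=
    (Finset.sum_add_sum_compl S _).symm
  have hV : ∑ a, F.div a * F.i a = ∑ a ∈ S, F.div a * F.i a + ∑ a ∈ Sᶜ, F.div a * F.i a :=
    (Finset.sum_add_sum_compl S _).symm
  have hS'' := hr Sᶜ hS'
  simp only [compl_compl] at hS''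
  simp only [δ, δPart, δCross, sub_mul, Finset.sum_sub_distrib, hr S hS, hS'']
  rw [sum_triple_split S, h0, h1, h2, hD, hV]
  module

/-- Terms with b outside S are -C a b b, which skewness kills. So the divergence of a frame member
in S is computed inside S alone. -/
theorem IsSkew.div_eq (hS : F.IsSkew S) {a : N} (ha : a ∈ S) : F.div a = ∑ b ∈ S, F.C b a b := by
  rw [div, ← Finset.sum_add_sum_compl S, add_eq_left]
  refine Finset.sum_eq_zero fun b hb => ?_
  rw [F.C_swap, hS.diag ha hb, neg_zero]

/-! ### Number operator and weights -/

variable (F S) in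
/-- The operator that counts factors in `S`. -/
noncomputable def num : A := ∑ a ∈ S, F.e a * F.i a

variable (F S) in
/-- The element `x` raises the number of factors in `S` by `w`. -/
def HasWeight (w : ℝ) (x : A) : Prop := F.num S * x - x * F.num S = w • x

/-- The commutator with the number operator is a derivation, so weights add under products. -/
theorem HasWeight.mul {w v : ℝ} {x y : A} (hx : F.HasWeight S w x) (hy : F.HasWeight S v y) :
    F.HasWeight S (w + v) (x * y) := by
  unfold HasWeight at *
  calc _ = (F.num S * x - x * F.num S) * y + x * (F.num S * y - y * F.num S) := by noncomm_ring
    _ = _ := by rw [hx, hy, add_smul, smul_mul_assoc, mul_smul_comm]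

theorem HasWeight.add {w : ℝ} {x y : A} (hx : F.HasWeight S w x) (hy : F.HasWeight S w y) :
    F.HasWeight S w (x + y) := by
  unfold HasWeight at *
  rw [smul_add, ← hx, ← hy]; noncomm_ring

theorem HasWeight.smul {w : ℝ} {x : A} (r : ℝ) (hx : F.HasWeight S w x) :
    F.HasWeight S w (r • x) := by
  unfold HasWeight at *
  rw [smul_comm, ← hx, smul_sub, mul_smul_comm, smul_mul_assoc]

theorem HasWeight.neg {w : ℝ} {x : A} (hx : F.HasWeight S w x) : F.HasWeight S w (-x) := by
  simpa using hx.smul (-1)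

theorem HasWeight.sub {w : ℝ} {x y : A} (hx : F.HasWeight S w x) (hy : F.HasWeight S w y) :
    F.HasWeight S w (x - y) := by
  rw [sub_eq_add_neg]; exact hx.add hy.neg

theorem HasWeight.sum {ι : Type*} {w : ℝ} {s : Finset ι} {x : ι → A}
    (hx : ∀ j ∈ s, F.HasWeight S w (x j)) : F.HasWeight S w (∑ j ∈ s, x j) := by
  unfold HasWeight at *
  rw [Finset.mul_sum, Finset.sum_mul, Finset.smul_sum, ← Finset.sum_sub_distrib]
  exact Finset.sum_congr rfl hx

/-- The number operator is built from the e's and i's only; this covers derivatives and structure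
functions. -/
theorem hasWeight_of_commute {x : A} (he : ∀ a, x * F.e a = F.e a * x)
    (hi : ∀ a, x * F.i a = F.i a * x) : F.HasWeight S 0 x := by
  unfold HasWeight
  rw [zero_smul, sub_eq_zero, num, Finset.sum_mul, Finset.mul_sum]
  refine Finset.sum_congr rfl fun a _ => ?_
  rw [mul_assoc, ← hi, ← mul_assoc, ← he, mul_assoc]

theorem e_i_e (a b : N) : F.e a * F.i a * F.e b - F.e b * (F.e a * F.i a) =
    if a = b then F.e b else 0 := by
  rw [mul_assoc, F.i_e, mul_sub, ← mul_assoc, ← mul_assoc, F.e_e a b]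
  split_ifs with h
  · subst h; simp
  · simp

theorem e_i_i (a b : N) : F.e a * F.i a * F.i b - F.i b * (F.e a * F.i a) =
    if a = b then -F.i b else 0 := by
  have h : F.i b * F.e a = (if a = b then 1 else 0) - F.e a * F.i b := by
    rw [F.i_e]; simp only [eq_comm]
  rw [← mul_assoc (F.i b), h, mul_assoc, F.i_i a b]
  split_ifs with h
  · subst h; noncomm_ring
  · noncomm_ring

theorem hasWeight_e (b : N) : F.HasWeight S (if b ∈ S then 1 else 0) (F.e b) := by
  unfold HasWeight
  rw [num, Finset.sum_mul, Finset.mul_sum, ← Finset.sum_sub_distrib]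
  simp only [e_i_e, Finset.sum_ite_eq']
  split_ifs <;> simp

theorem hasWeight_i (b : N) : F.HasWeight S (if b ∈ S then -1 else 0) (F.i b) := by
  unfold HasWeight
  rw [num, Finset.sum_mul, Finset.mul_sum, ← Finset.sum_sub_distrib]
  simp only [e_i_i, Finset.sum_ite_eq']
  split_ifs <;> simp

theorem hasWeight_D (a : N) : F.HasWeight S 0 (F.D a) := hasWeight_of_commute (F.D_e a) (F.D_i a)

theorem hasWeight_C (a b c : N) : F.HasWeight S 0 (F.C a b c) :=
  hasWeight_of_commute (F.C_e a b c) (F.C_i a b c)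

theorem HasWeight.congr {w v : ℝ} {x : A} (hx : F.HasWeight S w x) (h : w = v) :
    F.HasWeight S v x := h ▸ hx

/-- The rotation terms involve no factor from S, and the cubic terms have two raising factors and
one lowering factor from S. -/
theorem hasWeight_dPart : F.HasWeight S 1 (F.dPart S) := by
  refine .sub (.sum fun a ha => ?_) (.smul _ (.sum fun a ha => .sum fun b hb => .sum fun c hc => ?_))
  · refine ((hasWeight_e a).mul (v := 0) (.sub (hasWeight_D a)
      (.sum fun b hb => .sum fun c hc => ?_))).congr ?_
    · refine ((hasWeight_C a b c).mul ((hasWeight_e b).mul (hasWeight_i c))).congr ?_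
      rw [if_neg (Finset.mem_compl.1 hb), if_neg (Finset.mem_compl.1 hc)]; norm_num
    · rw [if_pos ha]; norm_num
  · refine ((hasWeight_C a b c).mul
      (((hasWeight_e a).mul (hasWeight_e b)).mul (hasWeight_i c))).congr ?_
    rw [if_pos ha, if_pos hb, if_pos hc]; norm_num

/-- Factors from S occur only inside `rot Sᶜ`, where a raising factor and a lowering factor balance.
-/
theorem hasWeight_dPart_compl : F.HasWeight S 0 (F.dPart Sᶜ) := by
  refine .sub (.sum fun a ha => ?_) (.smul _ (.sum fun a ha => .sum fun b hb => .sum fun c hc => ?_))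
  · refine ((hasWeight_e a).mul (v := 0) (.sub (hasWeight_D a)
      (.sum fun b hb => .sum fun c hc => ?_))).congr ?_
    · rw [compl_compl] at hb hc
      refine ((hasWeight_C a b c).mul ((hasWeight_e b).mul (hasWeight_i c))).congr ?_
      rw [if_pos hb, if_pos hc]; norm_num
    · rw [if_neg (Finset.mem_compl.1 ha)]; norm_num
  · refine ((hasWeight_C a b c).mul
      (((hasWeight_e a).mul (hasWeight_e b)).mul (hasWeight_i c))).congr ?_
    rw [if_neg (Finset.mem_compl.1 ha), if_neg (Finset.mem_compl.1 hb),
      if_neg (Finset.mem_compl.1 hc)]; norm_num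

theorem hasWeight_dCross : F.HasWeight S 2 (F.dCross S) := by
  refine .neg (.smul _ (.sum fun a ha => .sum fun b hb => .sum fun c hc => ?_))
  refine ((hasWeight_C a b c).mul
      (((hasWeight_e a).mul (hasWeight_e b)).mul (hasWeight_i c))).congr ?_
  rw [if_pos ha, if_pos hb, if_neg (Finset.mem_compl.1 hc)]; norm_num

theorem hasWeight_δPart : F.HasWeight S (-1) (F.δPart S) := by
  refine .sub (.sub (.neg (.sum fun a ha => ?_)) (.sum fun a ha => ?_))
    (.smul _ (.sum fun a ha => .sum fun b hb => .sum fun c hc => ?_))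
  · refine (HasWeight.mul (w := 0) (.sub (hasWeight_D a)
      (.sum fun b hb => .sum fun c hc => ?_)) (hasWeight_i a)).congr ?_
    · refine ((hasWeight_C a b c).mul ((hasWeight_e b).mul (hasWeight_i c))).congr ?_
      rw [if_neg (Finset.mem_compl.1 hb), if_neg (Finset.mem_compl.1 hc)]; norm_num
    · rw [if_pos ha]; norm_num
  · refine (HasWeight.mul (w := 0) (.sum fun b _ => hasWeight_C b a b) (hasWeight_i a)).congr ?_
    rw [if_pos ha]; norm_num
  · refine ((hasWeight_C a b c).mul
      (((hasWeight_e c).mul (hasWeight_i b)).mul (hasWeight_i a))).congr ?_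
    rw [if_pos ha, if_pos hb, if_pos hc]; norm_num

theorem hasWeight_δPart_compl : F.HasWeight S 0 (F.δPart Sᶜ) := by
  refine .sub (.sub (.neg (.sum fun a ha => ?_)) (.sum fun a ha => ?_))
    (.smul _ (.sum fun a ha => .sum fun b hb => .sum fun c hc => ?_))
  · refine (HasWeight.mul (w := 0) (.sub (hasWeight_D a)
      (.sum fun b hb => .sum fun c hc => ?_)) (hasWeight_i a)).congr ?_
    · rw [compl_compl] at hb hc
      refine ((hasWeight_C a b c).mul ((hasWeight_e b).mul (hasWeight_i c))).congr ?_
      rw [if_pos hb, if_pos hc]; norm_num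
    · rw [if_neg (Finset.mem_compl.1 ha)]; norm_num
  · refine (HasWeight.mul (w := 0) (.sum fun b _ => hasWeight_C b a b) (hasWeight_i a)).congr ?_
    rw [if_neg (Finset.mem_compl.1 ha)]; norm_num
  · refine ((hasWeight_C a b c).mul
      (((hasWeight_e c).mul (hasWeight_i b)).mul (hasWeight_i a))).congr ?_
    rw [if_neg (Finset.mem_compl.1 ha), if_neg (Finset.mem_compl.1 hb),
      if_neg (Finset.mem_compl.1 hc)]; norm_num

theorem hasWeight_δCross : F.HasWeight S (-2) (F.δCross S) := by
  refine .neg (.smul _ (.sum fun a ha => .sum fun b hb => .sum fun c hc => ?_))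
  refine ((hasWeight_C a b c).mul
      (((hasWeight_e c).mul (hasWeight_i b)).mul (hasWeight_i a))).congr ?_
  rw [if_pos ha, if_pos hb, if_neg (Finset.mem_compl.1 hc)]; norm_num

/-- The `(1, 1)`-component of `d² = 0`. -/
theorem dPart_anticomm (hint : ∀ a ∈ Sᶜ, ∀ b ∈ Sᶜ, ∀ c ∈ S, F.C a b c = 0) (hd : F.d * F.d = 0) :
    F.dPart S * F.dPart Sᶜ + F.dPart Sᶜ * F.dPart S = 0 := by
  have hx := hasWeight_dPart (F := F) (S := S)
  have hy := hasWeight_dPart_compl (F := F) (S := S)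
  have hz := hasWeight_dCross (F := F) (S := S)
  rw [d_eq hint] at hd
  set x := F.dPart S
  set y := F.dPart Sᶜ
  set z := F.dCross S
  -- The pieces x, y, z of d have weights 1, 0, 2. The products in d² are grouped by total weight 0,
  -- …, 4, and weight 1 consists exactly of xy + yx.
  have h1 := ((hx.mul hy).congr (add_zero 1)).add ((hy.mul hx).congr (zero_add 1))
  have h0 := (hy.mul hy).congr (add_zero 0)
  have h2 := (((hx.mul hx).congr (one_add_one_eq_two)).add
    ((hy.mul hz).congr (zero_add 2))).add ((hz.mul hy).congr (add_zero 2))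
  have h3 := ((hx.mul hz).congr (show (1 : ℝ) + 2 = 3 by norm_num)).add
    ((hz.mul hx).congr (show (2 : ℝ) + 1 = 3 by norm_num))
  have h4 := (hz.mul hz).congr (show (2 : ℝ) + 2 = 4 by norm_num)
  set u0 := y * y
  set u1 := x * y + y * x
  set u2 := x * x + y * z + z * y
  set u3 := x * z + z * x
  set u4 := z * z
  have s0 : u0 + u1 + u2 + u3 + u4 = 0 := by
    rw [← hd]; simp only [u0, u1, u2, u3, u4]; noncomm_ring
  have step (r0 r1 r2 r3 r4 : ℝ)
      (h : r0 • u0 + r1 • u1 + r2 • u2 + r3 • u3 + r4 • u4 = 0) :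
      -- The commutator with the number operator multiplies the piece of weight j by j.
      (0 : ℝ) • u0 + r1 • u1 + (2 * r2) • u2 + (3 * r3) • u3 + (4 * r4) • u4 = 0 := by
    have := congrArg (fun t => F.num S * t - t * F.num S) h
    simp only [mul_add, add_mul, mul_smul_comm, smul_mul_assoc, mul_zero, zero_mul,
      sub_zero] at this
    unfold HasWeight at h0 h1 h2 h3 h4
    rw [← this]
    linear_combination (norm := module) -(r0 • h0) - r1 • h1 - r2 • h2 - r3 • h3 - r4 • h4
  have t0 : (1 : ℝ) • u0 + (1 : ℝ) • u1 + (1 : ℝ) • u2 + (1 : ℝ) • u3 + (1 : ℝ) • u4 = 0 := by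
    simpa using s0
  have t1 := step _ _ _ _ _ t0
  have t2 := step _ _ _ _ _ t1
  have t3 := step _ _ _ _ _ t2
  have t4 := step _ _ _ _ _ t3
  -- Lagrange interpolation: the polynomial 4t - 13t²/3 + 3t³/2 - t⁴/6 is 1 at t = 1 and 0 at t = 0,
  -- 2, 3, 4, so this combination isolates the piece of weight 1.
  linear_combination (norm := module) (4 : ℝ) • t1 - (13 / 3 : ℝ) • t2 + (3 / 2 : ℝ) • t3 - (1 / 6 : ℝ) • t4

end FrameOps

end FrameAlgebra

end GradedForms

namespace GradedForms

open MeasureTheory Bundle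

section FrameAlgebra

set_option linter.unusedSectionVars false

namespace FrameOps

variable {N A : Type*} [Fintype N] [DecidableEq N] [Ring A] [Algebra ℝ A]
variable {F : FrameOps N A} {S : Finset N}

/-! ### Interchange of exterior and interior multiplications -/

theorem self_eq_zero_of_eq_neg {x : A} (h : x = -x) : x = 0 := by
  have h2 : (2 : ℝ) • x = 0 := by
    rw [two_smul]
    exact add_eq_zero_iff_eq_neg.2 h
  exact (smul_eq_zero.1 h2).resolve_left two_ne_zero

variable (F) in
/-- Clifford multiplication by a member of the frame. -/
def cliff (a : N) : A := F.e a + F.i a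

/-- Squares of e and i vanish and ei + ie = 1. Being an involution, the Clifford element is its own
inverse, so `conj` really is a conjugation. -/
theorem cliff_cliff (a : N) : F.cliff a * F.cliff a = 1 := by
  have he : F.e a * F.e a = 0 := self_eq_zero_of_eq_neg (F.e_e a a)
  have hi : F.i a * F.i a = 0 := self_eq_zero_of_eq_neg (F.i_i a a)
  have h := F.i_e a a
  rw [if_pos rfl] at h
  rw [cliff, mul_add, add_mul, add_mul, he, hi, h]
  abel

theorem cliff_e (a b : N) :
    F.cliff a * F.e b = if a = b then F.i a * F.cliff a else -(F.e b * F.cliff a) := by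
  have he : F.e a * F.e a = 0 := self_eq_zero_of_eq_neg (F.e_e a a)
  have hi : F.i a * F.i a = 0 := self_eq_zero_of_eq_neg (F.i_i a a)
  unfold cliff
  split_ifs with h
  · subst h
    rw [add_mul, mul_add, he, hi]; abel
  · rw [add_mul, mul_add, F.e_e a b, F.i_e a b, if_neg h]; abel

theorem cliff_i (a b : N) :
    F.cliff a * F.i b = if a = b then F.e a * F.cliff a else -(F.i b * F.cliff a) := by
  have he : F.e a * F.e a = 0 := self_eq_zero_of_eq_neg (F.e_e a a)
  have hi : F.i a * F.i a = 0 := self_eq_zero_of_eq_neg (F.i_i a a)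
  unfold cliff
  split_ifs with h
  · subst h
    rw [add_mul, mul_add, he, hi]; abel
  · rw [add_mul, mul_add, F.i_i a b, F.i_e b a, if_neg (Ne.symm h)]; abel

variable (F) in
/-- Conjugation by Clifford multiplication by a member of the frame. -/
noncomputable def conj (a : N) : A →ₐ[ℝ] A where
  toFun x := F.cliff a * x * F.cliff a
  map_one' := by rw [mul_one, cliff_cliff]
  map_mul' x y := by
    calc _ = F.cliff a * x * 1 * y * F.cliff a := by noncomm_ring
      _ = _ := by rw [← cliff_cliff (F := F) a]; noncomm_ring
  map_zero' := by simp
  map_add' x y := by noncomm_ring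
  commutes' r := by
    rw [← Algebra.commutes, mul_assoc, cliff_cliff, mul_one]

theorem conj_apply (a : N) (x : A) : F.conj a x = F.cliff a * x * F.cliff a := rfl

theorem conj_e (a b : N) : F.conj a (F.e b) = if a = b then F.i b else -F.e b := by
  rw [conj_apply, cliff_e]
  split_ifs with h
  · subst h; rw [mul_assoc, cliff_cliff, mul_one]
  · rw [neg_mul, mul_assoc, cliff_cliff, mul_one]

theorem conj_i (a b : N) : F.conj a (F.i b) = if a = b then F.e b else -F.i b := by
  rw [conj_apply, cliff_i]
  split_ifs with h
  · subst h; rw [mul_assoc, cliff_cliff, mul_one]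
  · rw [neg_mul, mul_assoc, cliff_cliff, mul_one]

theorem conj_of_commute (a : N) {x : A} (he : x * F.e a = F.e a * x)
    (hi : x * F.i a = F.i a * x) : F.conj a x = x := by
  rw [conj_apply, cliff, add_mul, ← he, ← hi, ← mul_add, mul_assoc, ← cliff, cliff_cliff, mul_one]

variable (F S) in
/-- The algebra endomorphism `Ψ` interchanges, up to a sign `σ`, exterior and interior
multiplications by the frame members in `S`, and fixes the other ones up to a sign. -/
structure IsSwap (Ψ : A →ₐ[ℝ] A) (σ : ℝ) : Prop where
  sq : σ * σ = 1
  e_mem : ∀ a ∈ S, Ψ (F.e a) = -(σ • F.i a)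
  i_mem : ∀ a ∈ S, Ψ (F.i a) = -(σ • F.e a)
  e_notMem : ∀ a ∉ S, Ψ (F.e a) = σ • F.e a
  i_notMem : ∀ a ∉ S, Ψ (F.i a) = σ • F.i a
  D : ∀ a, Ψ (F.D a) = F.D a
  C : ∀ a b c, Ψ (F.C a b c) = F.C a b c

variable (F S) in
-- Composition of the Clifford conjugations over S. Each one exchanges a single pair e, i and
-- negates all other generators, so σ is the parity (-1)^|S|.
theorem exists_isSwap : ∃ Ψ σ, F.IsSwap S Ψ σ := by
  induction S using Finset.induction_on with
  | empty =>
    exact ⟨AlgHom.id ℝ A, 1, by simp, by simp, by simp, by simp, by simp, by simp, by simp⟩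
  | insert j S hj ih =>
    obtain ⟨Ψ, σ, h⟩ := ih
    refine ⟨(F.conj j).comp Ψ, -σ, by simpa using h.sq, fun a ha => ?_, fun a ha => ?_,
      fun a ha => ?_, fun a ha => ?_, fun a => ?_, fun a b c => ?_⟩
    · rcases Finset.mem_insert.1 ha with rfl | ha
      · simp [h.e_notMem _ hj, conj_e]
      · have : j ≠ a := fun h => hj (h ▸ ha)
        simp [h.e_mem _ ha, conj_i, this]
    · rcases Finset.mem_insert.1 ha with rfl | ha
      · simp [h.i_notMem _ hj, conj_i]
      · have : j ≠ a := fun h => hj (h ▸ ha)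
        simp [h.i_mem _ ha, conj_e, this]
    · rw [Finset.mem_insert, not_or] at ha
      simp [h.e_notMem _ ha.2, conj_e, Ne.symm ha.1]
    · rw [Finset.mem_insert, not_or] at ha
      simp [h.i_notMem _ ha.2, conj_i, Ne.symm ha.1]
    · simp only [AlgHom.comp_apply, h.D]
      exact conj_of_commute j (F.D_e a j) (F.D_i a j)
    · simp only [AlgHom.comp_apply, h.C]
      exact conj_of_commute j (F.C_e a b c j) (F.C_i a b c j)

variable {Ψ : A →ₐ[ℝ] A} {σ : ℝ}

theorem IsSwap.rot (h : F.IsSwap S Ψ σ) (a : N) : Ψ (F.rot S a) = F.rot S a := by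
  simp only [FrameOps.rot, map_sum, map_mul, h.C]
  refine Finset.sum_congr rfl fun b hb => Finset.sum_congr rfl fun c hc => ?_
  rw [h.e_notMem b (Finset.mem_compl.1 hb), h.i_notMem c (Finset.mem_compl.1 hc), smul_mul_smul_comm,
    h.sq, one_smul]

/-- Both indices lie in S, so each product e i becomes i e, which is δ - e i. Skewness removes the
δ-term, since the diagonal coefficients are zero, and absorbs the sign of the other. -/
theorem IsSwap.rot_compl (h : F.IsSwap S Ψ σ) (hS : F.IsSkew Sᶜ) {a : N} (ha : a ∈ Sᶜ) :
    Ψ (F.rot Sᶜ a) = F.rot Sᶜ a := by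
  simp only [FrameOps.rot, map_sum, map_mul, h.C, compl_compl]
  rw [Finset.sum_comm]
  refine Finset.sum_congr rfl fun b hb => Finset.sum_congr rfl fun c hc => ?_
  have hc' : c ∈ Sᶜᶜ := by simpa using hc
  have hb' : b ∈ Sᶜᶜ := by simpa using hb
  rw [h.e_mem c hc, h.i_mem b hb, neg_mul_neg, smul_mul_smul_comm, h.sq, one_smul, F.i_e,
    hS a ha c hc' b hb', mul_sub]
  split_ifs with hcb
  · subst hcb
    rw [hS.diag ha hb']; simp
  · simp

/-- The rotation only involves indices outside S, so `i a` passes two odd factors and the signs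
cancel. -/
theorem rot_i (a : N) (ha : a ∈ S) : F.rot S a * F.i a = F.i a * F.rot S a := by
  simp only [FrameOps.rot, Finset.sum_mul, Finset.mul_sum]
  refine Finset.sum_congr rfl fun b hb => Finset.sum_congr rfl fun c hc => ?_
  have hab : a ≠ b := fun h => Finset.mem_compl.1 hb (h ▸ ha)
  have h := F.i_e a b
  rw [if_neg hab, zero_sub] at h
  rw [mul_assoc, mul_assoc, F.i_i c a, mul_neg, ← mul_assoc (F.e b), ← neg_mul, ← h, ← mul_assoc,
    ← mul_assoc, F.C_i, mul_assoc, mul_assoc]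

/-- The heart of the partial Hodge duality. First-order terms e_a(D_a - rot) turn directly into the
first-order terms of `δPart`. The divergence terms of `δPart` come from putting the swapped cubic
terms back into normal order. -/
theorem IsSwap.dPart (h : F.IsSwap S Ψ σ) (hS : F.IsSkew S) :
    Ψ (F.dPart S) = σ • F.δPart S := by
  have h1 : Ψ (∑ a ∈ S, F.e a * (F.D a - F.rot S a)) =
      -(σ • ∑ a ∈ S, (F.D a - F.rot S a) * F.i a) := by
    rw [map_sum, Finset.smul_sum, ← Finset.sum_neg_distrib]
    refine Finset.sum_congr rfl fun a ha => ?_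
    rw [map_mul, map_sub, h.e_mem a ha, h.D, h.rot, neg_mul, smul_mul_assoc, sub_mul, mul_sub,
      F.D_i, rot_i a ha]
  have h2 : Ψ (∑ a ∈ S, ∑ b ∈ S, ∑ c ∈ S, F.C a b c * (F.e a * F.e b * F.i c)) =
      -(σ • ∑ a ∈ S, ∑ b ∈ S, ∑ c ∈ S, F.C a b c * (F.i a * F.i b * F.e c)) := by
    simp only [map_sum, Finset.smul_sum, ← Finset.sum_neg_distrib]
    refine Finset.sum_congr rfl fun a ha => Finset.sum_congr rfl fun b hb =>
      Finset.sum_congr rfl fun c hc => ?_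
    rw [map_mul, map_mul, map_mul, h.C, h.e_mem a ha, h.e_mem b hb, h.i_mem c hc, neg_mul_neg,
      smul_mul_smul_comm, h.sq, one_smul, mul_neg, mul_smul_comm, mul_neg, mul_smul_comm]
  -- Normal ordering i_a i_b e_c = δ_bc i_a - δ_ac i_b - e_c i_b i_a. After summation each of the
  -- two contractions gives -Σ div(a) i_a, and the factor 2 cancels the ½ of the definition.
  have h3 : ∑ a ∈ S, ∑ b ∈ S, ∑ c ∈ S, F.C a b c * (F.i a * F.i b * F.e c) =
      -((2 : ℝ) • ∑ a ∈ S, F.div a * F.i a)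
        - ∑ a ∈ S, ∑ b ∈ S, ∑ c ∈ S, F.C a b c * (F.e c * F.i b * F.i a) := by
    have hterm (a b c : N) : F.C a b c * (F.i a * F.i b * F.e c) =
        (if b = c then F.C a b c * F.i a else 0) - (if a = c then F.C a b c * F.i b else 0)
          - F.C a b c * (F.e c * F.i b * F.i a) := by
      have : F.i a * F.i b * F.e c =
          (if b = c then F.i a else 0) - (if a = c then F.i b else 0)
            - F.e c * F.i b * F.i a := by
        rw [mul_assoc, F.i_e, mul_sub, ← mul_assoc, F.i_e, sub_mul, mul_assoc, F.i_i a b]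
        split_ifs <;> noncomm_ring
      rw [this, mul_sub, mul_sub]
      split_ifs <;> simp
    have hA : ∑ a ∈ S, ∑ b ∈ S, ∑ c ∈ S, (if b = c then F.C a b c * F.i a else 0) =
        -∑ a ∈ S, F.div a * F.i a := by
      rw [← Finset.sum_neg_distrib]
      refine Finset.sum_congr rfl fun a ha => ?_
      rw [hS.div_eq ha, Finset.sum_mul, ← Finset.sum_neg_distrib]
      refine Finset.sum_congr rfl fun b hb => ?_
      rw [Finset.sum_ite_eq, if_pos hb, F.C_swap, neg_mul]
    have hB : ∑ a ∈ S, ∑ b ∈ S, ∑ c ∈ S, (if a = c then F.C a b c * F.i b else 0) =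
        ∑ a ∈ S, F.div a * F.i a := by
      rw [Finset.sum_comm]
      refine Finset.sum_congr rfl fun a ha => ?_
      rw [hS.div_eq ha, Finset.sum_mul]
      refine Finset.sum_congr rfl fun b hb => ?_
      rw [Finset.sum_ite_eq, if_pos hb]
    simp only [hterm, Finset.sum_sub_distrib, hA, hB]
    module
  rw [FrameOps.dPart, FrameOps.δPart, map_sub, map_smul, h1, h2, h3]
  module

/-- Generators outside S only acquire the sign σ: once in first-order terms, three times in cubic
ones, and σ³ = σ. -/
theorem IsSwap.dPart_compl (h : F.IsSwap S Ψ σ) (hS : F.IsSkew Sᶜ) :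
    Ψ (F.dPart Sᶜ) = σ • F.dPart Sᶜ := by
  have h1 : Ψ (∑ a ∈ Sᶜ, F.e a * (F.D a - F.rot Sᶜ a)) =
      σ • ∑ a ∈ Sᶜ, F.e a * (F.D a - F.rot Sᶜ a) := by
    rw [map_sum, Finset.smul_sum]
    refine Finset.sum_congr rfl fun a ha => ?_
    rw [map_mul, map_sub, h.e_notMem a (Finset.mem_compl.1 ha), h.D, h.rot_compl hS ha,
      smul_mul_assoc]
  rw [FrameOps.dPart, map_sub, map_smul, h1, smul_sub, smul_comm σ]
  congr 2
  simp only [map_sum, Finset.smul_sum]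
  refine Finset.sum_congr rfl fun a ha => Finset.sum_congr rfl fun b hb =>
    Finset.sum_congr rfl fun c hc => ?_
  rw [map_mul, map_mul, map_mul, h.C, h.e_notMem a (Finset.mem_compl.1 ha),
    h.e_notMem b (Finset.mem_compl.1 hb), h.i_notMem c (Finset.mem_compl.1 hc), smul_mul_smul_comm,
    h.sq, one_smul, mul_smul_comm, mul_smul_comm]

theorem IsSwap.δPart_compl (h : F.IsSwap S Ψ σ) (hS : F.IsSkew Sᶜ) :
    Ψ (F.δPart Sᶜ) = σ • F.δPart Sᶜ := by
  have h1 : Ψ (∑ a ∈ Sᶜ, (F.D a - F.rot Sᶜ a) * F.i a) =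
      σ • ∑ a ∈ Sᶜ, (F.D a - F.rot Sᶜ a) * F.i a := by
    rw [map_sum, Finset.smul_sum]
    refine Finset.sum_congr rfl fun a ha => ?_
    rw [map_mul, map_sub, h.i_notMem a (Finset.mem_compl.1 ha), h.D, h.rot_compl hS ha,
      mul_smul_comm]
  have h2 : Ψ (∑ a ∈ Sᶜ, F.div a * F.i a) = σ • ∑ a ∈ Sᶜ, F.div a * F.i a := by
    rw [map_sum, Finset.smul_sum]
    refine Finset.sum_congr rfl fun a ha => ?_
    rw [map_mul, h.i_notMem a (Finset.mem_compl.1 ha), div, map_sum, mul_smul_comm]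
    simp only [h.C]
  have h3 : Ψ (∑ a ∈ Sᶜ, ∑ b ∈ Sᶜ, ∑ c ∈ Sᶜ, F.C a b c * (F.e c * F.i b * F.i a)) =
      σ • ∑ a ∈ Sᶜ, ∑ b ∈ Sᶜ, ∑ c ∈ Sᶜ, F.C a b c * (F.e c * F.i b * F.i a) := by
    simp only [map_sum, Finset.smul_sum]
    refine Finset.sum_congr rfl fun a ha => Finset.sum_congr rfl fun b hb =>
      Finset.sum_congr rfl fun c hc => ?_
    rw [map_mul, map_mul, map_mul, h.C, h.i_notMem a (Finset.mem_compl.1 ha),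
      h.i_notMem b (Finset.mem_compl.1 hb), h.e_notMem c (Finset.mem_compl.1 hc),
      smul_mul_smul_comm, h.sq, one_smul, mul_smul_comm, mul_smul_comm]
  rw [FrameOps.δPart, map_sub, map_sub, map_neg, map_smul, h1, h2, h3]
  module

/-! ### Anticommuting codifferentials and commuting Laplacians -/

theorem IsSwap.transfer (h : F.IsSwap S Ψ σ) {x y x' y' : A} (hxy : x * y + y * x = 0)
    (hx : Ψ x = σ • x') (hy : Ψ y = σ • y') : x' * y' + y' * x' = 0 := by
  have := congrArg Ψ hxy
  simpa [hx, hy, smul_smul, h.sq] using this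

theorem δPart_dPart_compl_anticomm (hS : F.IsSkew S) (hS' : F.IsSkew Sᶜ)
    (h : F.dPart S * F.dPart Sᶜ + F.dPart Sᶜ * F.dPart S = 0) :
    F.δPart S * F.dPart Sᶜ + F.dPart Sᶜ * F.δPart S = 0 := by
  obtain ⟨Ψ, σ, hΨ⟩ := F.exists_isSwap S
  exact hΨ.transfer h (hΨ.dPart hS) (hΨ.dPart_compl hS')

/-- The previous relation with S replaced by its complement; the hypotheses are symmetric in the
two. -/
theorem δPart_compl_dPart_anticomm (hS : F.IsSkew S) (hS' : F.IsSkew Sᶜ)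
    (h : F.dPart S * F.dPart Sᶜ + F.dPart Sᶜ * F.dPart S = 0) :
    F.δPart Sᶜ * F.dPart S + F.dPart S * F.δPart Sᶜ = 0 := by
  have := δPart_dPart_compl_anticomm (F := F) (S := Sᶜ) hS' (by rwa [compl_compl])
    (by rw [compl_compl, add_comm]; exact h)
  rwa [compl_compl] at this

/-- A swap over S applied to the relation between `dPart S` and `δPart Sᶜ`, the latter being
invariant up to sign. -/
theorem δPart_anticomm (hS : F.IsSkew S) (hS' : F.IsSkew Sᶜ)
    (h : F.dPart S * F.dPart Sᶜ + F.dPart Sᶜ * F.dPart S = 0) :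
    F.δPart S * F.δPart Sᶜ + F.δPart Sᶜ * F.δPart S = 0 := by
  obtain ⟨Ψ, σ, hΨ⟩ := F.exists_isSwap S
  have h2 := δPart_compl_dPart_anticomm hS hS' h
  rw [add_comm] at h2
  exact hΨ.transfer h2 (hΨ.dPart hS) (hΨ.δPart_compl hS')

/-- Each of the two factors for S anticommutes with each of the two factors for the complement.
Moving a product of two past a product of two costs four signs. -/
theorem δPart_mul_dPart_comm (hS : F.IsSkew S) (hS' : F.IsSkew Sᶜ)
    (h : F.dPart S * F.dPart Sᶜ + F.dPart Sᶜ * F.dPart S = 0) :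
    (F.δPart S * F.dPart S) * (F.δPart Sᶜ * F.dPart Sᶜ) =
      (F.δPart Sᶜ * F.dPart Sᶜ) * (F.δPart S * F.dPart S) := by
  have h1 := eq_neg_of_add_eq_zero_left (δPart_dPart_compl_anticomm hS hS' h)
  have h2 := eq_neg_of_add_eq_zero_right (δPart_compl_dPart_anticomm hS hS' h)
  have h3 := eq_neg_of_add_eq_zero_left (δPart_anticomm hS hS' h)
  have h4 := eq_neg_of_add_eq_zero_left h
  calc _ = F.δPart S * (F.dPart S * F.δPart Sᶜ) * F.dPart Sᶜ := by noncomm_ring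
    _ = -((F.δPart S * F.δPart Sᶜ) * (F.dPart S * F.dPart Sᶜ)) := by rw [h2]; noncomm_ring
    _ = -(F.δPart Sᶜ * (F.δPart S * F.dPart Sᶜ) * F.dPart S) := by rw [h3, h4]; noncomm_ring
    _ = _ := by rw [h1]; noncomm_ring

/-! ### Laplacians on functions -/

variable {V : Type*} [AddCommGroup V] [Module A V]

variable (F S) in
/-- The Laplacian in the directions of `S` on functions. -/
noncomputable def lap : A := ∑ a ∈ S, (F.D a + F.div a) * F.D a

variable (F) in
/-- Elements of degree zero. -/
def IsVacuum (v : V) : Prop := ∀ a, F.i a • v = 0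

theorem IsVacuum.D {v : V} (hv : F.IsVacuum v) (a : N) : F.IsVacuum (F.D a • v) := fun b => by
  rw [← mul_smul, ← F.D_i, mul_smul, hv, smul_zero]

theorem IsVacuum.C {v : V} (hv : F.IsVacuum v) (a b c : N) : F.IsVacuum (F.C a b c • v) :=
  fun d => by rw [← mul_smul, ← F.C_i, mul_smul, hv, smul_zero]

theorem IsVacuum.add {v w : V} (hv : F.IsVacuum v) (hw : F.IsVacuum w) : F.IsVacuum (v + w) :=
  fun a => by rw [smul_add, hv, hw, add_zero]

theorem IsVacuum.sum {ι : Type*} {s : Finset ι} {v : ι → V} (hv : ∀ j ∈ s, F.IsVacuum (v j)) :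
    F.IsVacuum (∑ j ∈ s, v j) := fun a => by
  rw [Finset.smul_sum]
  exact Finset.sum_eq_zero fun j hj => hv j hj a

theorem IsVacuum.lap {v : V} (hv : F.IsVacuum v) : F.IsVacuum (F.lap S • v) := by
  rw [FrameOps.lap, Finset.sum_smul]
  refine .sum fun a _ => ?_
  rw [mul_smul, add_smul, FrameOps.div, Finset.sum_smul]
  exact ((hv.D a).D a).add (.sum fun b _ => (hv.D a).C b a b)

theorem IsVacuum.rot {v : V} (hv : F.IsVacuum v) (a : N) : F.rot S a • v = 0 := by
  simp only [FrameOps.rot, Finset.sum_smul, mul_smul, hv _, smul_zero, Finset.sum_const_zero]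

theorem IsVacuum.dPart {v : V} (hv : F.IsVacuum v) :
    F.dPart S • v = ∑ a ∈ S, F.e a • F.D a • v := by
  simp only [FrameOps.dPart, sub_smul, Finset.sum_smul, mul_smul, hv.rot, sub_zero]
  rw [sub_eq_self, Algebra.smul_def, mul_smul]
  simp only [Finset.sum_smul, mul_smul, hv _, smul_zero, Finset.sum_const_zero]

theorem IsVacuum.i_e {v : V} (hv : F.IsVacuum v) (a b : N) :
    F.i b • F.e a • v = if b = a then v else 0 := by
  rw [← mul_smul, F.i_e, sub_smul, mul_smul, hv, smul_zero, sub_zero]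
  split_ifs <;> simp

/-- Since i_b e_a v = δ_ab v, the linear terms retain only the index a. The cubic terms contract
twice and vanish, as does the rotation on degree zero. -/
theorem IsVacuum.δPart_e {v : V} (hv : F.IsVacuum v) {a : N} (ha : a ∈ S) :
    F.δPart S • F.e a • v = -((F.D a + F.div a) • v) := by
  have h1 : (∑ b ∈ S, (F.D b - F.rot S b) * F.i b) • F.e a • v = F.D a • v := by
    rw [Finset.sum_smul, Finset.sum_eq_single_of_mem a ha]
    · rw [mul_smul, hv.i_e, if_pos rfl, sub_smul, hv.rot, sub_zero]
    · intro b _ hb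
      rw [mul_smul, hv.i_e, if_neg hb, smul_zero]
  have h2 : (∑ b ∈ S, F.div b * F.i b) • F.e a • v = F.div a • v := by
    rw [Finset.sum_smul, Finset.sum_eq_single_of_mem a ha]
    · rw [mul_smul, hv.i_e, if_pos rfl]
    · intro b _ hb
      rw [mul_smul, hv.i_e, if_neg hb, smul_zero]
  have h3 : ((1 / 2 : ℝ) • ∑ a ∈ S, ∑ b ∈ S, ∑ c ∈ S, F.C a b c * (F.e c * F.i b * F.i a)) •
      F.e a • v = 0 := by
    rw [Algebra.smul_def, mul_smul]
    simp only [Finset.sum_smul, mul_smul, hv.i_e]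
    have : ∀ b b' : N, F.i b • (if b' = a then v else 0) = 0 := fun b b' => by
      split_ifs
      · exact hv b
      · simp
    simp only [this, smul_zero, Finset.sum_const_zero]
  rw [FrameOps.δPart, sub_smul, sub_smul, neg_smul, h1, h2, h3, add_smul]
  abel

theorem IsVacuum.δPart_dPart {v : V} (hv : F.IsVacuum v) :
    (F.δPart S * F.dPart S) • v = -(F.lap S • v) := by
  rw [mul_smul, hv.dPart, Finset.smul_sum, FrameOps.lap, Finset.sum_smul,
    ← Finset.sum_neg_distrib]
  refine Finset.sum_congr rfl fun a ha => ?_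
  rw [(hv.D a).δPart_e ha, mul_smul]

/-- On degree-zero elements each partial Laplacian is -δ d, and its value is again of degree zero,
so the operator identity can be applied to the iterated expression. -/
theorem IsVacuum.lap_comm {v : V} (hv : F.IsVacuum v) (hS : F.IsSkew S) (hS' : F.IsSkew Sᶜ)
    (h : F.dPart S * F.dPart Sᶜ + F.dPart Sᶜ * F.dPart S = 0) :
    F.lap S • F.lap Sᶜ • v = F.lap Sᶜ • F.lap S • v := by
  have := congrArg (· • v) (δPart_mul_dPart_comm hS hS' h)
  simp only [mul_smul _ _ v] at this
  rw [← neg_neg (F.lap Sᶜ • v), ← hv.δPart_dPart, smul_neg, ← neg_neg (F.lap S • v),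
    ← hv.δPart_dPart, smul_neg]
  have h1 : ∀ T : Finset N, F.IsVacuum ((F.δPart T * F.dPart T) • v) := fun T a => by
    rw [hv.δPart_dPart, smul_neg, hv.lap, neg_zero]
  rw [← (h1 Sᶜ).δPart_dPart, ← (h1 S).δPart_dPart]
  simp only [mul_smul]
  simpa only [mul_smul] using this

end FrameOps

end FrameAlgebra

end GradedForms

namespace GradedForms

open MeasureTheory Bundle

/-! ## Frames on open subsets of Euclidean space -/

section LocalFrames

theorem cov_apply_eq_sum {n k : ℕ} (φ : Cov n k) (v : Fin k → Vec n) :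
    φ v = ∑ d : Fin k → Fin n, (∏ l, v l (d l)) * φ (fun l => bvec (d l)) := by
  conv_lhs => rw [show v = fun l => ∑ a, v l a • bvec a from
    funext fun l => (sum_coord_smul_bvec (v l)).symm]
  rw [ContinuousAlternatingMap.map_sum]
  exact Finset.sum_congr rfl fun d _ => φ.map_smul_univ _ _

/-- The evaluation map on basis tuples has a linear left inverse, which is continuous by finite
dimensionality and hence smooth. -/
theorem contDiffOn_cov {n k : ℕ} {W : Set (Vec n)} {φ : Vec n → Cov n k}
    (h : ∀ c : Fin k → Fin n, ContDiffOn ℝ ∞ (fun y => φ y fun l => bvec (c l)) W) :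
    ContDiffOn ℝ ∞ φ W := by
  let f : Cov n k →ₗ[ℝ] ((Fin k → Fin n) → ℝ) :=
    { toFun := fun φ c => φ fun l => bvec (c l)
      map_add' := fun _ _ => rfl
      map_smul' := fun _ _ => rfl }
  obtain ⟨g, hg⟩ := f.exists_leftInverse_of_injective
    (LinearMap.ker_eq_bot.2 fun φ θ h => cov_ext fun c => congrFun h c)
  have h1 : ContDiffOn ℝ ∞ (fun y => f (φ y)) W := contDiffOn_pi.2 h
  refine (g.toContinuousLinearMap.contDiff.comp_contDiffOn h1).congr fun y _ => ?_
  exact (LinearMap.congr_fun hg (φ y)).symm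

theorem smoothOn_cov_apply {n k : ℕ} {W : Set (Vec n)} {φ : Vec n → Cov n k}
    {v : Fin k → Vec n → Vec n} (hφ : ContDiffOn ℝ ∞ φ W) (hv : ∀ l, ContDiffOn ℝ ∞ (v l) W) :
    ContDiffOn ℝ ∞ (fun y => φ y fun l => v l y) W := by
  simp only [fun y => cov_apply_eq_sum (φ y) fun l => v l y]
  refine ContDiffOn.sum fun d _ => .mul (contDiffOn_prod fun l _ => ?_) ?_
  · exact (EuclideanSpace.proj (d l) : Vec n →L[ℝ] ℝ).contDiff.comp_contDiffOn (hv l)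
  · exact (ContinuousAlternatingMap.apply ℝ (Vec n) ℝ fun l => bvec (d l)).contDiff.comp_contDiffOn
      hφ

theorem two_le_smooth : minSmoothness ℝ 2 ≤ (∞ : ℕ∞ω) := by
  rw [minSmoothness_of_isRCLikeNormedField]
  exact WithTop.coe_le_coe.2 le_top

/-- A linear operator on forms each of whose components depends on a single degree. -/
def Finitary {n : ℕ} (T : Tot n →ₗ[ℝ] Tot n) : Prop :=
  ∀ k, ∃ j, ∃ f : Cov n j →ₗ[ℝ] Cov n k, ∀ φ, T φ k = f (φ j)

theorem finitary_extMul {n : ℕ} (a : Fin n) : Finitary (extMul a) := fun k => by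
  cases k with
  | zero => exact ⟨0, 0, fun φ => by simp⟩
  | succ k => exact ⟨k, wedgeLeft (EuclideanSpace.proj a), fun φ => rfl⟩

theorem finitary_intMul {n : ℕ} (a : Fin n) : Finitary (intMul a) := fun k =>
  ⟨k + 1, { toFun := fun φ => φ.curryLeft (bvec a)
            map_add' := fun _ _ => by simp
            map_smul' := fun _ _ => by simp }, fun _ => rfl⟩

/-- A smooth frame `y ↦ A y b₁, …, A y bₙ` on an open subset of Euclidean space. -/
structure LocalFrame (n : ℕ) where
  W : Set (Vec n)
  isOpen : IsOpen W
  A : Vec n → (Vec n →L[ℝ] Vec n)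
  smooth : ContDiffOn ℝ ∞ A W
  inv : ∀ y ∈ W, (A y).IsInvertible

namespace LocalFrame

variable {n : ℕ} (L : LocalFrame n)

/-- The members of the frame. -/
noncomputable def fld (a : Fin n) (y : Vec n) : Vec n := L.A y (bvec a)

/-- The coframe. -/
noncomputable def B (y : Vec n) : Vec n →L[ℝ] Vec n := (L.A y).inverse

variable {L} in
theorem B_A {y : Vec n} (hy : y ∈ L.W) (v : Vec n) : L.B y (L.A y v) = v :=
  (L.inv y hy).inverse_apply_self v

variable {L} in
theorem A_B {y : Vec n} (hy : y ∈ L.W) (v : Vec n) : L.A y (L.B y v) = v :=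
  (L.inv y hy).self_apply_inverse v

theorem smooth_fld (a : Fin n) : ContDiffOn ℝ ∞ (L.fld a) L.W :=
  L.smooth.clm_apply contDiffOn_const

theorem smooth_B : ContDiffOn ℝ ∞ L.B L.W := fun y hy => by
  obtain ⟨e, he⟩ := L.inv y hy
  have h : ContDiffAt ℝ ∞ ContinuousLinearMap.inverse (L.A y) := by
    rw [← he]; exact contDiffAt_map_inverse e
  exact h.comp_contDiffWithinAt y (L.smooth y hy)

/-- The structure functions of the frame. -/
noncomputable def sc (a b c : Fin n) (y : Vec n) : ℝ :=
  L.B y (VectorField.lieBracket ℝ (L.fld a) (L.fld b) y) c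

theorem smooth_sc (a b c : Fin n) : ContDiffOn ℝ ∞ (L.sc a b c) L.W := by
  have h : ContDiffOn ℝ ∞ (VectorField.lieBracket ℝ (L.fld a) (L.fld b)) L.W := by
    unfold VectorField.lieBracket
    have hd (a : Fin n) : ContDiffOn ℝ ∞ (fderiv ℝ (L.fld a)) L.W :=
      (L.smooth_fld a).fderiv_of_isOpen L.isOpen (by simp)
    exact ((hd b).clm_apply (L.smooth_fld a)).sub ((hd a).clm_apply (L.smooth_fld b))
  exact (EuclideanSpace.proj c : Vec n →L[ℝ] ℝ).contDiff.comp_contDiffOn (L.smooth_B.clm_apply h)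

noncomputable instance : AddCommGroup (Tot n) := Pi.addCommGroup

noncomputable instance : Module ℝ (Tot n) := Pi.module _ _ _

noncomputable instance : AddCommGroup (Vec n → Tot n) := Pi.addCommGroup

noncomputable instance : Module ℝ (Vec n → Tot n) := Pi.module _ _ _

/-- Smooth forms on the domain of the frame, in terms of the frame. -/
def sec : Submodule ℝ (Vec n → Tot n) where
  carrier := {F | (∀ k, ContDiffOn ℝ ∞ (fun y => F y k) L.W) ∧ ∀ y ∉ L.W, F y = 0}
  add_mem' hF hG := ⟨fun k => (hF.1 k).add (hG.1 k), fun y hy => by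
    rw [Pi.add_apply, hF.2 y hy, hG.2 y hy, add_zero]⟩
  zero_mem' := ⟨fun _ => contDiffOn_const, fun _ _ => rfl⟩
  smul_mem' r F hF := ⟨fun k => (hF.1 k).const_smul r, fun y hy => by
    rw [Pi.smul_apply, hF.2 y hy, smul_zero]⟩

noncomputable instance : AddCommGroup L.sec := L.sec.addCommGroup

noncomputable instance : Module ℝ L.sec := L.sec.module

noncomputable instance : Ring (Module.End ℝ L.sec) := Module.End.instRing

noncomputable instance : Algebra ℝ (Module.End ℝ L.sec) := Module.End.instAlgebra ℝ ℝ L.sec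

/-- Sections are extended by zero outside the domain, so equality on the domain is genuine equality
and operator identities can hold in the endomorphism ring. -/
theorem sec_ext {F G : L.sec} (h : ∀ y ∈ L.W, (F : Vec n → Tot n) y = (G : Vec n → Tot n) y) :
    F = G := by
  ext1
  funext y
  by_cases hy : y ∈ L.W
  · exact h y hy
  · rw [F.2.2 y hy, G.2.2 y hy]

/-- The value of a section at a point. -/
noncomputable def ev (y : Vec n) : L.sec →ₗ[ℝ] Tot n := LinearMap.proj y ∘ₗ L.sec.subtype

@[simp] theorem ev_apply (y : Vec n) (F : L.sec) : L.ev y F = (F : Vec n → Tot n) y := rfl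

theorem end_ext {T T' : Module.End ℝ L.sec} (h : ∀ F, ∀ y ∈ L.W, L.ev y (T F) = L.ev y (T' F)) :
    T = T' := LinearMap.ext fun F => L.sec_ext (h F)

/-- Application of a linear operator at every point. -/
noncomputable def lift (T : Tot n →ₗ[ℝ] Tot n) (hT : Finitary T) : Module.End ℝ L.sec where
  toFun F := ⟨fun y => T ((F : Vec n → Tot n) y), fun k => by
    obtain ⟨j, f, hf⟩ := hT k
    simp only [hf]
    exact f.toContinuousLinearMap.contDiff.comp_contDiffOn (F.2.1 j), fun y hy => by
    dsimp only
    rw [F.2.2 y hy, map_zero]⟩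
  map_add' F G := by
    ext1; funext y; exact map_add T _ _
  map_smul' r F := by
    ext1; funext y; exact map_smul T _ _

@[simp] theorem ev_lift (T : Tot n →ₗ[ℝ] Tot n) (hT : Finitary T) (F : L.sec) (y : Vec n) :
    L.ev y (L.lift T hT F) = T (L.ev y F) := rfl

/-- Multiplication by a function. -/
noncomputable def mulFun (r : Vec n → ℝ) (hr : ContDiffOn ℝ ∞ r L.W) : Module.End ℝ L.sec where
  toFun F := ⟨fun y => r y • (F : Vec n → Tot n) y, fun k => hr.smul (F.2.1 k), fun y hy => by
    dsimp only
    rw [F.2.2 y hy, smul_zero]⟩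
  map_add' F G := by
    ext1; funext y; exact smul_add _ _ _
  map_smul' s F := by
    ext1; funext y; exact smul_comm (r y) s ((F : Vec n → Tot n) y)

@[simp] theorem ev_mulFun (r : Vec n → ℝ) (hr : ContDiffOn ℝ ∞ r L.W) (F : L.sec) (y : Vec n) :
    L.ev y (L.mulFun r hr F) = r y • L.ev y F := rfl

variable {L} in
theorem differentiableAt_of_contDiffOn {G : Type*} [NormedAddCommGroup G] [NormedSpace ℝ G]
    {f : Vec n → G} (hf : ContDiffOn ℝ ∞ f L.W) {y : Vec n} (hy : y ∈ L.W) :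
    DifferentiableAt ℝ f y :=
  (hf.contDiffAt (L.isOpen.mem_nhds hy)).differentiableAt (by simp)

variable {L} in
theorem differentiableAt_sec (F : L.sec) (k : ℕ) {y : Vec n} (hy : y ∈ L.W) :
    DifferentiableAt ℝ (fun z => (F : Vec n → Tot n) z k) y :=
  differentiableAt_of_contDiffOn (F.2.1 k) hy

open Classical in
/-- The derivative in the direction of a member of the frame, for which the frame is parallel. -/
noncomputable def deriv (a : Fin n) : Module.End ℝ L.sec where
  toFun F := ⟨fun y k => if y ∈ L.W then
      fderiv ℝ (fun z => (F : Vec n → Tot n) z k) y (L.fld a y) else 0,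
    fun k => by
      have h : ContDiffOn ℝ ∞
          (fun y => fderiv ℝ (fun z => (F : Vec n → Tot n) z k) y (L.fld a y)) L.W :=
        ((F.2.1 k).fderiv_of_isOpen L.isOpen (by simp)).clm_apply (L.smooth_fld a)
      exact h.congr fun y hy => if_pos hy,
    fun y hy => funext fun k => if_neg hy⟩
  map_add' F G := by
    refine L.sec_ext fun y hy => funext fun k => ?_
    simp only [if_pos hy, Submodule.coe_add, Pi.add_apply]
    rw [fderiv_fun_add (differentiableAt_sec F k hy) (differentiableAt_sec G k hy)]
    rfl
  map_smul' r F := by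
    refine L.sec_ext fun y hy => funext fun k => ?_
    simp only [if_pos hy, Submodule.coe_smul, Pi.smul_apply, RingHom.id_apply]
    rw [fderiv_fun_const_smul (differentiableAt_sec F k hy)]
    rfl

variable {L} in
theorem ev_deriv (a : Fin n) (F : L.sec) {y : Vec n} (hy : y ∈ L.W) (k : ℕ) :
    L.ev y (L.deriv a F) k = fderiv ℝ (fun z => (F : Vec n → Tot n) z k) y (L.fld a y) :=
  if_pos hy

/-- An operator with constant coefficients commutes with coefficientwise differentiation. `Finitary`
reduces each degree to a linear map of finite-dimensional spaces, to which the chain rule applies.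
-/
theorem deriv_lift (a : Fin n) (T : Tot n →ₗ[ℝ] Tot n) (hT : Finitary T) :
    L.deriv a * L.lift T hT = L.lift T hT * L.deriv a := by
  refine L.end_ext fun F y hy => funext fun k => ?_
  obtain ⟨j, f, hf⟩ := hT k
  rw [Module.End.mul_apply, Module.End.mul_apply, ev_deriv a _ hy, ev_lift, hf, ev_deriv a _ hy]
  have : (fun z => (L.lift T hT F : Vec n → Tot n) z k) =
      fun z => f.toContinuousLinearMap ((F : Vec n → Tot n) z j) := funext fun z => hf _
  rw [this]
  have h := (f.toContinuousLinearMap.hasFDerivAt.comp y (differentiableAt_sec F j hy).hasFDerivAt)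
  exact congrArg (fun t => t (L.fld a y)) h.fderiv

theorem mulFun_lift (r : Vec n → ℝ) (hr : ContDiffOn ℝ ∞ r L.W) (T : Tot n →ₗ[ℝ] Tot n)
    (hT : Finitary T) : L.mulFun r hr * L.lift T hT = L.lift T hT * L.mulFun r hr :=
  L.end_ext fun _ _ _ => (map_smul T _ _).symm

/-- The connection coefficients of the flat connection with respect to the frame. -/
noncomputable def gam (a b c : Fin n) (y : Vec n) : ℝ :=
  L.B y (fderiv ℝ (L.fld b) y (L.fld a y)) c

theorem sc_eq (a b c : Fin n) (y : Vec n) : L.sc a b c y = L.gam a b c y - L.gam b a c y := by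
  rw [sc, VectorField.lieBracket, map_sub]
  rfl

theorem sc_swap (a b c : Fin n) (y : Vec n) : L.sc a b c y = -L.sc b a c y := by
  rw [sc_eq, sc_eq]; ring

/-- The algebra of operators generated by the frame. -/
noncomputable def ops : FrameOps (Fin n) (Module.End ℝ L.sec) where
  e a := L.lift (extMul a) (finitary_extMul a)
  i a := L.lift (intMul a) (finitary_intMul a)
  D a := L.deriv a
  C a b c := L.mulFun (L.sc a b c) (L.smooth_sc a b c)
  e_e a b := L.end_ext fun F y _ => by
    simp only [Module.End.mul_apply, ev_lift, LinearMap.neg_apply, map_neg]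
    exact extMul_extMul a b _
  i_i a b := L.end_ext fun F y _ => by
    simp only [Module.End.mul_apply, ev_lift, LinearMap.neg_apply, map_neg]
    exact intMul_intMul a b _
  i_e a b := L.end_ext fun F y _ => by
    simp only [Module.End.mul_apply, ev_lift, LinearMap.sub_apply, map_sub]
    rw [intMul_extMul]
    split_ifs <;> simp
  D_e a b := L.deriv_lift a _ _
  D_i a b := L.deriv_lift a _ _
  C_e a b c d := L.mulFun_lift _ _ _ _
  C_i a b c d := L.mulFun_lift _ _ _ _
  C_swap a b c := L.end_ext fun F y _ => by
    simp only [ev_mulFun, LinearMap.neg_apply, map_neg]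
    rw [sc_swap, neg_smul]

@[simp] theorem ev_e (a : Fin n) (F : L.sec) (y : Vec n) :
    L.ev y (L.ops.e a F) = extMul a (L.ev y F) := rfl

@[simp] theorem ev_i (a : Fin n) (F : L.sec) (y : Vec n) :
    L.ev y (L.ops.i a F) = intMul a (L.ev y F) := rfl

@[simp] theorem ev_C (a b c : Fin n) (F : L.sec) (y : Vec n) :
    L.ev y (L.ops.C a b c F) = L.sc a b c y • L.ev y F := rfl

theorem ev_d (F : L.sec) (y : Vec n) :
    L.ev y (L.ops.d F) = ∑ a, extMul a (L.ev y (L.deriv a F)) -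
      (1 / 2 : ℝ) • ∑ a, ∑ b, ∑ c,
        L.sc a b c y • extMul a (extMul b (intMul c (L.ev y F))) := by
  simp only [FrameOps.d, LinearMap.sub_apply, LinearMap.smul_apply, LinearMap.sum_apply, map_sub,
    map_smul, map_sum, Module.End.mul_apply, ev_e, ev_i, ev_C]
  rfl

/-! ### The exterior derivative in terms of a frame -/

/-- The exterior derivative of forms of all degrees. -/
noncomputable def extTot (φ : ∀ k, Vec n → Cov n k) : ∀ k, Vec n → Cov n k
  | 0 => 0
  | k + 1 => extDeriv (φ k)

theorem smoothOn_compContinuousLinearMap {k : ℕ} {W : Set (Vec n)} {φ : Vec n → Cov n k}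
    {A : Vec n → (Vec n →L[ℝ] Vec n)} (hφ : ContDiffOn ℝ ∞ φ W) (hA : ContDiffOn ℝ ∞ A W) :
    ContDiffOn ℝ ∞ (fun y => (φ y).compContinuousLinearMap (A y)) W := by
  refine contDiffOn_cov fun c => ?_
  simp only [ContinuousAlternatingMap.compContinuousLinearMap_apply, Function.comp_def]
  exact smoothOn_cov_apply hφ fun l => hA.clm_apply contDiffOn_const

open Classical in
/-- The expression of a smooth form in terms of the frame. -/
noncomputable def rep (φ : ∀ k, Vec n → Cov n k) (hφ : ∀ k, ContDiffOn ℝ ∞ (φ k) L.W) : L.sec :=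
  ⟨fun y k => if y ∈ L.W then (φ k y).compContinuousLinearMap (L.A y) else 0,
    fun k => (smoothOn_compContinuousLinearMap (hφ k) L.smooth).congr fun _ hy => if_pos hy,
    fun _ hy => funext fun _ => if_neg hy⟩

theorem ev_rep {φ : ∀ k, Vec n → Cov n k} (hφ : ∀ k, ContDiffOn ℝ ∞ (φ k) L.W) {y : Vec n}
    (hy : y ∈ L.W) (k : ℕ) :
    L.ev y (L.rep φ hφ) k = (φ k y).compContinuousLinearMap (L.A y) := if_pos hy

theorem compContinuousLinearMap_alternatizeUncurryFin {k : ℕ} (f : Vec n →L[ℝ] Cov n k)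
    (A : Vec n →L[ℝ] Vec n) :
    (ContinuousAlternatingMap.alternatizeUncurryFin f).compContinuousLinearMap A =
      ∑ a, wedgeLeft (EuclideanSpace.proj a) ((f (A (bvec a))).compContinuousLinearMap A) := by
  have := alternatizeUncurryFin_eq_sum
    ((ContinuousAlternatingMap.compContinuousLinearMapCLM A ∘L f) ∘L A)
  simp only [ContinuousLinearMap.comp_apply] at this
  refine Eq.trans ?_ this
  ext v
  simp [ContinuousAlternatingMap.alternatizeUncurryFin_apply]
  rfl

theorem hasFDerivAt_fld (a : Fin n) {y : Vec n} (hy : y ∈ L.W) (u : Vec n) :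
    fderiv ℝ (L.fld a) y u = fderiv ℝ L.A y u (bvec a) := by
  have h := (differentiableAt_of_contDiffOn L.smooth hy).hasFDerivAt.clm_apply
    (hasFDerivAt_const (bvec a) y)
  have h' : fderiv ℝ (L.fld a) y = _ := h.fderiv
  rw [h']
  simp

/-- Leibniz rule for φ ∘ A. The correction term differentiates the frame itself, and its components
in the frame are the coefficients `gam`. -/
theorem fderiv_rep {φ : ∀ k, Vec n → Cov n k} (hφ : ∀ k, ContDiffOn ℝ ∞ (φ k) L.W) {y : Vec n}
    (hy : y ∈ L.W) (k : ℕ) (a : Fin n) :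
    ((fderiv ℝ (φ k) y (L.fld a y)).compContinuousLinearMap (L.A y)) =
      L.ev y (L.deriv a (L.rep φ hφ)) k -
        (∑ b, ∑ c, L.gam a b c y • extMul b (intMul c (L.ev y (L.rep φ hφ)))) k := by
  rw [ev_deriv a _ hy, eq_sub_iff_add_eq]
  have h1 : (fun z => (L.rep φ hφ : Vec n → Tot n) z k) =ᶠ[nhds y]
      fun z => (φ k z).compContinuousLinearMap (L.A z) :=
    Filter.eventually_of_mem (L.isOpen.mem_nhds hy) fun z hz => L.ev_rep hφ hz k
  rw [h1.fderiv_eq, fderiv_continuousAlternatingMapCompContinuousLinearMap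
    (differentiableAt_of_contDiffOn (hφ k) hy) (differentiableAt_of_contDiffOn L.smooth hy)]
  rw [add_apply, ContinuousLinearMap.comp_apply, ContinuousLinearMap.comp_apply]
  congr 1
  rw [Finset.sum_apply]
  cases k with
  | zero =>
    simp [ContinuousAlternatingMap.fderivCompContinuousLinearMap_of_isEmpty]
  | succ k =>
    rw [ContinuousAlternatingMap.fderivCompContinuousLinearMap_eq_alternatizeUncurryFin]
    change _ = ContinuousAlternatingMap.alternatizeUncurryFin _
    rw [alternatizeUncurryFin_eq_sum]
    refine Finset.sum_congr rfl fun b _ => ?_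
    change _ = wedgeLeft (EuclideanSpace.proj b)
      (((φ (k + 1) y).curryLeft (fderiv ℝ L.A y (L.fld a y) (bvec b))).compContinuousLinearMap
        (L.A y))
    rw [← L.hasFDerivAt_fld b hy, Finset.sum_apply]
    simp only [Pi.smul_apply, extMul_succ, ← map_smul, ← map_sum]
    congr 1
    -- The derivative of the b-th frame vector is rewritten as the frame applied to its own
    -- components, so contraction with it becomes a combination of the contractions `intMul c`.
    rw [← L.A_B hy (fderiv ℝ (L.fld b) y (L.fld a y)),
      ← ContinuousAlternatingMap.curryLeft_compContinuousLinearMap, ← L.ev_rep hφ hy (k + 1)]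
    exact (map_eq_sum_bvec ((L.ev y (L.rep φ hφ) (k + 1)).curryLeft.toLinearMap) _).symm

/-- The flat derivative gives Σ e_a(D_a - Σ gam e_b i_c). Because e_a e_b is antisymmetric, only the
antisymmetrization of `gam` matters, and that is half the structure functions. -/
theorem ev_d_rep {φ : ∀ k, Vec n → Cov n k} (hφ : ∀ k, ContDiffOn ℝ ∞ (φ k) L.W) {y : Vec n}
    (hy : y ∈ L.W) (k : ℕ) :
    L.ev y (L.ops.d (L.rep φ hφ)) k = (extTot φ k y).compContinuousLinearMap (L.A y) := by
  set ψ := L.ev y (L.rep φ hφ) with hψ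
  have key : (1 / 2 : ℝ) • ∑ a, ∑ b, ∑ c, L.sc a b c y • extMul a (extMul b (intMul c ψ)) =
      ∑ a, extMul a (∑ b, ∑ c, L.gam a b c y • extMul b (intMul c ψ)) := by
    have h1 : ∑ a, ∑ b, ∑ c, L.gam b a c y • extMul a (extMul b (intMul c ψ)) =
        -∑ a, ∑ b, ∑ c, L.gam a b c y • extMul a (extMul b (intMul c ψ)) := by
      rw [Finset.sum_comm]
      simp only [← Finset.sum_neg_distrib]
      refine Finset.sum_congr rfl fun a _ => Finset.sum_congr rfl fun b _ =>
        Finset.sum_congr rfl fun c _ => ?_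
      rw [extMul_extMul, smul_neg]
    simp only [sc_eq, sub_smul, Finset.sum_sub_distrib, h1, map_sum, map_smul]
    module
  rw [ev_d, key, ← Finset.sum_sub_distrib]
  simp only [← map_sub]
  rw [Finset.sum_apply]
  cases k with
  | zero =>
    simp only [extMul_zero, Finset.sum_const_zero, extTot]
    rfl
  | succ k =>
    rw [extTot, extDeriv, compContinuousLinearMap_alternatizeUncurryFin]
    refine Finset.sum_congr rfl fun a _ => ?_
    rw [extMul_succ]
    congr 1
    exact (L.fderiv_rep hφ hy k a).symm

theorem smooth_extTot {φ : ∀ k, Vec n → Cov n k} {W : Set (Vec n)} (hW : IsOpen W)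
    (hφ : ∀ k, ContDiffOn ℝ ∞ (φ k) W) (k : ℕ) : ContDiffOn ℝ ∞ (extTot φ k) W := by
  cases k with
  | zero => exact contDiffOn_const
  | succ k =>
    exact (ContinuousAlternatingMap.alternatizeUncurryFinCLM ℝ (Vec n) ℝ).contDiff.comp_contDiffOn
      ((hφ k).fderiv_of_isOpen (m := ∞) hW (by simp))

theorem d_rep {φ : ∀ k, Vec n → Cov n k} (hφ : ∀ k, ContDiffOn ℝ ∞ (φ k) L.W) :
    L.ops.d (L.rep φ hφ) = L.rep (extTot φ) (smooth_extTot L.isOpen hφ) :=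
  L.sec_ext fun _ hy => funext fun k =>
    (L.ev_d_rep hφ hy k).trans (L.ev_rep (smooth_extTot L.isOpen hφ) hy k).symm

theorem exists_rep (F : L.sec) :
    ∃ (φ : ∀ k, Vec n → Cov n k) (hφ : ∀ k, ContDiffOn ℝ ∞ (φ k) L.W), L.rep φ hφ = F := by
  have hφ : ∀ k, ContDiffOn ℝ ∞ (fun y =>
      ((F : Vec n → Tot n) y k).compContinuousLinearMap (L.B y)) L.W :=
    fun k => smoothOn_compContinuousLinearMap (F.2.1 k) L.smooth_B
  refine ⟨_, hφ, L.sec_ext fun y hy => funext fun k => ?_⟩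
  refine (L.ev_rep hφ hy k).trans ?_
  ext v
  simp only [ContinuousAlternatingMap.compContinuousLinearMap_apply, Function.comp_def, B_A hy]

/-- Every section is the frame expression of some smooth form, so d² = 0 is inherited from the
exterior derivative on Euclidean space. -/
theorem d_mul_d : L.ops.d * L.ops.d = 0 := by
  refine L.end_ext fun F y hy => ?_
  obtain ⟨φ, hφ, rfl⟩ := L.exists_rep F
  rw [Module.End.mul_apply, d_rep, d_rep]
  funext k
  rw [ev_rep _ _ hy]
  have : extTot (extTot φ) k y = 0 := by
    rcases k with _ | _ | k
    · rfl
    · change extDeriv 0 y = 0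
      rw [extDeriv, show (0 : Vec n → Cov n 0) = fun _ => 0 from rfl, fderiv_fun_const]
      exact map_zero (ContinuousAlternatingMap.alternatizeUncurryFinCLM ℝ (Vec n) ℝ)
    · exact extDeriv_extDeriv_apply ((hφ k).contDiffAt (L.isOpen.mem_nhds hy)) two_le_smooth
  rw [this]
  ext v
  simp

end LocalFrame

end LocalFrames

end GradedForms

namespace GradedForms

open MeasureTheory Bundle

/-! ## Divergence and integration by parts -/

section Divergence

variable {n : ℕ}

theorem trace_eq_sum_coord (T : Vec n →ₗ[ℝ] Vec n) :
    LinearMap.trace ℝ (Vec n) T = ∑ i, T (bvec i) i := by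
  rw [LinearMap.trace_eq_sum_inner T (EuclideanSpace.basisFun (Fin n) ℝ)]
  refine Finset.sum_congr rfl fun i _ => ?_
  simp [EuclideanSpace.inner_single_left]

theorem contDiff_of_contDiffOn_of_compact {G : Type*} [NormedAddCommGroup G] [NormedSpace ℝ G]
    {u : Vec n → G} {W K : Set (Vec n)} (hW : IsOpen W) (hu : ContDiffOn ℝ ∞ u W)
    (hK : IsCompact K) (hKW : K ⊆ W) (h0 : ∀ y ∉ K, u y = 0) :
    ContDiff ℝ ∞ u ∧ HasCompactSupport u := by
  refine ⟨contDiff_iff_contDiffAt.2 fun y => ?_, HasCompactSupport.intro hK h0⟩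
  by_cases hy : y ∈ W
  · exact hu.contDiffAt (hW.mem_nhds hy)
  · have : u =ᶠ[nhds y] fun _ => 0 :=
      Filter.eventually_of_mem (hK.isClosed.isOpen_compl.mem_nhds fun h => hy (hKW h)) h0
    exact contDiffAt_const.congr_of_eventuallyEq this

/-- The divergence theorem for compact support: each ∂_i X^i is integrated by parts against the
constant 1. -/
theorem integral_trace_fderiv_eq_zero {X : Vec n → Vec n} (hX : ContDiff ℝ ∞ X)
    (hc : HasCompactSupport X) :
    ∫ y, LinearMap.trace ℝ (Vec n) (fderiv ℝ X y : Vec n →ₗ[ℝ] Vec n) = 0 := by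
  simp only [trace_eq_sum_coord]
  have hdX : Continuous (fderiv ℝ X) := hX.continuous_fderiv (by simp)
  have hdc : HasCompactSupport (fderiv ℝ X) := hc.fderiv ℝ
  have hint : ∀ i : Fin n, Integrable (fun y => fderiv ℝ X y (bvec i) i) := fun i => by
    refine Continuous.integrable_of_hasCompactSupport ?_ ?_
    · fun_prop
    · exact hdc.comp_left (g := fun T : Vec n →L[ℝ] Vec n => T (bvec i) i) (by simp)
  change ∫ y, ∑ i, fderiv ℝ X y (bvec i) i = 0
  rw [integral_finsetSum _ fun i _ => hint i]
  refine Finset.sum_eq_zero fun i _ => ?_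
  have hXi : Differentiable ℝ fun y => X y i := fun y =>
    (EuclideanSpace.proj i : Vec n →L[ℝ] ℝ).differentiableAt.comp y
      (hX.differentiable (by simp) y)
  have hfd : ∀ y, fderiv ℝ (fun y => X y i) y (bvec i) = fderiv ℝ X y (bvec i) i := fun y => by
    have := ((EuclideanSpace.proj i : Vec n →L[ℝ] ℝ).hasFDerivAt.comp y
      (hX.differentiable (by simp) y).hasFDerivAt).fderiv
    exact congrArg (fun t => t (bvec i)) this
  have key := integral_mul_fderiv_eq_neg_fderiv_mul_of_integrable (μ := volume)
    (f := fun _ : Vec n => (1 : ℝ)) (g := fun y => X y i) (v := bvec i)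
    (by simp) (by simpa [hfd] using hint i) (by
      simp only [one_mul]
      refine Continuous.integrable_of_hasCompactSupport hXi.continuous ?_
      exact hc.comp_left (g := fun v : Vec n => v i) (by simp)) (by simp) (fun y _ => hXi y)
  simpa [hfd] using key

/-- At the identity matrix the derivative of the determinant is the trace. A permutation other than
the identity has at least two off-diagonal factors, so one remains, equal to zero, after
differentiating a single factor. -/
theorem hasFDerivAt_det_of_eq_one {M : Vec n → Matrix (Fin n) (Fin n) ℝ}
    {M' : Fin n → Fin n → Vec n →L[ℝ] ℝ} {y : Vec n}
    (hM : ∀ i j, HasFDerivAt (fun z => M z i j) (M' i j) y) (h1 : M y = 1) :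
    HasFDerivAt (fun z => (M z).det) (∑ i, M' i i) y := by
  have h : HasFDerivAt (fun z => (M z).det)
      (∑ σ : Equiv.Perm (Fin n), Equiv.Perm.sign σ •
        ∑ i, (∏ j ∈ Finset.univ.erase i, M y (σ j) j) • M' (σ i) i) y := by
    simp only [Matrix.det_apply]
    exact HasFDerivAt.fun_sum fun σ _ =>
      (HasFDerivAt.finsetProd fun i _ => hM (σ i) i).const_smul (Equiv.Perm.sign σ)
  refine h.congr_fderiv ?_
  rw [Finset.sum_eq_single 1]
  · simp only [Equiv.Perm.sign_one, one_smul, Equiv.Perm.coe_one, id_eq, h1, Matrix.one_apply_eq,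
      Finset.prod_const_one]
  · intro σ _ hσ
    rw [Finset.sum_eq_zero, smul_zero]
    intro i _
    obtain ⟨j, hj, hji⟩ : ∃ j, σ j ≠ j ∧ j ≠ i := by
      by_contra hcon
      push Not at hcon
      refine hσ (Equiv.ext fun j => ?_)
      by_contra hj
      have hji : j = i := hcon j hj
      have h2 : σ (σ j) = σ j := by
        by_contra h3
        exact hj ((hcon _ h3).trans hji.symm)
      exact hj (σ.injective h2)
    rw [Finset.prod_eq_zero (Finset.mem_erase.2 ⟨hji, Finset.mem_univ j⟩), zero_smul]
    rw [h1, Matrix.one_apply_ne hj]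
  · simp

namespace LocalFrame

variable (L : LocalFrame n)

/-- The density of the volume for which the frame is unimodular. -/
noncomputable def dens (y : Vec n) : ℝ := |(L.A y).det|⁻¹

/-- The divergence of a member of the frame. -/
noncomputable def dv (a : Fin n) (y : Vec n) : ℝ := ∑ b, L.sc b a b y

variable {L} in
theorem det_ne_zero {y : Vec n} (hy : y ∈ L.W) : (L.A y).det ≠ 0 := by
  obtain ⟨e, he⟩ := L.inv y hy
  rw [← he]
  exact (LinearEquiv.isUnit_det' e.toLinearEquiv).ne_zero

variable {L} in
theorem dens_pos {y : Vec n} (hy : y ∈ L.W) : 0 < L.dens y :=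
  inv_pos.2 (abs_pos.2 (det_ne_zero hy))

theorem det_eq_sum (T : Vec n →L[ℝ] Vec n) :
    T.det = (Matrix.of fun i j => T (bvec j) i).det := by
  rw [ContinuousLinearMap.det, ← LinearMap.det_toMatrix (EuclideanSpace.basisFun (Fin n) ℝ).toBasis]
  congr 1

theorem smooth_dens : ContDiffOn ℝ ∞ L.dens L.W := by
  have h1 : ContDiffOn ℝ ∞ (fun y => (L.A y).det) L.W := by
    simp only [det_eq_sum, Matrix.det_apply]
    refine ContDiffOn.sum fun σ _ => .const_smul _ (contDiffOn_prod fun i _ => ?_)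
    exact (EuclideanSpace.proj (σ i) : Vec n →L[ℝ] ℝ).contDiff.comp_contDiffOn
      (L.smooth.clm_apply contDiffOn_const)
  intro y hy
  exact ((h1 y hy).abs (det_ne_zero hy)).inv (abs_ne_zero.2 (det_ne_zero hy))

/-- Freeze the coframe at y: B(y)A(z) is the identity at z = y, so its determinant is positive
nearby. The absolute value drops out, and the derivative of the determinant is a trace. -/
theorem hasFDerivAt_dens {y : Vec n} (hy : y ∈ L.W) :
    HasFDerivAt L.dens (-(L.dens y) •
      ∑ b, (EuclideanSpace.proj b : Vec n →L[ℝ] ℝ) ∘L L.B y ∘L fderiv ℝ (L.fld b) y) y := by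
  let M : Vec n → Matrix (Fin n) (Fin n) ℝ := fun z => Matrix.of fun i j => L.B y (L.fld j z) i
  have hM : ∀ i j, HasFDerivAt (fun z => M z i j)
      ((EuclideanSpace.proj i : Vec n →L[ℝ] ℝ) ∘L L.B y ∘L fderiv ℝ (L.fld j) y) y := fun i j =>
    (EuclideanSpace.proj i : Vec n →L[ℝ] ℝ).hasFDerivAt.comp y ((L.B y).hasFDerivAt.comp y
      (differentiableAt_of_contDiffOn (L.smooth_fld j) hy).hasFDerivAt)
  have h1 : M y = 1 := by
    ext i j
    simp only [M, Matrix.of_apply, fld, B_A hy, Matrix.one_apply]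
    simp
  have hd := hasFDerivAt_det_of_eq_one hM h1
  have hMdet : ∀ z, (L.A z).det = (L.A y).det * (M z).det := fun z => by
    have : L.A z = L.A y ∘L (L.B y ∘L L.A z) := by
      ext1 v
      simp [A_B hy]
    have h2 : (M z).det = (L.B y ∘L L.A z).det := (det_eq_sum (L.B y ∘L L.A z)).symm
    conv_lhs => rw [this]
    rw [h2]
    exact LinearMap.det_comp _ _
  have hpos : ∀ᶠ z in nhds y, 0 < (M z).det := by
    refine hd.continuousAt.eventually (lt_mem_nhds ?_)
    simp [h1]
  have hev : L.dens =ᶠ[nhds y] fun z => L.dens y * ((M z).det)⁻¹ := by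
    filter_upwards [hpos] with z hz
    rw [dens, hMdet, abs_mul, mul_inv, abs_of_pos hz, dens]
  refine HasFDerivAt.congr_of_eventuallyEq ?_ hev
  have hinv := (hasDerivAt_inv (x := (M y).det) (by rw [h1]; simp)).comp_hasFDerivAt y hd
  refine (hinv.const_mul (L.dens y)).congr_fderiv ?_
  rw [h1]
  simp

theorem fderiv_dens {y : Vec n} (hy : y ∈ L.W) (a : Fin n) :
    fderiv ℝ L.dens y (L.fld a y) = -(L.dens y) * ∑ b, L.gam a b b y := by
  rw [(L.hasFDerivAt_dens hy).fderiv]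
  simp [gam, sum_apply]

theorem trace_fderiv_fld {y : Vec n} (hy : y ∈ L.W) (a : Fin n) :
    LinearMap.trace ℝ (Vec n) (fderiv ℝ (L.fld a) y : Vec n →ₗ[ℝ] Vec n) = ∑ b, L.gam b a b y := by
  have h : (fderiv ℝ (L.fld a) y : Vec n →ₗ[ℝ] Vec n) =
      (L.A y : Vec n →ₗ[ℝ] Vec n) ∘ₗ
        ((L.B y : Vec n →ₗ[ℝ] Vec n) ∘ₗ (fderiv ℝ (L.fld a) y : Vec n →ₗ[ℝ] Vec n)) := by
    ext1 v
    simp [A_B hy]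
  rw [h, LinearMap.trace_comp_comm', trace_eq_sum_coord]
  rfl

/-- Divergence of h times a frame field. The derivative of the density contributes -Σ gam a b b and
the trace of the derivative of the field contributes Σ gam b a b; together they are the
structure-function divergence `dv`. -/
theorem trace_fderiv_dens_smul_fld {y : Vec n} (hy : y ∈ L.W) (a : Fin n) {h : Vec n → ℝ}
    (hh : DifferentiableAt ℝ h y) :
    LinearMap.trace ℝ (Vec n)
      (fderiv ℝ (fun z => (L.dens z * h z) • L.fld a z) y : Vec n →ₗ[ℝ] Vec n) =
      L.dens y * (fderiv ℝ h y (L.fld a y) + L.dv a y * h y) := by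
  have hd := (L.hasFDerivAt_dens hy).differentiableAt
  have h1 := (hd.hasFDerivAt.mul hh.hasFDerivAt).smul
    (differentiableAt_of_contDiffOn (L.smooth_fld a) hy).hasFDerivAt
  have h1' : fderiv ℝ (fun z => (L.dens z * h z) • L.fld a z) y = _ := h1.fderiv
  rw [h1']
  have h2 : ∀ (r : ℝ) (T : Vec n →L[ℝ] Vec n) (l : Vec n →L[ℝ] ℝ) (v : Vec n),
      LinearMap.trace ℝ (Vec n) ((r • T + l.smulRight v : Vec n →L[ℝ] Vec n) : Vec n →ₗ[ℝ] Vec n) =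
        r * LinearMap.trace ℝ (Vec n) (T : Vec n →ₗ[ℝ] Vec n) + l v := fun r T l v => by
    simp only [trace_eq_sum_coord, Finset.mul_sum]
    have : l v = ∑ i, l (bvec i) * v i := by
      have := map_eq_sum_bvec l.toLinearMap v
      simpa [mul_comm] using this
    rw [this, ← Finset.sum_add_distrib]
    simp
  rw [h2, L.trace_fderiv_fld hy, dv]
  simp only [add_apply, smul_apply, smul_eq_mul, L.fderiv_dens hy, sc_eq, Finset.sum_sub_distrib,
    Pi.mul_apply]
  ring

/-! ### The codifferential is adjoint to the exterior derivative -/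

theorem totInner_add_right (φ θ θ' : Tot n) :
    totInner φ (θ + θ') = totInner φ θ + totInner φ θ' := by
  rw [totInner_comm, totInner_add_left, totInner_comm θ, totInner_comm θ']

theorem totInner_smul_right (r : ℝ) (φ θ : Tot n) : totInner φ (r • θ) = r * totInner φ θ := by
  rw [totInner_comm, totInner_smul_left, totInner_comm θ]

/-- The inner product of forms of all degrees as a bilinear form. -/
noncomputable def totInnerₗ (n : ℕ) : Tot n →ₗ[ℝ] Tot n →ₗ[ℝ] ℝ :=
  LinearMap.mk₂ ℝ totInner totInner_add_left totInner_smul_left totInner_add_right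
    totInner_smul_right

theorem totInnerₗ_apply (φ θ : Tot n) : totInnerₗ n φ θ = totInner φ θ := rfl

theorem ev_div (a : Fin n) (F : L.sec) (y : Vec n) :
    L.ev y (L.ops.div a F) = L.dv a y • L.ev y F := by
  simp only [FrameOps.div, LinearMap.sum_apply, map_sum, ev_C, dv, Finset.sum_smul]

theorem ev_δ (G : L.sec) (y : Vec n) :
    L.ev y (L.ops.δ G) = -∑ a, L.ev y (L.deriv a (L.ops.i a G)) -
      ∑ a, L.dv a y • intMul a (L.ev y G) -
      (1 / 2 : ℝ) • ∑ a, ∑ b, ∑ c,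
        L.sc a b c y • extMul c (intMul b (intMul a (L.ev y G))) := by
  simp only [FrameOps.δ, LinearMap.sub_apply, LinearMap.neg_apply, LinearMap.smul_apply,
    LinearMap.sum_apply, map_sub, map_neg, map_smul, map_sum, Module.End.mul_apply, ev_e, ev_i,
    ev_C, ev_div]
  rfl

/-- The cubic terms cancel because exterior and interior multiplication are adjoint. What is left is
the divergence of the vector field Σ ⟨F, i_a G⟩ e_a, written in the frame. -/
theorem totInner_d_sub (F G : L.sec) (y : Vec n) :
    totInner (L.ev y (L.ops.d F)) (L.ev y G) - totInner (L.ev y F) (L.ev y (L.ops.δ G)) =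
      ∑ a, (totInner (L.ev y (L.deriv a F)) (L.ev y (L.ops.i a G)) +
        totInner (L.ev y F) (L.ev y (L.deriv a (L.ops.i a G))) +
        L.dv a y * totInner (L.ev y F) (L.ev y (L.ops.i a G))) := by
  have hadj : ∀ a (φ θ : Tot n), totInnerₗ n (intMul a φ) θ = totInnerₗ n φ (extMul a θ) := by
    intro a φ θ
    simp only [totInnerₗ_apply]
    rw [totInner_comm, ← totInner_extMul, totInner_comm]
  have hadj' : ∀ a (φ θ : Tot n), totInnerₗ n (extMul a φ) θ = totInnerₗ n φ (intMul a θ) :=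
    totInner_extMul
  rw [ev_d, ev_δ]
  simp only [← totInnerₗ_apply, map_sub, map_neg, map_smul, map_sum, LinearMap.sub_apply,
    LinearMap.smul_apply, LinearMap.sum_apply, hadj, hadj', smul_eq_mul, ev_i,
    Finset.sum_add_distrib]
  ring

theorem smooth_covInner {k : ℕ} {W : Set (Vec n)} {φ θ : Vec n → Cov n k}
    (hφ : ContDiffOn ℝ ∞ φ W) (hθ : ContDiffOn ℝ ∞ θ W) :
    ContDiffOn ℝ ∞ (fun y => covInner (φ y) (θ y)) W :=
  (covInnerₗ n k).toContinuousBilinearMap.isBoundedBilinearMap.contDiff.comp_contDiffOn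
    (hφ.prodMk hθ)

theorem smooth_totInner (F G : L.sec) :
    ContDiffOn ℝ ∞ (fun y => totInner (L.ev y F) (L.ev y G)) L.W :=
  ContDiffOn.sum fun k _ => smooth_covInner (F.2.1 k) (G.2.1 k)

theorem fderiv_totInner (F G : L.sec) {y : Vec n} (hy : y ∈ L.W) (a : Fin n) :
    fderiv ℝ (fun z => totInner (L.ev z F) (L.ev z G)) y (L.fld a y) =
      totInner (L.ev y (L.deriv a F)) (L.ev y G) + totInner (L.ev y F) (L.ev y (L.deriv a G)) := by
  have h : ∀ k, HasFDerivAt (fun z => covInner (L.ev z F k) (L.ev z G k)) _ y := fun k =>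
    (covInnerₗ n k).toContinuousBilinearMap.hasFDerivAt_of_bilinear
      (differentiableAt_sec F k hy).hasFDerivAt (differentiableAt_sec G k hy).hasFDerivAt
  have h2 := HasFDerivAt.fun_sum fun k (_ : k ∈ Finset.range (n + 1)) => h k
  unfold totInner
  rw [h2.fderiv, sum_apply, ← Finset.sum_add_distrib]
  refine Finset.sum_congr rfl fun k _ => ?_
  rw [ev_deriv a F hy, ev_deriv a G hy, add_comm]
  rfl

theorem ev_d_eq_zero {F : L.sec} {K : Set (Vec n)} (hK : IsClosed K)
    (h0 : ∀ y ∉ K, L.ev y F = 0) {y : Vec n} (hy : y ∉ K) : L.ev y (L.ops.d F) = 0 := by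
  by_cases hyW : y ∈ L.W
  · have hD : ∀ a, L.ev y (L.deriv a F) = 0 := fun a => funext fun k => by
      rw [ev_deriv a F hyW]
      have : (fun z => (F : Vec n → Tot n) z k) =ᶠ[nhds y] fun _ => 0 :=
        Filter.eventually_of_mem (hK.isOpen_compl.mem_nhds hy) fun z hz =>
          congrFun (h0 z hz) k
      rw [this.fderiv_eq, fderiv_fun_const]
      rfl
    rw [ev_d]
    simp [hD, h0 y hy]
  · exact (L.ops.d F).2.2 y hyW

/-- The two integrands differ by the divergence of a vector field supported in K, whose integral is
zero. -/
theorem integral_dens_mul_totInner_d (F G : L.sec) {K : Set (Vec n)} (hK : IsCompact K)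
    (hKW : K ⊆ L.W) (h0 : ∀ y ∉ K, L.ev y F = 0) :
    ∫ y, L.dens y * totInner (L.ev y (L.ops.d F)) (L.ev y G) =
      ∫ y, L.dens y * totInner (L.ev y F) (L.ev y (L.ops.δ G)) := by
  have hz : ∀ θ : Tot n, totInner 0 θ = 0 := fun θ => by
    rw [← totInnerₗ_apply, map_zero, LinearMap.zero_apply]
  have hint : ∀ F' G' : L.sec, (∀ y ∉ K, L.ev y F' = 0) →
      Integrable fun y => L.dens y * totInner (L.ev y F') (L.ev y G') := fun F' G' h0' => by
    obtain ⟨h1, h2⟩ := contDiff_of_contDiffOn_of_compact L.isOpen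
      (L.smooth_dens.mul (L.smooth_totInner F' G')) hK hKW fun y hy => by
        rw [h0' y hy, hz, mul_zero]
    exact h1.continuous.integrable_of_hasCompactSupport h2
  rw [← sub_eq_zero, ← integral_sub
    (hint _ _ fun y hy => L.ev_d_eq_zero hK.isClosed h0 hy) (hint _ _ h0)]
  let h : Fin n → Vec n → ℝ := fun a y => totInner (L.ev y F) (L.ev y (L.ops.i a G))
  have hh : ∀ a, ContDiffOn ℝ ∞ (h a) L.W := fun a => L.smooth_totInner F (L.ops.i a G)
  let X : Vec n → Vec n := fun y => ∑ a, (L.dens y * h a y) • L.fld a y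
  have hX : ContDiffOn ℝ ∞ X L.W :=
    ContDiffOn.sum fun a _ => (L.smooth_dens.mul (hh a)).smul (L.smooth_fld a)
  have hX0 : ∀ y ∉ K, X y = 0 := fun y hy => by
    refine Finset.sum_eq_zero fun a _ => ?_
    simp only [h, h0 y hy, hz, mul_zero, zero_smul]
  obtain ⟨h1, h2⟩ := contDiff_of_contDiffOn_of_compact L.isOpen hX hK hKW hX0
  rw [← integral_trace_fderiv_eq_zero h1 h2]
  congr 1
  funext y
  by_cases hy : y ∈ L.W
  · have hd : ∀ a, DifferentiableAt ℝ (fun z => (L.dens z * h a z) • L.fld a z) y := fun a =>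
      differentiableAt_of_contDiffOn ((L.smooth_dens.mul (hh a)).smul (L.smooth_fld a)) hy
    have hs : fderiv ℝ X y = ∑ a, fderiv ℝ (fun z => (L.dens z * h a z) • L.fld a z) y :=
      fderiv_fun_sum fun a _ => hd a
    have hs' : (fderiv ℝ X y : Vec n →ₗ[ℝ] Vec n) =
        ∑ a, (fderiv ℝ (fun z => (L.dens z * h a z) • L.fld a z) y : Vec n →ₗ[ℝ] Vec n) := by
      rw [hs]; ext1 v; simp
    rw [hs', map_sum, ← mul_sub, totInner_d_sub, Finset.mul_sum]
    refine Finset.sum_congr rfl fun a _ => ?_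
    rw [L.trace_fderiv_dens_smul_fld hy a (differentiableAt_of_contDiffOn (hh a) hy),
      L.fderiv_totInner F _ hy]
  · have hy' : y ∉ K := fun h => hy (hKW h)
    have hX' : X =ᶠ[nhds y] fun _ => 0 :=
      Filter.eventually_of_mem (hK.isClosed.isOpen_compl.mem_nhds hy') hX0
    rw [hX'.fderiv_eq, fderiv_fun_const, h0 y hy', L.ev_d_eq_zero hK.isClosed h0 hy', hz, hz]
    simp

end LocalFrame

end Divergence

end GradedForms

namespace GradedForms

open MeasureTheory Bundle

/-! ## Charts -/

section Charts

variable {n : ℕ} {M : Type*} [TopologicalSpace M] [ChartedSpace (Vec n) M]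

variable (n) in
/-- The preferred chart at a point. -/
noncomputable abbrev chart (c : M) : PartialEquiv M (Vec n) := extChartAt 𝓘(ℝ, Vec n) c

/-- The derivative of a chart. -/
noncomputable def tD (c x : M) : Vec n →L[ℝ] Vec n :=
  mfderiv 𝓘(ℝ, Vec n) 𝓘(ℝ, Vec n) (chart n c) x

/-- The derivative of the inverse of a chart. -/
noncomputable def tI (c : M) (y : Vec n) : Vec n →L[ℝ] Vec n :=
  mfderiv 𝓘(ℝ, Vec n) 𝓘(ℝ, Vec n) (chart n c).symm y

/-- A transition map between charts. -/
noncomputable def trans (c c' : M) (y : Vec n) : Vec n := chart n c' ((chart n c).symm y)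

theorem isOpen_chart_target (c : M) : IsOpen (chart n c).target := isOpen_extChartAt_target c

theorem isOpen_chart_source (c : M) : IsOpen (chart n c).source := isOpen_extChartAt_source c

theorem isOpen_overlap (c : M) {U : Set M} (hU : IsOpen U) :
    IsOpen ((chart n c).target ∩ (chart n c).symm ⁻¹' U) :=
  (continuousOn_extChartAt_symm c).isOpen_inter_preimage (isOpen_chart_target c) hU

theorem dirDeriv_congr (X : VField n M) {f f' : M → ℝ} {x : M} (h : f =ᶠ[nhds x] f') :
    dirDeriv X f x = dirDeriv X f' x := by
  unfold dirDeriv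
  rw [h.mfderiv_eq]
  rfl

theorem tI_eq (c : M) (y : Vec n) :
    tI c y = mfderivWithin 𝓘(ℝ, Vec n) 𝓘(ℝ, Vec n) (chart n c).symm
      (Set.range 𝓘(ℝ, Vec n)) y := by
  rw [tI, ModelWithCorners.range_eq_univ, mfderivWithin_univ]

theorem symm_trans (c c' : M) {y : Vec n}
    (hy' : (chart n c).symm y ∈ (chart n c').source) :
    (chart n c').symm (trans c c' y) = (chart n c).symm y := (chart n c').left_inv hy'

theorem trans_mem_target (c c' : M) {y : Vec n}
    (hy' : (chart n c).symm y ∈ (chart n c').source) :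
    trans c c' y ∈ (chart n c').target := (chart n c').map_source hy'

/-- The value of a form as an alternating form on the model space. -/
def val {k : ℕ} (θ : ∀ x : M, TangentSpace 𝓘(ℝ, Vec n) x [⋀^Fin k]→L[ℝ] ℝ) (x : M) : Cov n k :=
  θ x

theorem formInChart_eq {k : ℕ} (θ : ∀ x : M, TangentSpace 𝓘(ℝ, Vec n) x [⋀^Fin k]→L[ℝ] ℝ) (c : M)
    (y : Vec n) :
    formInChart c θ y = (val θ ((chart n c).symm y)).compContinuousLinearMap (tI c y) := rfl

/-- A vector field in a chart. -/
noncomputable def fieldInChart (c : M) (X : VField n M) (y : Vec n) : Vec n :=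
  tD c ((chart n c).symm y) (X ((chart n c).symm y))

variable [IsManifold 𝓘(ℝ, Vec n) ∞ M]

variable (n M) in
theorem isManifold_of_smooth {k : ℕ∞ω} (hk : k ≤ ∞) : IsManifold 𝓘(ℝ, Vec n) k M :=
  IsManifold.of_le (n := ∞) hk

variable (n M) in
theorem isManifold_one : IsManifold 𝓘(ℝ, Vec n) 1 M := isManifold_of_smooth n M (by
  exact_mod_cast (le_top : (1 : ℕ∞) ≤ ⊤))

variable (n M) in
theorem isManifold_minSmoothness_two : IsManifold 𝓘(ℝ, Vec n) (minSmoothness ℝ 2) M :=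
  isManifold_of_smooth n M two_le_smooth

variable (n M) in
theorem isManifold_minSmoothness_three : IsManifold 𝓘(ℝ, Vec n) (minSmoothness ℝ 3) M :=
  isManifold_of_smooth n M (by
    rw [minSmoothness_of_isRCLikeNormedField]
    exact WithTop.coe_le_coe.2 le_top)

theorem contMDiffAt_chart (c : M) {x : M} (hx : x ∈ (chart n c).source) :
    ContMDiffAt 𝓘(ℝ, Vec n) 𝓘(ℝ, Vec n) ∞ (chart n c) x := by
  rw [extChartAt_source] at hx
  exact contMDiffAt_extChartAt' hx

theorem contMDiffAt_chart_symm (c : M) {y : Vec n} (hy : y ∈ (chart n c).target) :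
    ContMDiffAt 𝓘(ℝ, Vec n) 𝓘(ℝ, Vec n) ∞ (chart n c).symm y :=
  (contMDiffOn_extChartAt_symm c).contMDiffAt ((isOpen_chart_target c).mem_nhds hy)

theorem mdifferentiableAt_chart (c : M) {x : M} (hx : x ∈ (chart n c).source) :
    MDifferentiableAt 𝓘(ℝ, Vec n) 𝓘(ℝ, Vec n) (chart n c) x :=
  (contMDiffAt_chart c hx).mdifferentiableAt (by simp)

theorem mdifferentiableAt_chart_symm (c : M) {y : Vec n} (hy : y ∈ (chart n c).target) :
    MDifferentiableAt 𝓘(ℝ, Vec n) 𝓘(ℝ, Vec n) (chart n c).symm y :=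
  (contMDiffAt_chart_symm c hy).mdifferentiableAt (by simp)

theorem tD_comp_tI (c : M) {y : Vec n} (hy : y ∈ (chart n c).target) :
    tD c ((chart n c).symm y) ∘L tI c y = ContinuousLinearMap.id ℝ (Vec n) := by
  have := isManifold_one n M
  rw [tI_eq]
  exact mfderiv_extChartAt_comp_mfderivWithin_extChartAt_symm hy

theorem tI_comp_tD (c : M) {y : Vec n} (hy : y ∈ (chart n c).target) :
    tI c y ∘L tD c ((chart n c).symm y) = ContinuousLinearMap.id ℝ (Vec n) := by
  have := isManifold_one n M
  rw [tI_eq]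
  exact mfderivWithin_extChartAt_symm_comp_mfderiv_extChartAt hy

theorem tI_tD (c : M) {y : Vec n} (hy : y ∈ (chart n c).target) (v : Vec n) :
    tI c y (tD c ((chart n c).symm y) v) = v :=
  congrArg (fun T => T v) (tI_comp_tD c hy)

theorem inverse_tI (c : M) {y : Vec n} (hy : y ∈ (chart n c).target) :
    (tI c y).inverse = tD c ((chart n c).symm y) :=
  ContinuousLinearMap.inverse_eq (tI_comp_tD c hy) (tD_comp_tI c hy)

theorem smoothAt_trans (c c' : M) {y : Vec n} (hy : y ∈ (chart n c).target)
    (hy' : (chart n c).symm y ∈ (chart n c').source) : ContDiffAt ℝ ∞ (trans c c') y :=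
  ((contMDiffAt_chart c' hy').comp y (contMDiffAt_chart_symm c hy)).contDiffAt

theorem fderiv_trans (c c' : M) {y : Vec n} (hy : y ∈ (chart n c).target)
    (hy' : (chart n c).symm y ∈ (chart n c').source) :
    fderiv ℝ (trans c c') y = tD c' ((chart n c).symm y) ∘L tI c y := by
  rw [← mfderiv_eq_fderiv]
  exact mfderiv_comp y (mdifferentiableAt_chart c' hy') (mdifferentiableAt_chart_symm c hy)

theorem tI_trans (c c' : M) {y : Vec n} (hy : y ∈ (chart n c).target)
    (hy' : (chart n c).symm y ∈ (chart n c').source) :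
    tI c' (trans c c' y) ∘L fderiv ℝ (trans c c') y = tI c y := by
  rw [fderiv_trans c c' hy hy', ← symm_trans c c' hy', ← ContinuousLinearMap.comp_assoc,
    tI_comp_tD c' (trans_mem_target c c' hy'), ContinuousLinearMap.id_comp]

theorem tI_self (x : M) : tI x (chart n x x) = ContinuousLinearMap.id ℝ (Vec n) := by
  have := isManifold_one n M
  rw [tI_eq]
  exact mfderivWithin_range_extChartAt_symm

/-! ### Forms in charts -/

theorem formInChart_trans {k : ℕ} (θ : ∀ x : M, TangentSpace 𝓘(ℝ, Vec n) x [⋀^Fin k]→L[ℝ] ℝ)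
    (c c' : M) {y : Vec n} (hy : y ∈ (chart n c).target)
    (hy' : (chart n c).symm y ∈ (chart n c').source) :
    formInChart c θ y =
      (formInChart c' θ (trans c c' y)).compContinuousLinearMap (fderiv ℝ (trans c c') y) := by
  rw [formInChart_eq, formInChart_eq, symm_trans c c' hy', ← tI_trans c c' hy hy']
  rfl

/-- The global operator uses a different chart at every point. Naturality of the exterior derivative
under transition maps shows that any fixed chart gives the same answer. -/
theorem formInChart_extDOfDegree {k : ℕ}
    {θ : ∀ x : M, TangentSpace 𝓘(ℝ, Vec n) x [⋀^Fin k]→L[ℝ] ℝ}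
    (hθ : ∀ c : M, ContDiffOn ℝ ∞ (formInChart c θ) (chart n c).target) (c : M) {y : Vec n}
    (hy : y ∈ (chart n c).target) :
    formInChart c (extDOfDegree θ) y = extDeriv (formInChart c θ) y := by
  set x := (chart n c).symm y with hx
  have hxx : x ∈ (chart n x).source := mem_extChartAt_source x
  have hev : formInChart c θ =ᶠ[nhds y] fun z =>
      (formInChart x θ (trans c x z)).compContinuousLinearMap (fderiv ℝ (trans c x) z) := by
    filter_upwards [(isOpen_overlap c (isOpen_chart_source (n := n) x)).mem_nhds ⟨hy, hxx⟩]
      with z hz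
    exact formInChart_trans θ c x hz.1 hz.2
  have hd : DifferentiableAt ℝ (formInChart x θ) (trans c x y) :=
    ((hθ x).contDiffAt ((isOpen_chart_target x).mem_nhds
      (trans_mem_target c x hxx))).differentiableAt (by simp)
  rw [hev.extDeriv_eq, extDeriv_pullback hd (smoothAt_trans c x hy hxx) two_le_smooth,
    fderiv_trans c x hy hxx]
  rfl

theorem formInChart_extD {η : Form n M} (hη : IsSmoothForm η) (c : M) (k : ℕ) {y : Vec n}
    (hy : y ∈ (chart n c).target) :
    formInChart c (extD η k) y = LocalFrame.extTot (fun k => formInChart c (η k)) k y := by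
  cases k with
  | zero => rfl
  | succ k => exact formInChart_extDOfDegree (fun c => hη k c) c hy

theorem IsSmoothForm.extD {η : Form n M} (hη : IsSmoothForm η) : IsSmoothForm (GradedForms.extD η) :=
  fun k c => (LocalFrame.smooth_extTot (isOpen_chart_target c) (fun k => hη k c) k).congr fun _ hy =>
    formInChart_extD hη c k hy

/-! ### Functions and vector fields in charts -/

theorem fderiv_comp_chart_symm {f : M → ℝ} (c : M) {y : Vec n} (hy : y ∈ (chart n c).target)
    (hf : MDifferentiableAt 𝓘(ℝ, Vec n) 𝓘(ℝ, ℝ) f ((chart n c).symm y)) (v : Vec n) :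
    fderiv ℝ (fun z => f ((chart n c).symm z)) y v =
      mfderiv 𝓘(ℝ, Vec n) 𝓘(ℝ, ℝ) f ((chart n c).symm y) (tI c y v) := by
  have h := mfderiv_comp y hf (mdifferentiableAt_chart_symm c hy)
  rw [mfderiv_eq_fderiv] at h
  exact congrArg (fun T => T v) h

theorem tI_fieldInChart (c : M) (X : VField n M) {y : Vec n} (hy : y ∈ (chart n c).target) :
    tI c y (fieldInChart c X y) = X ((chart n c).symm y) := tI_tD c hy _

theorem fieldInChart_eq_mpullback (c : M) (X : VField n M) {y : Vec n}
    (hy : y ∈ (chart n c).target) :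
    fieldInChart c X y =
      VectorField.mpullback 𝓘(ℝ, Vec n) 𝓘(ℝ, Vec n) (chart n c).symm X y := by
  rw [fieldInChart, ← inverse_tI c hy]
  rfl

/-- Smoothness of a vector field at a point. -/
abbrev SmoothFieldAt (X : VField n M) (x : M) : Prop :=
  ContMDiffAt 𝓘(ℝ, Vec n) (𝓘(ℝ, Vec n)).tangent ∞
    (fun x => (⟨x, X x⟩ : TangentBundle 𝓘(ℝ, Vec n) M)) x

/-- On the chart domain the derivative of the chart is the standard trivialization of the tangent
bundle, in which a smooth section has smooth components. -/
theorem smoothAt_fieldInChart {X : VField n M} {c : M} {y : Vec n} (hy : y ∈ (chart n c).target)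
    (hX : SmoothFieldAt X ((chart n c).symm y)) : ContDiffAt ℝ ∞ (fieldInChart c X) y := by
  have := isManifold_one n M
  have hs : (chart n c).symm y ∈ (chart n c).source := (chart n c).map_target hy
  have hs' : (chart n c).symm y ∈ (trivializationAt (Vec n) (TangentSpace 𝓘(ℝ, Vec n)) c).baseSet := by
    rw [extChartAt_source] at hs
    exact hs
  have h := ((trivializationAt (Vec n) (TangentSpace 𝓘(ℝ, Vec n)) c).contMDiffAt_section_iff
    (IB := 𝓘(ℝ, Vec n)) (n := ∞) hs').1 hX
  have h2 := h.comp y (contMDiffAt_chart_symm c hy)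
  refine ContDiffAt.congr_of_eventuallyEq h2.contDiffAt ?_
  filter_upwards [(isOpen_chart_target c).mem_nhds hy] with z hz
  have hz' : (chart n c).symm z ∈ (chartAt (Vec n) c).source := by
    rw [← extChartAt_source 𝓘(ℝ, Vec n)]
    exact (chart n c).map_target hz
  rw [fieldInChart, tD, ← TangentBundle.continuousLinearMapAt_trivializationAt hz']
  exact Trivialization.continuousLinearMapAt_apply_of_mem ℝ
    (trivializationAt (Vec n) (TangentSpace 𝓘(ℝ, Vec n)) c) hz' _

/-- Naturality of the bracket under pullback by the inverse chart; on the model space the manifold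
bracket is the ordinary one. -/
theorem mlieBracket_in_chart {X Y : VField n M} {c : M} {y : Vec n} (hy : y ∈ (chart n c).target)
    (hX : SmoothFieldAt X ((chart n c).symm y)) (hY : SmoothFieldAt Y ((chart n c).symm y)) :
    fieldInChart c (VectorField.mlieBracket 𝓘(ℝ, Vec n) X Y) y =
      VectorField.lieBracket ℝ (fieldInChart c X) (fieldInChart c Y) y := by
  have := isManifold_minSmoothness_three n M
  have := isManifold_minSmoothness_two n M
  rw [fieldInChart_eq_mpullback c _ hy, VectorField.mpullback_mlieBracket
    (hX.mdifferentiableAt (by simp)) (hY.mdifferentiableAt (by simp))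
    (contMDiffAt_chart_symm c hy) two_le_smooth]
  have h : ∀ X : VField n M, VectorField.mpullback 𝓘(ℝ, Vec n) 𝓘(ℝ, Vec n) (chart n c).symm X
      =ᶠ[nhds y] fieldInChart c X := fun X => by
    filter_upwards [(isOpen_chart_target c).mem_nhds hy] with z hz
    exact (fieldInChart_eq_mpullback c X hz).symm
  refine ((h X).mlieBracket_vectorField_eq (h Y)).trans ?_
  have h1 := congrFun (VectorField.mlieBracketWithin_eq_lieBracketWithin (𝕜 := ℝ)
    (V := fieldInChart c X) (W := fieldInChart c Y) (s := Set.univ)) y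
  rw [VectorField.lieBracketWithin_univ] at h1
  have h2 := congrFun (VectorField.mlieBracketWithin_univ (I := 𝓘(ℝ, Vec n))
    (V := fieldInChart c X) (W := fieldInChart c Y)) y
  exact h2.symm.trans h1

end Charts

end GradedForms

namespace GradedForms

open MeasureTheory Bundle

/-! ## Orthonormal frames -/

section Frames

variable {n : ℕ} {M : Type*} [TopologicalSpace M] [ChartedSpace (Vec n) M]
  [IsManifold 𝓘(ℝ, Vec n) ∞ M]

theorem covInner_comp {k : ℕ} {T : Vec n →L[ℝ] Vec n} {E : Fin n → Vec n}
    (hT : ∀ a, T (bvec a) = E a) (α β : Cov n k) :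
    covInner (α.compContinuousLinearMap T) (β.compContinuousLinearMap T) =
      ((k.factorial : ℝ))⁻¹ * ∑ p : Fin k → Fin n, ∑ q : Fin k → Fin n,
        (∏ l, ∑ a, E a (p l) * E a (q l)) * α (fun l => bvec (p l)) * β (fun l => bvec (q l)) := by
  have hexp : ∀ (θ : Cov n k) (d : Fin k → Fin n),
      θ.compContinuousLinearMap T (fun l => bvec (d l)) =
        ∑ p : Fin k → Fin n, (∏ l, E (d l) (p l)) * θ (fun l => bvec (p l)) := fun θ d => by
    rw [ContinuousAlternatingMap.compContinuousLinearMap_apply, cov_apply_eq_sum]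
    simp only [Function.comp_apply, hT]
  simp only [covInner, hexp, Fintype.prod_sum, Finset.prod_mul_distrib, Finset.sum_mul_sum]
  congr 1
  rw [Finset.sum_comm]
  refine Finset.sum_congr rfl fun p _ => ?_
  rw [Finset.sum_comm]
  refine Finset.sum_congr rfl fun q _ => ?_
  rw [Finset.sum_mul, Finset.sum_mul]
  refine Finset.sum_congr rfl fun d _ => ?_
  ring

/-- The metric as a bilinear form on the model space. -/
def met (g : Metric n M) (x : M) : Vec n →L[ℝ] Vec n →L[ℝ] ℝ := g.inner x

/-- A local orthonormal frame of the tangent bundle. -/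
structure OrthoFrame (g : Metric n M) where
  U : Set M
  isOpen : IsOpen U
  e : Fin n → VField n M
  smooth : ∀ a, ∀ x ∈ U, SmoothFieldAt (e a) x
  ortho : ∀ x ∈ U, ∀ a b, g.inner x (e a x) (e b x) = if a = b then 1 else 0

namespace OrthoFrame

variable {g : Metric n M} (F : OrthoFrame g)

/-- The members of the frame at a point, as elements of the model space. -/
def vec (a : Fin n) (x : M) : Vec n := F.e a x

/-- The linear map that takes the standard basis to the frame. -/
noncomputable def fr (x : M) : Vec n →L[ℝ] Vec n :=
  ∑ a, (EuclideanSpace.proj a : Vec n →L[ℝ] ℝ).smulRight (F.vec a x)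

theorem fr_apply (x : M) (v : Vec n) : F.fr x v = ∑ a, v a • F.vec a x := by
  simp [fr, sum_apply]

theorem fr_bvec (x : M) (a : Fin n) : F.fr x (bvec a) = F.vec a x := by
  rw [fr_apply, Finset.sum_eq_single a]
  · simp [bvec]
  · intro b _ hb
    simp [bvec, hb]
  · simp

variable {F} in
theorem met_vec {x : M} (hx : x ∈ F.U) (a b : Fin n) :
    met g x (F.vec a x) (F.vec b x) = if a = b then 1 else 0 := F.ortho x hx a b

variable {F} in
theorem met_fr_vec {x : M} (hx : x ∈ F.U) (v : Vec n) (b : Fin n) :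
    met g x (F.fr x v) (F.vec b x) = v b := by
  rw [fr_apply, map_sum, sum_apply, Finset.sum_eq_single b]
  · simp [met_vec hx]
  · intro a _ hab
    simp [met_vec hx, hab]
  · simp

variable {F} in
theorem injective_fr {x : M} (hx : x ∈ F.U) : Function.Injective (F.fr x) := by
  rw [injective_iff_map_eq_zero]
  intro v hv
  ext b
  rw [← met_fr_vec hx v b, hv, map_zero]
  rfl

/-- The frame at a point as a linear equivalence. -/
noncomputable def frEquiv {x : M} (hx : x ∈ F.U) : Vec n ≃L[ℝ] Vec n :=
  (LinearEquiv.ofInjectiveEndo (F.fr x : Vec n →ₗ[ℝ] Vec n) (injective_fr hx)).toContinuousLinearEquiv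

theorem coe_frEquiv {x : M} (hx : x ∈ F.U) : (F.frEquiv hx : Vec n →L[ℝ] Vec n) = F.fr x := by
  ext1 v
  rfl

/-- The frame in a chart. -/
noncomputable def inChart (c : M) : LocalFrame n where
  W := (chart n c).target ∩ (chart n c).symm ⁻¹' F.U
  isOpen := isOpen_overlap c F.isOpen
  A y := tD c ((chart n c).symm y) ∘L F.fr ((chart n c).symm y)
  smooth := by
    have : (fun y => tD c ((chart n c).symm y) ∘L F.fr ((chart n c).symm y)) = fun y =>
        ∑ a, (EuclideanSpace.proj a : Vec n →L[ℝ] ℝ).smulRight (fieldInChart c (F.e a) y) := by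
      funext y
      ext1 v
      simp only [ContinuousLinearMap.comp_apply, fr_apply, map_sum, map_smul, sum_apply,
        ContinuousLinearMap.smulRight_apply]
      rfl
    rw [this]
    refine ContDiffOn.sum fun a _ y hy => ?_
    exact (ContDiff.comp_contDiffAt y
      (ContinuousLinearMap.smulRightL ℝ (Vec n) (Vec n) (EuclideanSpace.proj a)).contDiff
      (smoothAt_fieldInChart hy.1 (F.smooth a _ hy.2))).contDiffWithinAt
  inv y hy := by
    refine ContinuousLinearMap.IsInvertible.comp ?_ ⟨F.frEquiv hy.2, F.coe_frEquiv hy.2⟩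
    exact ContinuousLinearMap.IsInvertible.of_inverse (tD_comp_tI c hy.1) (tI_comp_tD c hy.1)

variable {F} {c : M} {y : Vec n}

theorem inChart_A : (F.inChart c).A y = tD c ((chart n c).symm y) ∘L F.fr ((chart n c).symm y) := rfl

theorem fld_inChart (a : Fin n) : (F.inChart c).fld a = fieldInChart c (F.e a) := by
  funext y
  rw [LocalFrame.fld, inChart_A, ContinuousLinearMap.comp_apply, fr_bvec]
  rfl

theorem tI_A (hy : y ∈ (F.inChart c).W) (v : Vec n) :
    tI c y ((F.inChart c).A y v) = F.fr ((chart n c).symm y) v := tI_tD c hy.1 _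

theorem tI_fld (hy : y ∈ (F.inChart c).W) (a : Fin n) :
    tI c y ((F.inChart c).fld a y) = F.vec a ((chart n c).symm y) := by
  rw [LocalFrame.fld, tI_A hy, fr_bvec]

/-- Orthonormality identifies the coframe with the metric pairing against the frame. -/
theorem B_inChart (hy : y ∈ (F.inChart c).W) (v : Vec n) (a : Fin n) :
    (F.inChart c).B y v a =
      met g ((chart n c).symm y) (tI c y v) (F.vec a ((chart n c).symm y)) := by
  have h : tI c y v = F.fr ((chart n c).symm y) ((F.inChart c).B y v) := by
    rw [← tI_A hy, LocalFrame.A_B hy]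
  rw [h, met_fr_vec hy.2]

theorem formInChart_comp_A {k : ℕ} (θ : ∀ x : M, TangentSpace 𝓘(ℝ, Vec n) x [⋀^Fin k]→L[ℝ] ℝ)
    (hy : y ∈ (F.inChart c).W) :
    (formInChart c θ y).compContinuousLinearMap ((F.inChart c).A y) =
      (val θ ((chart n c).symm y)).compContinuousLinearMap (F.fr ((chart n c).symm y)) := by
  rw [formInChart_eq]
  ext v
  change val θ _ (fun l => tI c y ((F.inChart c).A y (v l))) = _
  simp only [tI_A hy]
  rfl

variable (F) in
/-- The structure functions of the frame. -/
noncomputable def br (a b d : Fin n) (x : M) : ℝ :=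
  met g x (VectorField.mlieBracket 𝓘(ℝ, Vec n) (F.e a) (F.e b) x) (F.vec d x)

variable (F) in
/-- The divergences of the members of the frame. -/
noncomputable def dv (a : Fin n) (x : M) : ℝ := ∑ b, F.br b a b x

theorem sc_inChart (hy : y ∈ (F.inChart c).W) (a b d : Fin n) :
    (F.inChart c).sc a b d y = F.br a b d ((chart n c).symm y) := by
  rw [LocalFrame.sc, fld_inChart, fld_inChart, ← mlieBracket_in_chart hy.1 (F.smooth a _ hy.2)
    (F.smooth b _ hy.2), B_inChart hy, tI_fieldInChart c _ hy.1]
  rfl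

theorem dv_inChart (hy : y ∈ (F.inChart c).W) (a : Fin n) :
    (F.inChart c).dv a y = F.dv a ((chart n c).symm y) := by
  simp only [LocalFrame.dv, dv, sc_inChart hy]

theorem dirDeriv_eq (hy : y ∈ (F.inChart c).W) (a : Fin n) {f : M → ℝ}
    (hf : MDifferentiableAt 𝓘(ℝ, Vec n) 𝓘(ℝ, ℝ) f ((chart n c).symm y)) :
    dirDeriv (F.e a) f ((chart n c).symm y) =
      fderiv ℝ (fun z => f ((chart n c).symm z)) y ((F.inChart c).fld a y) := by
  rw [fderiv_comp_chart_symm c hy.1 hf, tI_fld hy]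
  rfl

/-! ### The metric in terms of the frame -/

theorem coordField_self (x : M) (i : Fin n) : (coordField x i x : Vec n) = bvec i :=
  congrArg (fun T : Vec n →L[ℝ] Vec n => T (bvec i)) (tI_self x)

/-- If E is the matrix of frame components, orthonormality reads Eᵀ G E = 1, so E Eᵀ = G⁻¹. -/
theorem gram_self_inv {x : M} (hx : x ∈ F.U) (i j : Fin n) :
    (gram g x x)⁻¹ i j = ∑ a, F.vec a x i * F.vec a x j := by
  have hG : ∀ i j, gram g x x i j = met g x (bvec i) (bvec j) := fun i j => by
    rw [← coordField_self x i, ← coordField_self x j]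
    rfl
  let E : Matrix (Fin n) (Fin n) ℝ := Matrix.of fun i a => F.vec a x i
  have h1 : E.transpose * gram g x x * E = 1 := by
    ext a b
    rw [Matrix.one_apply, ← met_vec hx a b]
    conv_rhs => rw [← sum_coord_smul_bvec (F.vec a x), ← sum_coord_smul_bvec (F.vec b x)]
    simp only [Matrix.mul_apply, Matrix.transpose_apply, hG, map_sum, sum_apply, map_smul,
      smul_apply, smul_eq_mul, E, Matrix.of_apply, Finset.sum_mul]
    refine Finset.sum_congr rfl fun j _ => ?_
    rw [Finset.mul_sum]
    refine Finset.sum_congr rfl fun i _ => ?_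
    ring
  have h2 : E * (E.transpose * gram g x x) = 1 := mul_eq_one_comm.1 h1
  rw [Matrix.inv_eq_left_inv (B := E * E.transpose) (by rw [Matrix.mul_assoc, h2])]
  rfl

theorem raise_eq {x : M} (hx : x ∈ F.U) (l : Vec n →L[ℝ] ℝ) :
    raise g x (fun i => l (coordField x i x)) = ∑ a, l (F.vec a x) • F.vec a x := by
  have h : ∀ a, F.vec a x = ∑ i, F.vec a x i • bvec i := fun a =>
    (sum_coord_smul_bvec (F.vec a x)).symm
  have hl : ∀ a, l (F.vec a x) = ∑ i, F.vec a x i * l (bvec i) := fun a => by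
    conv_lhs => rw [h a]
    simp
  have h1 : raise g x (fun i => l (coordField x i x)) =
      ∑ i, ∑ j, ((∑ a, F.vec a x i * F.vec a x j) * l (bvec i)) • (bvec j : Vec n) := by
    refine Finset.sum_congr rfl fun i _ => Finset.sum_congr rfl fun j _ => ?_
    rw [gram_self_inv hx]
    exact congrArg₂ (fun u v : Vec n => ((∑ a, F.vec a x i * F.vec a x j) * l u) • v)
      (coordField_self x i) (coordField_self x j)
  have h2 : ∑ a, l (F.vec a x) • F.vec a x = ∑ a, ∑ i, ∑ j,
      (F.vec a x i * l (bvec i) * F.vec a x j) • (bvec j : Vec n) := by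
    refine Finset.sum_congr rfl fun a _ => ?_
    conv_lhs => rw [hl a]; enter [2]; rw [h a]
    simp only [Finset.sum_smul, Finset.smul_sum, smul_smul, Finset.sum_mul]
    exact Finset.sum_comm
  refine h1.trans (Eq.trans ?_ h2.symm)
  conv_rhs => rw [Finset.sum_comm]
  refine Finset.sum_congr rfl fun i _ => ?_
  conv_rhs => rw [Finset.sum_comm]
  refine Finset.sum_congr rfl fun j _ => ?_
  rw [Finset.sum_mul, Finset.sum_smul]
  refine Finset.sum_congr rfl fun a _ => ?_
  congr 1
  ring

theorem formInner_eq {k : ℕ} {x : M} (hx : x ∈ F.U)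
    (α β : TangentSpace 𝓘(ℝ, Vec n) x [⋀^Fin k]→L[ℝ] ℝ) :
    formInner g x α β =
      covInner (ContinuousAlternatingMap.compContinuousLinearMap (α : Cov n k) (F.fr x))
        (ContinuousAlternatingMap.compContinuousLinearMap (β : Cov n k) (F.fr x)) := by
  have hprod : ∀ p q : Fin k → Fin n, ∏ l, (gram g x x)⁻¹ (p l) (q l) =
      ∏ l, ∑ a, F.vec a x (p l) * F.vec a x (q l) := fun p q => by
    simp only [gram_self_inv hx]
  have hα : ∀ (θ : Cov n k) (p : Fin k → Fin n),
      θ (fun l => coordField x (p l) x) = θ (fun l => bvec (p l)) := fun θ p => by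
    simp only [coordField_self]
  have hform : formInner g x α β = ((k.factorial : ℝ))⁻¹ *
      ∑ p : Fin k → Fin n, ∑ q : Fin k → Fin n, (∏ l, (gram g x x)⁻¹ (p l) (q l)) *
        (α : Cov n k) (fun l => bvec (p l)) * (β : Cov n k) (fun l => bvec (q l)) := by
    unfold formInner
    refine congrArg _ (Finset.sum_congr rfl fun p _ => Finset.sum_congr rfl fun q _ => ?_)
    exact congrArg₂ (fun u v : ℝ => _ * u * v) (hα α p) (hα β q)
  simp only [hform, hprod]
  exact (covInner_comp (F.fr_bvec x) α β).symm

/-- Orthonormality gives Eᵀ G E = 1 in the chart, so det G = (det E)⁻², and the square root is |det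
E|⁻¹. -/
theorem density_eq (hy : y ∈ (F.inChart c).W) :
    density g c ((chart n c).symm y) = (F.inChart c).dens y := by
  let E : Matrix (Fin n) (Fin n) ℝ := Matrix.of fun i a => (F.inChart c).A y (bvec a) i
  have hG : ∀ i j, gram g c ((chart n c).symm y) i j =
      met g ((chart n c).symm y) (tI c y (bvec i)) (tI c y (bvec j)) := fun i j => by
    rw [gram, Matrix.of_apply, coordField, coordField, (chart n c).right_inv hy.1]
    rfl
  have h1 : E.transpose * gram g c ((chart n c).symm y) * E = 1 := by
    ext a b
    have hv : ∀ a, F.vec a ((chart n c).symm y) = ∑ i, E i a • tI c y (bvec i) := fun a => by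
      rw [← tI_fld hy]
      conv_lhs => rw [← sum_coord_smul_bvec ((F.inChart c).fld a y)]
      simp only [map_sum, map_smul]
      rfl
    rw [Matrix.one_apply, ← met_vec hy.2 a b, hv a, hv b]
    simp only [Matrix.mul_apply, Matrix.transpose_apply, hG, map_sum, sum_apply, map_smul,
      smul_apply, smul_eq_mul, Finset.sum_mul]
    refine Finset.sum_congr rfl fun j _ => ?_
    rw [Finset.mul_sum]
    refine Finset.sum_congr rfl fun i _ => ?_
    ring
  have h2 : (gram g c ((chart n c).symm y)).det = (E.det⁻¹) ^ 2 := by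
    have := congrArg Matrix.det h1
    rw [Matrix.det_mul, Matrix.det_mul, Matrix.det_transpose, Matrix.det_one] at this
    have h0 : E.det ≠ 0 := fun h => by simp [h] at this
    field_simp
    linarith
  rw [density, h2, Real.sqrt_sq_eq_abs, abs_inv, LocalFrame.dens, LocalFrame.det_eq_sum]

end OrthoFrame

end Frames

end GradedForms

namespace GradedForms

open MeasureTheory Bundle

/-! ## Functions as forms of degree zero, and Laplacians -/

section LocalFunctions

namespace LocalFrame

variable {n : ℕ} (L : LocalFrame n)

open Classical in
/-- A function as a form of degree zero. -/
noncomputable def ofFun (h : Vec n → ℝ) (hh : ContDiffOn ℝ ∞ h L.W) : L.sec :=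
  ⟨fun y k => match k with
    | 0 => if y ∈ L.W then h y • ContinuousAlternatingMap.constOfIsEmpty ℝ (Vec n) (Fin 0) 1 else 0
    | _ + 1 => 0, fun k => by
      cases k with
      | zero => exact (hh.smul contDiffOn_const).congr fun y hy => if_pos hy
      | succ k => exact contDiffOn_const, fun y hy => by
      funext k
      cases k with
      | zero => exact if_neg hy
      | succ k => rfl⟩

variable {L}

theorem ev_ofFun_zero {h : Vec n → ℝ} (hh : ContDiffOn ℝ ∞ h L.W) {y : Vec n} (hy : y ∈ L.W) :
    L.ev y (L.ofFun h hh) 0 =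
      h y • ContinuousAlternatingMap.constOfIsEmpty ℝ (Vec n) (Fin 0) 1 := if_pos hy

theorem ofFun_inj {h h' : Vec n → ℝ} {hh : ContDiffOn ℝ ∞ h L.W} {hh' : ContDiffOn ℝ ∞ h' L.W}
    (H : L.ofFun h hh = L.ofFun h' hh') {y : Vec n} (hy : y ∈ L.W) : h y = h' y := by
  have := congrArg (fun F => L.ev y F 0 (fun _ => 0)) H
  simp only [ev_ofFun_zero hh hy, ev_ofFun_zero hh' hy] at this
  simpa using this

theorem isVacuum_ofFun {h : Vec n → ℝ} (hh : ContDiffOn ℝ ∞ h L.W) :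
    L.ops.IsVacuum (L.ofFun h hh) := fun a => by
  refine L.sec_ext fun y hy => ?_
  change L.ev y (L.ops.i a (L.ofFun h hh)) = 0
  rw [ev_i]
  funext k
  rfl

theorem smooth_fderiv_fld {h : Vec n → ℝ} (hh : ContDiffOn ℝ ∞ h L.W) (a : Fin n) :
    ContDiffOn ℝ ∞ (fun y => fderiv ℝ h y (L.fld a y)) L.W :=
  (hh.fderiv_of_isOpen L.isOpen (by simp)).clm_apply (L.smooth_fld a)

theorem smooth_dv (a : Fin n) : ContDiffOn ℝ ∞ (L.dv a) L.W :=
  ContDiffOn.sum fun b _ => L.smooth_sc b a b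

theorem D_ofFun {h : Vec n → ℝ} (hh : ContDiffOn ℝ ∞ h L.W) (a : Fin n) :
    L.ops.D a • L.ofFun h hh = L.ofFun _ (smooth_fderiv_fld hh a) := by
  refine L.sec_ext fun y hy => funext fun k => ?_
  refine (L.ev_deriv a (L.ofFun h hh) hy k).trans ?_
  cases k with
  | zero =>
    have : (fun z => (L.ofFun h hh : Vec n → Tot n) z 0) =ᶠ[nhds y] fun z =>
        h z • ContinuousAlternatingMap.constOfIsEmpty ℝ (Vec n) (Fin 0) 1 :=
      Filter.eventually_of_mem (L.isOpen.mem_nhds hy) fun z hz => ev_ofFun_zero hh hz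
    have h1 := (differentiableAt_of_contDiffOn hh hy).hasFDerivAt.smul_const
      (ContinuousAlternatingMap.constOfIsEmpty ℝ (Vec n) (Fin 0) (1 : ℝ))
    rw [(h1.congr_of_eventuallyEq this).fderiv]
    exact (ev_ofFun_zero (smooth_fderiv_fld hh a) hy).symm
  | succ k =>
    have : (fun z => (L.ofFun h hh : Vec n → Tot n) z (k + 1)) = fun _ => 0 := rfl
    rw [this, fderiv_fun_const]
    rfl

theorem div_ofFun {h : Vec n → ℝ} (hh : ContDiffOn ℝ ∞ h L.W) (a : Fin n) :
    L.ops.div a • L.ofFun h hh = L.ofFun _ ((smooth_dv a).mul hh) := by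
  refine L.sec_ext fun y hy => funext fun k => ?_
  have h1 := congrFun (L.ev_div a (L.ofFun h hh) y) k
  refine h1.trans ?_
  cases k with
  | zero =>
    change L.dv a y • L.ev y (L.ofFun h hh) 0 = _
    rw [ev_ofFun_zero hh hy, smul_smul]
    exact (ev_ofFun_zero ((smooth_dv a).mul hh) hy).symm
  | succ k => exact (smul_zero (L.dv a y) : L.dv a y • (0 : Cov n (k + 1)) = 0)

variable (L) in
/-- The part of the Laplacian in the directions of some of the members of the frame. -/
noncomputable def lapFun (S : Finset (Fin n)) (h : Vec n → ℝ) (y : Vec n) : ℝ :=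
  ∑ a ∈ S, (fderiv ℝ (fun z => fderiv ℝ h z (L.fld a z)) y (L.fld a y) +
    L.dv a y * fderiv ℝ h y (L.fld a y))

theorem smooth_lapFun (S : Finset (Fin n)) {h : Vec n → ℝ} (hh : ContDiffOn ℝ ∞ h L.W) :
    ContDiffOn ℝ ∞ (L.lapFun S h) L.W :=
  ContDiffOn.sum fun a _ => (smooth_fderiv_fld (smooth_fderiv_fld hh a) a).add
    ((smooth_dv a).mul (smooth_fderiv_fld hh a))

theorem lap_ofFun (S : Finset (Fin n)) {h : Vec n → ℝ} (hh : ContDiffOn ℝ ∞ h L.W) :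
    L.ops.lap S • L.ofFun h hh = L.ofFun _ (smooth_lapFun S hh) := by
  have h1 : L.ops.lap S • L.ofFun h hh = ∑ a ∈ S,
      (L.ofFun _ (smooth_fderiv_fld (smooth_fderiv_fld hh a) a) +
        L.ofFun _ ((smooth_dv a).mul (smooth_fderiv_fld hh a))) := by
    simp only [FrameOps.lap, Finset.sum_smul, mul_smul, add_smul, D_ofFun hh, D_ofFun, div_ofFun]
  rw [h1]
  refine L.sec_ext fun y hy => funext fun k => ?_
  rw [← ev_apply, ← ev_apply, map_sum, Finset.sum_apply]
  simp only [map_add]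
  cases k with
  | zero =>
    rw [ev_ofFun_zero _ hy, lapFun, Finset.sum_smul]
    refine Finset.sum_congr rfl fun a _ => ?_
    rw [Pi.add_apply, ev_ofFun_zero _ hy, ev_ofFun_zero _ hy, ← add_smul]
  | succ k =>
    refine Finset.sum_eq_zero fun a _ => ?_
    rw [Pi.add_apply]
    exact add_zero _

/-- A function is regarded as a section of degree zero, and the algebraic commutation of the partial
Laplacians is applied to it. -/
theorem lapFun_comm {S : Finset (Fin n)} (hS : L.ops.IsSkew S) (hS' : L.ops.IsSkew Sᶜ)
    (h : L.ops.dPart S * L.ops.dPart Sᶜ + L.ops.dPart Sᶜ * L.ops.dPart S = 0)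
    {f : Vec n → ℝ} (hf : ContDiffOn ℝ ∞ f L.W) {y : Vec n} (hy : y ∈ L.W) :
    L.lapFun S (L.lapFun Sᶜ f) y = L.lapFun Sᶜ (L.lapFun S f) y := by
  have := (isVacuum_ofFun hf).lap_comm hS hS' h
  simp only [lap_ofFun] at this
  exact ofFun_inj this hy

theorem lapFun_add_compl (S : Finset (Fin n)) (f : Vec n → ℝ) :
    L.lapFun Finset.univ f = L.lapFun S f + L.lapFun Sᶜ f := by
  funext y
  exact (Finset.sum_add_sum_compl S _).symm

theorem lapFun_congr (S : Finset (Fin n)) {f f' : Vec n → ℝ} {y : Vec n}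
    (h : f =ᶠ[nhds y] f') : L.lapFun S f y = L.lapFun S f' y := by
  refine Finset.sum_congr rfl fun a _ => ?_
  have h1 : (fun z => fderiv ℝ f z (L.fld a z)) =ᶠ[nhds y] fun z => fderiv ℝ f' z (L.fld a z) := by
    filter_upwards [h.eventuallyEq_nhds] with z hz
    rw [hz.fderiv_eq]
  rw [h1.fderiv_eq, h.fderiv_eq]

theorem lapFun_add (S : Finset (Fin n)) {f f' : Vec n → ℝ} (hf : ContDiffOn ℝ ∞ f L.W)
    (hf' : ContDiffOn ℝ ∞ f' L.W) {y : Vec n} (hy : y ∈ L.W) :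
    L.lapFun S (f + f') y = L.lapFun S f y + L.lapFun S f' y := by
  unfold lapFun
  rw [← Finset.sum_add_distrib]
  refine Finset.sum_congr rfl fun a _ => ?_
  have h1 : (fun z => fderiv ℝ (f + f') z (L.fld a z)) =ᶠ[nhds y]
      fun z => fderiv ℝ f z (L.fld a z) + fderiv ℝ f' z (L.fld a z) := by
    filter_upwards [L.isOpen.mem_nhds hy] with z hz
    rw [fderiv_add (differentiableAt_of_contDiffOn hf hz) (differentiableAt_of_contDiffOn hf' hz),
      add_apply]
  rw [h1.fderiv_eq, fderiv_add (differentiableAt_of_contDiffOn hf hy)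
    (differentiableAt_of_contDiffOn hf' hy),
    fderiv_fun_add (differentiableAt_of_contDiffOn (smooth_fderiv_fld hf a) hy)
    (differentiableAt_of_contDiffOn (smooth_fderiv_fld hf' a) hy), add_apply, add_apply]
  ring

/-- The full Laplacian is the sum of the parts for S and its complement: the first commutes with
itself, the second by the previous result. -/
theorem lapFun_univ_comm {S : Finset (Fin n)} (hS : L.ops.IsSkew S) (hS' : L.ops.IsSkew Sᶜ)
    (h : L.ops.dPart S * L.ops.dPart Sᶜ + L.ops.dPart Sᶜ * L.ops.dPart S = 0)
    {f : Vec n → ℝ} (hf : ContDiffOn ℝ ∞ f L.W) {y : Vec n} (hy : y ∈ L.W) :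
    L.lapFun S (L.lapFun Finset.univ f) y = L.lapFun Finset.univ (L.lapFun S f) y := by
  rw [lapFun_add_compl S, lapFun_add S (smooth_lapFun S hf) (smooth_lapFun Sᶜ hf) hy,
    lapFun_add_compl S, Pi.add_apply, lapFun_comm hS hS' h hf hy]

end LocalFrame

end LocalFunctions

/-! ## Divergence and gradient in a frame -/

section Divergence

variable {n : ℕ} {M : Type*} [TopologicalSpace M] [ChartedSpace (Vec n) M]
  [IsManifold 𝓘(ℝ, Vec n) ∞ M] {g : Metric n M}

theorem mdifferentiableAt_of_chart {f : M → ℝ} {c : M} {y : Vec n} (hy : y ∈ (chart n c).target)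
    (hf : DifferentiableAt ℝ (fun z => f ((chart n c).symm z)) y) :
    MDifferentiableAt 𝓘(ℝ, Vec n) 𝓘(ℝ, ℝ) f ((chart n c).symm y) := by
  have hs := (chart n c).map_target hy
  have h1 := hf.mdifferentiableAt
  rw [← (chart n c).right_inv hy] at h1
  refine (h1.comp _ (mdifferentiableAt_chart c hs)).congr_of_eventuallyEq ?_
  filter_upwards [(isOpen_chart_source c).mem_nhds hs] with z hz
  exact congrArg f ((chart n c).left_inv hz).symm

theorem IsSmoothFun.inChart {f : M → ℝ} (hf : IsSmoothFun (n := n) f) (c : M) :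
    ContDiffOn ℝ ∞ (fun z => f ((chart n c).symm z)) (chart n c).target :=
  (hf.comp_contMDiffOn (contMDiffOn_extChartAt_symm c)).contDiffOn

namespace OrthoFrame

variable (F : OrthoFrame g)

theorem grad_eq {x : M} (hx : x ∈ F.U) (f : M → ℝ) :
    (grad g f x : Vec n) = ∑ a, dirDeriv (F.e a) f x • F.vec a x :=
  raise_eq hx (mfderiv 𝓘(ℝ, Vec n) 𝓘(ℝ, ℝ) f x : Vec n →L[ℝ] ℝ)

/-- The chart density is the density of the frame, so the coordinate divergence is a sum of
divergences of multiples of frame fields. The factor `dens` cancels against its inverse. -/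
theorem divergence_eq {x : M} (hx : x ∈ F.U) {X : VField n M} {h : Fin n → M → ℝ}
    (hX : ∀ᶠ z in nhds x, (X z : Vec n) = ∑ a, h a z • F.vec a z)
    (hh : ∀ a, MDifferentiableAt 𝓘(ℝ, Vec n) 𝓘(ℝ, ℝ) (h a) x) :
    divergence g X x = ∑ a, (dirDeriv (F.e a) (h a) x + F.dv a x * h a x) := by
  set L := F.inChart x with hL
  set y := chart n x x with hy
  have hyt : y ∈ (chart n x).target := mem_extChartAt_target x
  have hxy : (chart n x).symm y = x := extChartAt_to_inv x
  have hyW : y ∈ L.W := ⟨hyt, by rw [Set.mem_preimage, hxy]; exact hx⟩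
  have hh' : ∀ a, MDifferentiableAt 𝓘(ℝ, Vec n) 𝓘(ℝ, ℝ) (h a) ((chart n x).symm y) := by
    rwa [hxy]
  have hd : ∀ a, DifferentiableAt ℝ (fun z => h a ((chart n x).symm z)) y := fun a =>
    ((hh' a).comp y (mdifferentiableAt_chart_symm x hyt)).differentiableAt
  have hev : ∀ᶠ z in nhds y, density g x ((chart n x).symm z) • fieldInChart x X z =
      ∑ a, (L.dens z * h a ((chart n x).symm z)) • L.fld a z := by
    have hcont : Filter.Tendsto (chart n x).symm (nhds y) (nhds x) := by
      have := (mdifferentiableAt_chart_symm x hyt).continuousAt.tendsto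
      rwa [hxy] at this
    filter_upwards [L.isOpen.mem_nhds hyW, hcont.eventually hX] with z hz hz'
    rw [density_eq hz, fieldInChart, hz', map_sum, Finset.smul_sum]
    refine Finset.sum_congr rfl fun a _ => ?_
    rw [map_smul, smul_smul, fld_inChart]
    rfl
  have hds : ∀ a, DifferentiableAt ℝ
      (fun z => (L.dens z * h a ((chart n x).symm z)) • L.fld a z) y := fun a =>
    ((L.hasFDerivAt_dens hyW).differentiableAt.mul (hd a)).smul
      (LocalFrame.differentiableAt_of_contDiffOn (L.smooth_fld a) hyW)
  have h1 : divergence g X x = (L.dens y)⁻¹ * LinearMap.trace ℝ (Vec n)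
      (fderiv ℝ (fun z => density g x ((chart n x).symm z) • fieldInChart x X z) y :
        Vec n →ₗ[ℝ] Vec n) := by
    rw [← density_eq hyW, hxy]
    rfl
  have h2 : ((∑ a, fderiv ℝ (fun z => (L.dens z * h a ((chart n x).symm z)) • L.fld a z) y :
      Vec n →L[ℝ] Vec n) : Vec n →ₗ[ℝ] Vec n) =
      ∑ a, (fderiv ℝ (fun z => (L.dens z * h a ((chart n x).symm z)) • L.fld a z) y :
        Vec n →ₗ[ℝ] Vec n) := by
    ext1 v; simp
  rw [h1, Filter.EventuallyEq.fderiv_eq hev, fderiv_fun_sum fun a _ => hds a, h2, map_sum,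
    Finset.mul_sum]
  refine Finset.sum_congr rfl fun a _ => ?_
  rw [L.trace_fderiv_dens_smul_fld hyW a (hd a), ← mul_assoc,
    inv_mul_cancel₀ (LocalFrame.dens_pos hyW).ne', one_mul, dv_inChart hyW,
    ← dirDeriv_eq hyW a (hh' a), hxy]

/-- The divergence of the part of the gradient of a function along some of the members of the
frame. -/
theorem divergence_partial_grad {c : M} {y : Vec n} (hy : y ∈ (F.inChart c).W) {f : M → ℝ}
    (hf : ContDiffOn ℝ ∞ (fun z => f ((chart n c).symm z)) (F.inChart c).W)
    (S : Finset (Fin n)) {X : VField n M}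
    (hX : ∀ x ∈ F.U, (X x : Vec n) = ∑ a ∈ S, dirDeriv (F.e a) f x • F.vec a x) :
    divergence g X ((chart n c).symm y) =
      (F.inChart c).lapFun S (fun z => f ((chart n c).symm z)) y := by
  classical
  set L := F.inChart c with hL
  have hd : ∀ z ∈ L.W, ∀ a, dirDeriv (F.e a) f ((chart n c).symm z) =
      fderiv ℝ (fun z => f ((chart n c).symm z)) z (L.fld a z) := fun z hz a =>
    dirDeriv_eq hz a (mdifferentiableAt_of_chart hz.1
      (LocalFrame.differentiableAt_of_contDiffOn hf hz))
  have hev : ∀ a, (fun z => dirDeriv (F.e a) f ((chart n c).symm z)) =ᶠ[nhds y]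
      fun z => fderiv ℝ (fun z => f ((chart n c).symm z)) z (L.fld a z) := fun a =>
    Filter.eventually_of_mem (L.isOpen.mem_nhds hy) fun z hz => hd z hz a
  have hm : ∀ a, MDifferentiableAt 𝓘(ℝ, Vec n) 𝓘(ℝ, ℝ) (dirDeriv (F.e a) f)
      ((chart n c).symm y) := fun a =>
    mdifferentiableAt_of_chart hy.1 ((LocalFrame.differentiableAt_of_contDiffOn
      (LocalFrame.smooth_fderiv_fld hf a) hy).congr_of_eventuallyEq (hev a))
  -- Coefficients outside S are set to zero so that the expansion over the whole frame applies.
  let h : Fin n → M → ℝ := fun a x => if a ∈ S then dirDeriv (F.e a) f x else 0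
  have hh : ∀ a, MDifferentiableAt 𝓘(ℝ, Vec n) 𝓘(ℝ, ℝ) (h a) ((chart n c).symm y) := fun a => by
    by_cases ha : a ∈ S
    · simpa only [h, if_pos ha] using hm a
    · simpa only [h, if_neg ha] using mdifferentiableAt_const
  rw [F.divergence_eq hy.2 (h := h) ?_ hh]
  · rw [LocalFrame.lapFun, ← Finset.sum_subset (Finset.subset_univ S)]
    · refine Finset.sum_congr rfl fun a ha => ?_
      have : h a = dirDeriv (F.e a) f := by
        funext x
        exact if_pos ha
      rw [this, dirDeriv_eq hy a (hm a), (hev a).fderiv_eq, hd y hy a, dv_inChart hy]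
    · intro a _ ha
      have : h a = fun _ => 0 := by
        funext x
        exact if_neg ha
      rw [this, mul_zero, add_zero, dirDeriv, mfderiv_const]
      rfl
  · filter_upwards [F.isOpen.mem_nhds hy.2] with x hx
    rw [hX x hx, ← Finset.sum_subset (Finset.subset_univ S)]
    · exact Finset.sum_congr rfl fun a ha => by simp only [h, if_pos ha]; rfl
    · intro a _ ha
      simp only [h, if_neg ha, zero_smul]

theorem laplacian_eq {c : M} {y : Vec n} (hy : y ∈ (F.inChart c).W) {f : M → ℝ}
    (hf : ContDiffOn ℝ ∞ (fun z => f ((chart n c).symm z)) (F.inChart c).W) :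
    laplacian g f ((chart n c).symm y) =
      (F.inChart c).lapFun Finset.univ (fun z => f ((chart n c).symm z)) y :=
  F.divergence_partial_grad hy hf Finset.univ fun _ hx => F.grad_eq hx f

end OrthoFrame

end Divergence

end GradedForms

namespace GradedForms

open MeasureTheory Bundle

/-! ## Bigraded parts in a frame -/

section Parts

variable {n : ℕ}

theorem bigradedPart_apply {k : ℕ} (P Q : Vec n →L[ℝ] Vec n) (p q : ℤ) (θ : Cov n k)
    (v : Fin k → Vec n) :
    bigradedPart P Q p q θ v =
      ∑ s : Finset (Fin k) with ((s.card : ℤ) = p ∧ (sᶜ.card : ℤ) = q),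
        θ (fun i => if i ∈ s then P (v i) else Q (v i)) :=
  bigradedMultilinear_apply P Q p q θ v

/-- The projection to the span of some of the standard vectors. -/
noncomputable def coordProj (S : Finset (Fin n)) : Vec n →L[ℝ] Vec n :=
  ∑ a ∈ S, (EuclideanSpace.proj a : Vec n →L[ℝ] ℝ).smulRight (bvec a)

theorem coordProj_apply (S : Finset (Fin n)) (v : Vec n) :
    coordProj S v = ∑ a ∈ S, v a • bvec a := by
  simp [coordProj, sum_apply]

theorem coordProj_bvec (S : Finset (Fin n)) (a : Fin n) :
    coordProj S (bvec a) = if a ∈ S then bvec a else 0 := by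
  rw [coordProj_apply]
  split_ifs with h
  · rw [Finset.sum_eq_single_of_mem a h]
    · simp
    · intro b _ hb
      simp [hb]
  · refine Finset.sum_eq_zero fun b hb => ?_
    have : b ≠ a := fun e => h (e ▸ hb)
    simp [this]

/-- The bigraded parts of forms of all degrees. -/
noncomputable def partOp (S : Finset (Fin n)) (p q : ℤ) : Tot n →ₗ[ℝ] Tot n where
  toFun φ k := bigradedPart (coordProj S) (coordProj Sᶜ) p q (φ k)
  map_add' φ θ := by
    funext k
    ext v
    change bigradedPart _ _ p q (φ k + θ k) v =
      bigradedPart _ _ p q (φ k) v + bigradedPart _ _ p q (θ k) v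
    simp only [bigradedPart_apply, ContinuousAlternatingMap.add_apply, Finset.sum_add_distrib]
  map_smul' r φ := by
    funext k
    ext v
    change bigradedPart _ _ p q (r • φ k) v = r * bigradedPart _ _ p q (φ k) v
    simp only [bigradedPart_apply, ContinuousAlternatingMap.smul_apply, smul_eq_mul, Finset.mul_sum]

theorem partOp_apply (S : Finset (Fin n)) (p q : ℤ) (φ : Tot n) (k : ℕ) :
    partOp S p q φ k = bigradedPart (coordProj S) (coordProj Sᶜ) p q (φ k) := rfl

theorem finitary_partOp (S : Finset (Fin n)) (p q : ℤ) : Finitary (partOp S p q) := fun k =>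
  ⟨k, (LinearMap.proj k ∘ₗ partOp S p q) ∘ₗ LinearMap.single ℝ (fun k => Cov n k) k, fun φ => by
    simp [partOp_apply]⟩

/-- The number of slots that are filled with members of a set. -/
def slots {k : ℕ} (S : Finset (Fin n)) (c : Fin k → Fin n) : ℕ :=
  (Finset.univ.filter fun l => c l ∈ S).card

theorem slots_le {k : ℕ} (S : Finset (Fin n)) (c : Fin k → Fin n) : slots S c ≤ k := by
  simpa [slots] using Finset.card_filter_le Finset.univ fun l => c l ∈ S

theorem slots_compl {k : ℕ} (S : Finset (Fin n)) (c : Fin k → Fin n) :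
    slots Sᶜ c = ((Finset.univ.filter fun l => c l ∈ S)ᶜ).card := by
  simp only [slots, Finset.compl_filter, Finset.mem_compl]

/-- On basis vectors the projections are 0 or the identity. Hence the only choice of slots that can
contribute is the set of slots filled with members of S, and its size decides the bidegree. -/
theorem partOp_apply_bvec (S : Finset (Fin n)) (p q : ℤ) (φ : Tot n) (k : ℕ)
    (c : Fin k → Fin n) :
    partOp S p q φ k (fun l => bvec (c l)) =
      if (slots S c : ℤ) = p ∧ (slots Sᶜ c : ℤ) = q then φ k (fun l => bvec (c l)) else 0 := by
  rw [partOp_apply, bigradedPart_apply]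
  simp only [coordProj_bvec]
  set s₀ : Finset (Fin k) := Finset.univ.filter fun l => c l ∈ S with hs₀
  have h0 : ∀ s : Finset (Fin k), s ≠ s₀ → φ k (fun i => if i ∈ s then
      (if c i ∈ S then bvec (c i) else 0) else if c i ∈ Sᶜ then bvec (c i) else 0) = 0 := by
    intro s hs
    obtain ⟨i, hi⟩ : ∃ i, ¬(i ∈ s ↔ i ∈ s₀) := by
      by_contra hcon
      push Not at hcon
      exact hs (Finset.ext hcon)
    refine (φ k).map_coord_zero i ?_
    have hi' : i ∈ s₀ ↔ c i ∈ S := by simp [hs₀]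
    rw [hi'] at hi
    by_cases h1 : i ∈ s <;> by_cases h2 : c i ∈ S <;> simp_all
  have h1 : φ k (fun i => if i ∈ s₀ then
      (if c i ∈ S then bvec (c i) else 0) else if c i ∈ Sᶜ then bvec (c i) else 0) =
      φ k (fun l => bvec (c l)) := by
    congr 1
    funext i
    by_cases h2 : c i ∈ S <;> simp [hs₀, h2]
  rw [slots_compl, ← hs₀, show slots S c = s₀.card from rfl]
  split_ifs with hpq
  · rw [Finset.sum_eq_single_of_mem s₀ (by simpa using hpq), h1]
    exact fun s _ hs => h0 s hs
  · refine Finset.sum_eq_zero fun s hs => h0 s ?_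
    rintro rfl
    exact hpq (by simpa using hs)

theorem extMul_intMul_apply (a : Fin n) (φ : Tot n) (k : ℕ) (c : Fin k → Fin n) :
    extMul a (intMul a φ) k (fun l => bvec (c l)) =
      ∑ l, if c l = a then φ k (fun l => bvec (c l)) else 0 := by
  cases k with
  | zero => simp
  | succ k =>
    rw [extMul_succ, wedgeLeft_apply]
    refine Finset.sum_congr rfl fun i _ => ?_
    split_ifs with h
    · have h1 : (i.insertNth (bvec a) (i.removeNth fun l => (bvec (c l) : Vec n)) :
          Fin (k + 1) → Vec n) = fun l => bvec (c l) := by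
        rw [← h]
        exact Fin.insertNth_self_removeNth i _
      have h2 := ContinuousAlternatingMap.map_insertNth (φ (k + 1)) i (bvec a)
        (i.removeNth fun l => (bvec (c l) : Vec n))
      rw [h1] at h2
      rw [h2, h]
      simp [intMul_apply]
    · have : (EuclideanSpace.proj a : Vec n →L[ℝ] ℝ) (bvec (c i)) = 0 := by
        simp [Ne.symm h]
      rw [this, zero_mul, mul_zero]

namespace LocalFrame

variable (L : LocalFrame n)

/-- The projection to a bigraded part. -/
noncomputable def partEnd (S : Finset (Fin n)) (p q : ℤ) : Module.End ℝ L.sec :=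
  L.lift (partOp S p q) (finitary_partOp S p q)

/-! ### Bidegrees as eigenvalues of number operators -/

variable {L}

theorem ev_partEnd (S : Finset (Fin n)) (p q : ℤ) (F : L.sec) (y : Vec n) :
    L.ev y (L.partEnd S p q F) = partOp S p q (L.ev y F) := rfl

/-- Each e_a i_a counts the slots filled with a, so the number operator acts diagonally on
coefficients. This links weights to bidegrees. -/
theorem ev_num (S : Finset (Fin n)) (F : L.sec) (y : Vec n) (k : ℕ) (c : Fin k → Fin n) :
    L.ev y (L.ops.num S F) k (fun l => bvec (c l)) =
      slots S c * L.ev y F k (fun l => bvec (c l)) := by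
  simp only [FrameOps.num, LinearMap.sum_apply, Module.End.mul_apply, map_sum, ev_e, ev_i,
    Finset.sum_apply, ContinuousAlternatingMap.sum_apply, extMul_intMul_apply]
  rw [Finset.sum_comm]
  simp only [Finset.sum_ite_eq]
  rw [← Finset.sum_filter, Finset.sum_const, nsmul_eq_mul]
  rfl

theorem num_partEnd (S : Finset (Fin n)) (p q : ℤ) :
    L.ops.num S * L.partEnd S p q = (p : ℝ) • L.partEnd S p q := by
  refine L.end_ext fun F y _ => funext fun k => cov_ext fun c => ?_
  rw [Module.End.mul_apply, ev_num, LinearMap.smul_apply, map_smul, Pi.smul_apply, ContinuousAlternatingMap.smul_apply,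
    ev_partEnd, partOp_apply_bvec]
  split_ifs with h
  · rw [← h.1]; simp
  · simp

theorem num_compl_partEnd (S : Finset (Fin n)) (p q : ℤ) :
    L.ops.num Sᶜ * L.partEnd S p q = (q : ℝ) • L.partEnd S p q := by
  refine L.end_ext fun F y _ => funext fun k => cov_ext fun c => ?_
  rw [Module.End.mul_apply, ev_num, LinearMap.smul_apply, map_smul, Pi.smul_apply, ContinuousAlternatingMap.smul_apply,
    ev_partEnd, partOp_apply_bvec]
  split_ifs with h
  · rw [← h.2]; simp
  · simp

theorem num_mul_of_hasWeight {T : Finset (Fin n)} {w r : ℝ} {x z : Module.End ℝ L.sec}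
    (hx : L.ops.HasWeight T w x) (hz : L.ops.num T * z = r • z) :
    L.ops.num T * (x * z) = (r + w) • (x * z) := by
  have h : L.ops.num T * x = x * L.ops.num T + w • x := by
    rw [← hx]; abel
  rw [← mul_assoc, h, add_mul, mul_assoc, hz, smul_mul_assoc, mul_smul_comm, ← add_smul]

/-- Because the number operator is diagonal, a coefficient in its r-eigenspace vanishes unless its
slot count is r. -/
theorem slots_of_num_mul {T : Finset (Fin n)} {r : ℝ} {z : Module.End ℝ L.sec}
    (hz : L.ops.num T * z = r • z) (F : L.sec) (y : Vec n) (k : ℕ) (c : Fin k → Fin n) :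
    (slots T c : ℝ) = r ∨ L.ev y (z F) k (fun l => bvec (c l)) = 0 := by
  have h := congrArg (fun x : Module.End ℝ L.sec => L.ev y (x F) k (fun l => bvec (c l))) hz
  simp only [Module.End.mul_apply, ev_num, LinearMap.smul_apply, map_smul, Pi.smul_apply,
    ContinuousAlternatingMap.smul_apply, smul_eq_mul] at h
  rw [← sub_eq_zero, ← sub_mul, mul_eq_zero, sub_eq_zero] at h
  exact h

/-- The image of bidegree (p, q) has p + w slots in S, which misses p + a; already the first degree
decides. -/
theorem partEnd_mul_of_hasWeight_ne {S : Finset (Fin n)} {w : ℝ} {x : Module.End ℝ L.sec}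
    (hx : L.ops.HasWeight S w x) (p q a b : ℤ) (hw : w ≠ a) :
    L.partEnd S (p + a) (q + b) * (x * L.partEnd S p q) = 0 := by
  refine L.end_ext fun F y _ => funext fun k => cov_ext fun c => ?_
  rw [Module.End.mul_apply, ev_partEnd, partOp_apply_bvec]
  split_ifs with h
  · rcases slots_of_num_mul (num_mul_of_hasWeight hx (num_partEnd S p q)) F y k c
      with h1 | h1
    · exfalso
      have h2 : ((slots S c : ℤ) : ℝ) = ((p + a : ℤ) : ℝ) := by rw [h.1]
      push_cast at h2
      exact hw (by linarith)
    · exact h1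
  · rfl

/-- Known weights for both S and its complement force the image into exactly this bidegree, so the
outer projection does nothing. -/
theorem partEnd_mul_of_hasWeight {S : Finset (Fin n)} {x : Module.End ℝ L.sec} {a b : ℤ}
    (hx : L.ops.HasWeight S a x) (hx' : L.ops.HasWeight Sᶜ b x) (p q : ℤ) :
    L.partEnd S (p + a) (q + b) * (x * L.partEnd S p q) = x * L.partEnd S p q := by
  refine L.end_ext fun F y _ => funext fun k => cov_ext fun c => ?_
  rw [Module.End.mul_apply, ev_partEnd, partOp_apply_bvec]
  split_ifs with h
  · rfl
  · symm
    rcases slots_of_num_mul (num_mul_of_hasWeight hx (num_partEnd S p q)) F y k c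
      with h1 | h1
    · rcases slots_of_num_mul (num_mul_of_hasWeight hx' (num_compl_partEnd S p q)) F y k c
        with h2 | h2
      · exact absurd ⟨by exact_mod_cast h1, by exact_mod_cast h2⟩ h
      · exact h2
    · exact h1

/-- In degree at most n both slot counts are at most n, so exactly one pair (p, q) of the range
contributes; higher degrees are zero. -/
theorem sum_partEnd (S : Finset (Fin n)) :
    ∑ p ∈ Finset.range (n + 1), ∑ q ∈ Finset.range (n + 1), L.partEnd S p q = 1 := by
  refine L.end_ext fun F y _ => funext fun k => cov_ext fun c => ?_
  simp only [LinearMap.sum_apply, map_sum, Finset.sum_apply, ContinuousAlternatingMap.sum_apply, ev_partEnd,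
    partOp_apply_bvec, Module.End.one_apply, Nat.cast_inj]
  by_cases hk : n < k
  · rw [cov_eq_zero_of_lt hk (L.ev y F k)]
    simp
  · have h1 := (slots_le S c).trans (not_lt.1 hk)
    have h2 := (slots_le Sᶜ c).trans (not_lt.1 hk)
    rw [Finset.sum_eq_single_of_mem (slots S c) (by simpa [Nat.lt_succ_iff] using h1),
      Finset.sum_eq_single_of_mem (slots Sᶜ c) (by simpa [Nat.lt_succ_iff] using h2)]
    · simp
    · intro q _ hq
      simp [hq.symm]
    · intro p _ hp
      simp [hp.symm]

/-- The component of a sum of operators of different weights. -/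
theorem sum_partEnd_mul {S : Finset (Fin n)} {x y z : Module.End ℝ L.sec} {a b : ℤ} {w w' : ℝ}
    (hx : L.ops.HasWeight S a x) (hx' : L.ops.HasWeight Sᶜ b x) (hy : L.ops.HasWeight S w y)
    (hz : L.ops.HasWeight S w' z) (hw : w ≠ a) (hw' : w' ≠ a) :
    ∑ p ∈ Finset.range (n + 1), ∑ q ∈ Finset.range (n + 1),
      L.partEnd S (p + a) (q + b) * ((x + y + z) * L.partEnd S p q) = x := by
  simp only [add_mul, mul_add, partEnd_mul_of_hasWeight hx hx',
    partEnd_mul_of_hasWeight_ne hy _ _ a b hw, partEnd_mul_of_hasWeight_ne hz _ _ a b hw', add_zero]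
  simp only [← Finset.mul_sum, sum_partEnd, mul_one]

end LocalFrame

end Parts

end GradedForms

namespace GradedForms

open MeasureTheory Bundle

/-! ## Existence of adapted orthonormal frames -/

section Existence

variable {n : ℕ} {M : Type*} [TopologicalSpace M] [ChartedSpace (Vec n) M]
  [IsManifold 𝓘(ℝ, Vec n) ∞ M]

theorem SmoothFieldAt.add {X Y : VField n M} {x : M} (hX : SmoothFieldAt X x)
    (hY : SmoothFieldAt Y x) : SmoothFieldAt (fun x => X x + Y x) x := by
  have := isManifold_one n M
  exact ContMDiffAt.add_section hX hY

theorem SmoothFieldAt.smul {f : M → ℝ} {X : VField n M} {x : M}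
    (hf : ContMDiffAt 𝓘(ℝ, Vec n) 𝓘(ℝ, ℝ) ∞ f x) (hX : SmoothFieldAt X x) :
    SmoothFieldAt (fun x => f x • X x) x := by
  have := isManifold_one n M
  exact ContMDiffAt.smul_section hf hX

theorem smoothFieldAt_sum {ι : Type*} {s : Finset ι} {X : ι → VField n M} {x : M}
    (hX : ∀ i ∈ s, SmoothFieldAt (X i) x) : SmoothFieldAt (fun x => ∑ i ∈ s, X i x) x := by
  have := isManifold_one n M
  exact ContMDiffAt.sum_section hX

theorem SmoothFieldAt.inner (g : Metric n M) {X Y : VField n M} {x : M} (hX : SmoothFieldAt X x)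
    (hY : SmoothFieldAt Y x) :
    ContMDiffAt 𝓘(ℝ, Vec n) 𝓘(ℝ, ℝ) ∞ (fun x => g.inner x (X x) (Y x)) x := by
  have := isManifold_one n M
  have h : ContMDiffAt 𝓘(ℝ, Vec n) ((𝓘(ℝ, Vec n)).prod 𝓘(ℝ)) ∞
      (fun m => TotalSpace.mk' ℝ (E := Bundle.Trivial M ℝ) m (g.inner m (X m) (Y m))) x := by
    apply ContMDiffAt.clm_bundle_apply₂ (F₁ := Vec n) (F₂ := Vec n)
    · exact g.contMDiff.contMDiffAt
    · exact hX
    · exact hY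
  simp only [contMDiffAt_totalSpace] at h
  exact h.2

/-- Gram–Schmidt, carried out smoothly and for vector fields at once, with the span kept fixed at
every point. -/
theorem exists_orthonormal (g : Metric n M) {U : Set M} {r : ℕ} (X : Fin r → VField n M)
    (hX : ∀ i, ∀ x ∈ U, SmoothFieldAt (X i) x)
    (hli : ∀ x ∈ U, LinearIndependent ℝ (fun i => X i x)) :
    ∃ E : Fin r → VField n M, (∀ i, ∀ x ∈ U, SmoothFieldAt (E i) x) ∧
      ∀ x ∈ U, (∀ i j, g.inner x (E i x) (E j x) = if i = j then 1 else 0) ∧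
        Submodule.span ℝ (Set.range fun i => E i x) =
          Submodule.span ℝ (Set.range fun i => X i x) := by
  induction r with
  | zero =>
    refine ⟨X, hX, fun x _ => ⟨fun i => i.elim0, rfl⟩⟩
  | succ r ih =>
    obtain ⟨E, hE, hEx⟩ := ih (fun i => X i.castSucc) (fun i => hX i.castSucc) fun x hx =>
      (hli x hx).comp _ (Fin.castSucc_injective r)
    -- The last field minus its orthogonal projection to the span of the fields already treated;
    -- linear independence keeps it nonzero.
    let Y : VField n M := fun x =>
      X (Fin.last r) x + ∑ j, (-g.inner x (X (Fin.last r) x) (E j x)) • E j x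
    have hY : ∀ x ∈ U, SmoothFieldAt Y x := fun x hx =>
      (hX _ x hx).add (smoothFieldAt_sum fun j _ =>
        SmoothFieldAt.smul ((hX _ x hx).inner g (hE j x hx)).neg (hE j x hx))
    have hYE : ∀ x ∈ U, ∀ j, g.inner x (Y x) (E j x) = 0 := fun x hx j => by
      simp only [Y, map_add, map_sum, map_smul, add_apply, sum_apply, smul_apply, smul_eq_mul,
        (hEx x hx).1]
      simp
    have hmem : ∀ x ∈ U, ∑ j, (-g.inner x (X (Fin.last r) x) (E j x)) • E j x ∈
        Submodule.span ℝ (Set.range fun i : Fin r => X i.castSucc x) := fun x hx => by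
      rw [← (hEx x hx).2]
      exact Submodule.sum_mem _ fun j _ =>
        Submodule.smul_mem _ _ (Submodule.subset_span ⟨j, rfl⟩)
    have hY0 : ∀ x ∈ U, Y x ≠ 0 := fun x hx h0 => by
      have h1 := (linearIndependent_finSucc'.1 (hli x hx)).2
      refine h1 ?_
      have h2 : X (Fin.last r) x = -∑ j, (-g.inner x (X (Fin.last r) x) (E j x)) • E j x :=
        eq_neg_of_add_eq_zero_left h0
      rw [h2]
      exact Submodule.neg_mem _ (hmem x hx)
    have hpos : ∀ x ∈ U, 0 < g.inner x (Y x) (Y x) := fun x hx => g.pos x _ (hY0 x hx)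
    let ρ : M → ℝ := fun x => (√(g.inner x (Y x) (Y x)))⁻¹
    have hρ0 : ∀ x ∈ U, ρ x ≠ 0 := fun x hx => inv_ne_zero (Real.sqrt_pos.2 (hpos x hx)).ne'
    have hρ : ∀ x ∈ U, ContMDiffAt 𝓘(ℝ, Vec n) 𝓘(ℝ, ℝ) ∞ ρ x := fun x hx => by
      have h : ContDiffAt ℝ ∞ (fun t : ℝ => (√t)⁻¹) (g.inner x (Y x) (Y x)) :=
        (Real.contDiffAt_sqrt (hpos x hx).ne').inv (Real.sqrt_pos.2 (hpos x hx)).ne'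
      exact ContMDiffAt.comp (g := fun t : ℝ => (√t)⁻¹) x h.contMDiffAt
        ((hY x hx).inner g (hY x hx))
    have hρY : ∀ x ∈ U, ρ x * (ρ x * g.inner x (Y x) (Y x)) = 1 := fun x hx => by
      have := Real.mul_self_sqrt (hpos x hx).le
      have h2 := (Real.sqrt_pos.2 (hpos x hx)).ne'
      simp only [ρ]
      field_simp
      rw [sq, this]
    refine ⟨Fin.snoc E fun x => ρ x • Y x, fun i => ?_, fun x hx => ⟨fun i j => ?_, ?_⟩⟩
    · refine Fin.lastCases ?_ (fun i => ?_) i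
      · simp only [Fin.snoc_last]
        exact fun x hx => (hY x hx).smul (hρ x hx)
      · simp only [Fin.snoc_castSucc]
        exact hE i
    · refine Fin.lastCases ?_ (fun i => ?_) i <;> refine Fin.lastCases ?_ (fun j => ?_) j
      · simp only [Fin.snoc_last, map_smul, smul_apply, smul_eq_mul, hρY x hx, if_true]
      · simp only [Fin.snoc_last, Fin.snoc_castSucc, map_smul, smul_apply, smul_eq_mul, hYE x hx,
          mul_zero, (Fin.castSucc_lt_last j).ne', if_false]
      · simp only [Fin.snoc_last, Fin.snoc_castSucc, g.symm x (E i x), map_smul, smul_apply, smul_eq_mul,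
          hYE x hx, mul_zero, (Fin.castSucc_lt_last i).ne, if_false]
      · simp only [Fin.snoc_castSucc, (hEx x hx).1, Fin.castSucc_inj]
    · have hsnoc : ∀ (Z : Fin r → VField n M) (Z' : VField n M),
          (Set.range fun i => (Fin.snoc Z Z' : Fin (r + 1) → VField n M) i x) =
            insert (Z' x) (Set.range fun i => Z i x) := fun Z Z' => by
        ext v
        simp only [Set.mem_range, Set.mem_insert_iff, Fin.exists_fin_succ', Fin.snoc_castSucc,
          Fin.snoc_last, or_comm, eq_comm]
      have hX' : (Set.range fun i => X i x) =
          insert (X (Fin.last r) x) (Set.range fun i : Fin r => X i.castSucc x) := by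
        rw [← hsnoc (fun i => X i.castSucc) (X (Fin.last r))]
        congr 1
        funext i
        refine Fin.lastCases ?_ (fun i => ?_) i <;> simp
      rw [hsnoc, hX', Submodule.span_insert, Submodule.span_insert, (hEx x hx).2,
        Submodule.span_singleton_smul_eq (hρ0 x hx).isUnit]
      have hm := hmem x hx
      refine le_antisymm (sup_le ?_ le_sup_right) (sup_le ?_ le_sup_right)
      · rw [Submodule.span_singleton_le_iff_mem]
        exact Submodule.add_mem _ (Submodule.mem_sup_left (Submodule.mem_span_singleton_self _))
          (Submodule.mem_sup_right hm)
      · rw [Submodule.span_singleton_le_iff_mem]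
        have : X (Fin.last r) x = Y x +
            -∑ j, (-g.inner x (X (Fin.last r) x) (E j x)) • E j x := by
          simp only [Y, add_neg_cancel_right]
        rw [this]
        exact Submodule.add_mem _ (Submodule.mem_sup_left (Submodule.mem_span_singleton_self _))
          (Submodule.mem_sup_right (Submodule.neg_mem _ hm))

theorem IsSmoothSubbundle.exists_orthonormal {g : Metric n M}
    {D : ∀ x : M, Submodule ℝ (TangentSpace 𝓘(ℝ, Vec n) x)} (hD : IsSmoothSubbundle D) (x₀ : M) :
    ∃ (U : Set M) (r : ℕ) (E : Fin r → VField n M), IsOpen U ∧ x₀ ∈ U ∧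
      (∀ i, ∀ x ∈ U, SmoothFieldAt (E i) x) ∧
      ∀ x ∈ U, (∀ i j, g.inner x (E i x) (E j x) = if i = j then 1 else 0) ∧
        Submodule.span ℝ (Set.range fun i => E i x) = D x := by
  obtain ⟨r, hr⟩ := hD
  obtain ⟨U, hU, X, hX, hXD⟩ := hr x₀
  obtain ⟨E, hE, hEx⟩ := GradedForms.exists_orthonormal g (U := interior U) X
    (fun i x hx => (hX i).contMDiffAt (mem_interior_iff_mem_nhds.1 hx))
    (fun x hx => (hXD x (interior_subset hx)).1)
  exact ⟨interior U, r, E, isOpen_interior, mem_interior_iff_mem_nhds.2 hU, hE, fun x hx =>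
    ⟨(hEx x hx).1, (hEx x hx).2.trans (hXD x (interior_subset hx)).2⟩⟩

/-- A local orthonormal frame each of whose members is horizontal or vertical. -/
structure AdaptedFrame {g : Metric n M} (S : Splitting g) extends OrthoFrame g where
  hs : Finset (Fin n)
  mem_H : ∀ x ∈ U, ∀ a ∈ hs, e a x ∈ S.H x
  mem_V : ∀ x ∈ U, ∀ a ∉ hs, e a x ∈ S.V x

theorem orthonormal_linearIndependent (g : Metric n M) (x : M) {ι : Type*} [DecidableEq ι]
    {E : ι → TangentSpace 𝓘(ℝ, Vec n) x}
    (hE : ∀ i j, g.inner x (E i) (E j) = if i = j then 1 else 0) : LinearIndependent ℝ E := by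
  rw [linearIndependent_iff']
  intro s c hc i hi
  have h := congrArg (fun v => g.inner x v (E i)) hc
  simp only [map_sum, map_smul, sum_apply, smul_apply, hE, smul_eq_mul, map_zero, zero_apply] at h
  simpa [hi] using h

/-- Orthonormal frames of H and V are concatenated. Orthogonality of the splitting makes the union
orthonormal, and complementarity makes the ranks add up to n. -/
theorem Splitting.exists_adaptedFrame {g : Metric n M} (S : Splitting g) (x₀ : M) :
    ∃ F : AdaptedFrame S, x₀ ∈ F.U := by
  classical
  obtain ⟨U₁, r₁, E₁, hU₁, hx₁, hs₁, ho₁⟩ := S.smooth_H.exists_orthonormal (g := g) x₀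
  obtain ⟨U₂, r₂, E₂, hU₂, hx₂, hs₂, ho₂⟩ := S.smooth_V.exists_orthonormal (g := g) x₀
  have hH : ∀ x ∈ U₁, ∀ i, E₁ i x ∈ S.H x := fun x hx i => by
    rw [← (ho₁ x hx).2]
    exact Submodule.subset_span ⟨i, rfl⟩
  have hV : ∀ x ∈ U₂, ∀ i, E₂ i x ∈ S.V x := fun x hx i => by
    rw [← (ho₂ x hx).2]
    exact Submodule.subset_span ⟨i, rfl⟩
  have : FiniteDimensional ℝ (TangentSpace 𝓘(ℝ, Vec n) x₀) :=
    inferInstanceAs (FiniteDimensional ℝ (Vec n))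
  have hr : r₁ + r₂ = n := by
    have h1 := Submodule.finrank_add_eq_of_isCompl (S.isCompl x₀)
    have h3 : Module.finrank ℝ (TangentSpace 𝓘(ℝ, Vec n) x₀) = n :=
      finrank_euclideanSpace_fin (𝕜 := ℝ) (n := n)
    rw [h3, ← (ho₁ x₀ hx₁).2, ← (ho₂ x₀ hx₂).2,
      finrank_span_eq_card (orthonormal_linearIndependent g x₀ (ho₁ x₀ hx₁).1),
      finrank_span_eq_card (orthonormal_linearIndependent g x₀ (ho₂ x₀ hx₂).1),
      Fintype.card_fin, Fintype.card_fin] at h1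
    exact h1
  let σ : Fin n ≃ Fin r₁ ⊕ Fin r₂ := (finSumFinEquiv.trans (finCongr hr)).symm
  let E : Fin r₁ ⊕ Fin r₂ → VField n M := Sum.elim E₁ E₂
  have hE : ∀ i, ∀ x ∈ U₁ ∩ U₂, SmoothFieldAt (E i) x := by
    rintro (i | i) x hx
    · exact hs₁ i x hx.1
    · exact hs₂ i x hx.2
  have hEo : ∀ x ∈ U₁ ∩ U₂, ∀ i j, g.inner x (E i x) (E j x) = if i = j then 1 else 0 := by
    rintro x hx (i | i) (j | j)
    · simpa [E] using (ho₁ x hx.1).1 i j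
    · simpa [E] using S.orthogonal x _ (hH x hx.1 i) _ (hV x hx.2 j)
    · simpa [E, g.symm x (E₂ i x)] using S.orthogonal x _ (hH x hx.1 j) _ (hV x hx.2 i)
    · simpa [E] using (ho₂ x hx.2).1 i j
  refine ⟨{ U := U₁ ∩ U₂
            isOpen := hU₁.inter hU₂
            e := fun a => E (σ a)
            smooth := fun a => hE (σ a)
            ortho := fun x hx a b => ?_
            hs := Finset.univ.filter fun a => (σ a).isLeft
            mem_H := fun x hx a ha => ?_
            mem_V := fun x hx a ha => ?_ }, hx₁, hx₂⟩
  · simp only [hEo x hx, σ.injective.eq_iff]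
  · rcases h : σ a with i | i
    · simpa only [h, E, Sum.elim_inl] using hH x hx.1 i
    · simp [h] at ha
  · rcases h : σ a with i | i
    · simp [h] at ha
    · simpa only [h, E, Sum.elim_inr] using hV x hx.2 i

end Existence

end GradedForms

namespace GradedForms

open MeasureTheory Bundle

/-! ## The Riemannian volume in a chart -/

section Volume

variable {n : ℕ} {M : Type*} [TopologicalSpace M] [ChartedSpace (Vec n) M]

theorem trans_trans (c c' : M) {y : Vec n} (hy : y ∈ (chart n c).target)
    (hy' : (chart n c).symm y ∈ (chart n c').source) : trans c' c (trans c c' y) = y := by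
  rw [trans, symm_trans c c' hy', (chart n c).right_inv hy]

theorem measurableSet_overlap [MeasurableSpace M] [BorelSpace M] (c : M) {A : Set M} (hA : MeasurableSet A) :
    MeasurableSet ((chart n c).target ∩ (chart n c).symm ⁻¹' A) := by
  have h := continuousOn_iff_continuous_domRestrict.1 (continuousOn_extChartAt_symm
    (I := 𝓘(ℝ, Vec n)) c)
  have h2 := (isOpen_chart_target (n := n) c).measurableSet.subtype_image (h.measurable hA)
  convert h2 using 1
  ext y
  constructor
  · exact fun hy => ⟨⟨y, hy.1⟩, hy.2, rfl⟩
  · rintro ⟨z, hz, rfl⟩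
    exact ⟨z.2, hz⟩

theorem aemeasurable_chart_symm [MeasurableSpace M] [BorelSpace M] (c : M) {ρ : Measure (Vec n)}
    (hρ : ρ ≪ volume.restrict (chart n c).target) :
    AEMeasurable (chart n c).symm ρ :=
  ((continuousOn_extChartAt_symm c).aemeasurable (isOpen_chart_target c).measurableSet).mono_ac hρ

variable [IsManifold 𝓘(ℝ, Vec n) ∞ M] {g : Metric n M}

/-- A frame near the point expresses both densities as |det A|⁻¹, and its two coordinate matrices
differ by the derivative of the transition map. -/
theorem density_trans (hF : ∀ x : M, ∃ F : OrthoFrame g, x ∈ F.U) (c c' : M) {y : Vec n}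
    (hy : y ∈ (chart n c).target) (hy' : (chart n c).symm y ∈ (chart n c').source) :
    |(fderiv ℝ (trans c c') y).det| * density g c' ((chart n c).symm y) =
      density g c ((chart n c).symm y) := by
  obtain ⟨F, hx⟩ := hF ((chart n c).symm y)
  have hW : y ∈ (F.inChart c).W := ⟨hy, hx⟩
  have hW' : trans c c' y ∈ (F.inChart c').W :=
    ⟨trans_mem_target c c' hy', by rw [Set.mem_preimage, symm_trans c c' hy']; exact hx⟩
  have h1 := OrthoFrame.density_eq hW'
  have h2 := OrthoFrame.density_eq hW
  rw [symm_trans c c' hy'] at h1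
  rw [h1, h2, LocalFrame.dens, LocalFrame.dens]
  have h3 : (F.inChart c').A (trans c c' y) = fderiv ℝ (trans c c') y ∘L (F.inChart c).A y := by
    ext1 v
    rw [fderiv_trans c c' hy hy', ContinuousLinearMap.comp_apply, ContinuousLinearMap.comp_apply,
      OrthoFrame.tI_A hW, OrthoFrame.inChart_A, symm_trans c c' hy']
    rfl
  have h4 : ((F.inChart c').A (trans c c' y)).det =
      (fderiv ℝ (trans c c') y).det * ((F.inChart c).A y).det := by
    rw [h3]; exact LinearMap.det_comp _ _
  have h5 := LocalFrame.det_ne_zero hW'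
  rw [h4] at h5 ⊢
  rw [abs_mul, mul_inv, ← mul_assoc, mul_inv_cancel₀ (abs_ne_zero.2 (left_ne_zero_of_mul h5)),
    one_mul]

theorem smooth_density (hF : ∀ x : M, ∃ F : OrthoFrame g, x ∈ F.U) (c : M) :
    ContDiffOn ℝ ∞ (fun y => density g c ((chart n c).symm y)) (chart n c).target := fun y hy => by
  obtain ⟨F, hx⟩ := hF ((chart n c).symm y)
  have hW : y ∈ (F.inChart c).W := ⟨hy, hx⟩
  refine ContDiffAt.contDiffWithinAt ?_
  refine (((F.inChart c).smooth_dens).contDiffAt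
    ((F.inChart c).isOpen.mem_nhds hW)).congr_of_eventuallyEq ?_
  filter_upwards [(F.inChart c).isOpen.mem_nhds hW] with z hz
  exact OrthoFrame.density_eq hz

variable [MeasurableSpace M] [BorelSpace M]

/-- Change of variables under the transition map; the Jacobian is exactly the ratio of the
densities. -/
theorem lintegral_density_trans (hF : ∀ x : M, ∃ F : OrthoFrame g, x ∈ F.U) (c c' : M) {A : Set M}
    (hA : MeasurableSet A) (hc : A ⊆ (chart n c).source) (hc' : A ⊆ (chart n c').source) :
    ∫⁻ y in (chart n c').target ∩ (chart n c').symm ⁻¹' A,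
        ENNReal.ofReal (density g c' ((chart n c').symm y)) =
      ∫⁻ y in (chart n c).target ∩ (chart n c).symm ⁻¹' A,
        ENNReal.ofReal (density g c ((chart n c).symm y)) := by
  have himg : trans c c' '' ((chart n c).target ∩ (chart n c).symm ⁻¹' A) =
      (chart n c').target ∩ (chart n c').symm ⁻¹' A := by
    ext z
    constructor
    · rintro ⟨y, hy, rfl⟩
      exact ⟨trans_mem_target c c' (hc' hy.2), by
        rw [Set.mem_preimage, symm_trans c c' (hc' hy.2)]; exact hy.2⟩
    · intro hz
      refine ⟨trans c' c z, ⟨trans_mem_target c' c (hc hz.2), ?_⟩,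
        trans_trans c' c hz.1 (hc hz.2)⟩
      rw [Set.mem_preimage, symm_trans c' c (hc hz.2)]
      exact hz.2
  rw [← himg, lintegral_image_eq_lintegral_abs_det_fderiv_mul volume (measurableSet_overlap c hA)
    (fun y hy => ((smoothAt_trans c c' hy.1 (hc' hy.2)).differentiableAt
      (by simp)).hasFDerivAt.hasFDerivWithinAt)
    (fun y hy z hz hyz => by
      rw [← trans_trans c c' hy.1 (hc' hy.2), hyz, trans_trans c c' hz.1 (hc' hz.2)])]
  refine setLIntegral_congr_fun (measurableSet_overlap c hA) fun y hy => ?_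
  rw [symm_trans c c' (hc' hy.2), ← ENNReal.ofReal_mul (abs_nonneg _),
    density_trans hF c c' hy.1 (hc' hy.2)]

variable [SecondCountableTopology M] [Nonempty M]

/-- The pieces used in the definition partition M. On A intersected with each piece the integral is
moved to the chart at c, and the pieces are summed up, so the choice of charts and pieces is
immaterial. -/
theorem riemVolume_apply (hF : ∀ x : M, ∃ F : OrthoFrame g, x ∈ F.U) (c : M) {A : Set M}
    (hA : MeasurableSet A) (hc : A ⊆ (chart n c).source) :
    riemVolume g A = ∫⁻ y in (chart n c).target ∩ (chart n c).symm ⁻¹' A,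
      ENNReal.ofReal (density g c ((chart n c).symm y)) := by
  let D : ℕ → Set M := disjointed fun j => (chart n (chartCentre n M j)).source
  have hD : ∀ i, MeasurableSet (D i) := fun i =>
    MeasurableSet.disjointed (fun j => (isOpen_chart_source _).measurableSet) i
  have hDs : ∀ i, D i ⊆ (chart n (chartCentre n M i)).source := fun i => disjointed_subset _ i
  have hDU : ⋃ i, D i = Set.univ := by
    rw [iUnion_disjointed]
    exact (exists_chart_cover n M).choose_spec
  have hDd : Pairwise (Function.onFun Disjoint D) := disjoint_disjointed _
  have hterm : ∀ i, Measure.map (chart n (chartCentre n M i)).symm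
      (((volume : Measure (Vec n)).restrict ((chart n (chartCentre n M i)).target ∩
        (chart n (chartCentre n M i)).symm ⁻¹' D i)).withDensity fun y =>
          ENNReal.ofReal (density g (chartCentre n M i) ((chart n (chartCentre n M i)).symm y))) A =
      ∫⁻ y in (chart n c).target ∩ (chart n c).symm ⁻¹' (A ∩ D i),
        ENNReal.ofReal (density g c ((chart n c).symm y)) := fun i => by
    rw [Measure.map_apply_of_aemeasurable (aemeasurable_chart_symm _ ?_) hA,
      withDensity_apply', Measure.restrict_restrict' (measurableSet_overlap _ (hD i)),
      ← lintegral_density_trans hF c (chartCentre n M i) (hA.inter (hD i))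
        (Set.inter_subset_left.trans hc) (Set.inter_subset_right.trans (hDs i))]
    · congr 2
      ext y
      simp only [Set.mem_inter_iff, Set.mem_preimage]
      tauto
    · exact (withDensity_absolutelyContinuous _ _).trans
        (Measure.absolutelyContinuous_of_le (Measure.restrict_mono_set _ Set.inter_subset_left))
  rw [riemVolume, Measure.sum_apply _ hA]
  refine (tsum_congr hterm).trans ?_
  rw [← lintegral_iUnion (fun i => measurableSet_overlap c (hA.inter (hD i)))]
  · congr 2
    rw [← Set.inter_iUnion, ← Set.preimage_iUnion, ← Set.inter_iUnion, hDU, Set.inter_univ]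
  · intro i j hij
    refine Set.disjoint_left.2 fun y hy hy' => ?_
    exact Set.disjoint_left.1 (hDd hij) hy.2.2 hy'.2.2

theorem riemVolume_restrict (hF : ∀ x : M, ∃ F : OrthoFrame g, x ∈ F.U) (c : M) :
    (riemVolume g).restrict (chart n c).source = Measure.map (chart n c).symm
      (((volume : Measure (Vec n)).restrict (chart n c).target).withDensity fun y =>
        ENNReal.ofReal (density g c ((chart n c).symm y))) := by
  ext A hA
  rw [Measure.restrict_apply hA, riemVolume_apply hF c
    (hA.inter (isOpen_chart_source c).measurableSet) Set.inter_subset_right,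
    Measure.map_apply_of_aemeasurable
      (aemeasurable_chart_symm _ (withDensity_absolutelyContinuous _ _)) hA,
    withDensity_apply', Measure.restrict_restrict' (isOpen_chart_target c).measurableSet]
  congr 2
  ext y
  simp only [Set.mem_inter_iff, Set.mem_preimage]
  exact ⟨fun h => ⟨h.2.1, h.1⟩, fun h => ⟨h.2, h.1, (chart n c).map_target h.2⟩⟩

/-- Integrals over a chart. -/
theorem integral_riemVolume (hF : ∀ x : M, ∃ F : OrthoFrame g, x ∈ F.U) (c : M) {f : M → ℝ}
    (hf : Continuous f) {K : Set M} (hK : IsCompact K) (hKc : K ⊆ (chart n c).source)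
    (h0 : ∀ x ∉ K, f x = 0) :
    Integrable f (riemVolume g) ∧ ∫ x, f x ∂(riemVolume g) =
      ∫ y in (chart n c).target, density g c ((chart n c).symm y) * f ((chart n c).symm y) := by
  have hsupp : Function.support f ⊆ (chart n c).source := fun x hx => by
    by_contra hcon
    exact hx (h0 x fun h => hcon (hKc h))
  have hρm : AEMeasurable (fun y => (density g c ((chart n c).symm y)).toNNReal)
      ((volume : Measure (Vec n)).restrict (chart n c).target) :=
    ((smooth_density hF c).continuousOn.aemeasurable
      (isOpen_chart_target c).measurableSet).real_toNNReal
  have hac : ((volume : Measure (Vec n)).restrict (chart n c).target).withDensity (fun y =>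
      ENNReal.ofReal (density g c ((chart n c).symm y))) ≪ volume.restrict (chart n c).target :=
    withDensity_absolutelyContinuous _ _
  have hnn : ∀ y, 0 ≤ density g c ((chart n c).symm y) := fun y => Real.sqrt_nonneg _
  have hK' : IsCompact (chart n c '' K) :=
    hK.image_of_continuousOn ((continuousOn_extChartAt c).mono hKc)
  have hint : IntegrableOn (fun y => density g c ((chart n c).symm y) * f ((chart n c).symm y))
      (chart n c).target := by
    have h1 : ContinuousOn (fun y => density g c ((chart n c).symm y) * f ((chart n c).symm y))
        (chart n c).target := (smooth_density hF c).continuousOn.mul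
      (hf.comp_continuousOn (continuousOn_extChartAt_symm c))
    have h2 : chart n c '' K ⊆ (chart n c).target := by
      rintro _ ⟨x, hx, rfl⟩
      exact (chart n c).map_source (hKc hx)
    refine ((h1.mono h2).integrableOn_compact hK').of_forall_sdiff_eq_zero
      (isOpen_chart_target c).measurableSet fun y hy => ?_
    rw [h0, mul_zero]
    intro hyK
    exact hy.2 ⟨_, hyK, (chart n c).right_inv hy.1⟩
  constructor
  · rw [← integrableOn_iff_integrable_of_support_subset hsupp, IntegrableOn,
      riemVolume_restrict hF c, integrable_map_measure hf.aestronglyMeasurable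
        (aemeasurable_chart_symm c hac)]
    refine (integrable_withDensity_iff_integrable_smul₀ hρm).2 ?_
    refine hint.congr (Filter.Eventually.of_forall fun y => ?_)
    simp only [NNReal.smul_def, Real.coe_toNNReal _ (hnn y), smul_eq_mul, Function.comp_apply]
  · rw [← setIntegral_eq_integral_of_forall_compl_eq_zero (s := (chart n c).source)
      (fun x hx => h0 x fun h => hx (hKc h)), riemVolume_restrict hF c,
      integral_map (aemeasurable_chart_symm c hac) hf.aestronglyMeasurable]
    refine (integral_withDensity_eq_integral_smul₀ hρm _).trans ?_
    refine integral_congr_ae (Filter.Eventually.of_forall fun y => ?_)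
    simp only [NNReal.smul_def, Real.coe_toNNReal _ (hnn y), smul_eq_mul]

end Volume

end GradedForms

namespace GradedForms

open MeasureTheory Bundle

/-! ## Differential forms in orthonormal frames -/

section LocalForms

variable {n : ℕ} {M : Type*} [TopologicalSpace M] [ChartedSpace (Vec n) M]

/-- Smoothness of a form on a subset. -/
def SmoothFormOn (V : Set M) (η : Form n M) : Prop :=
  ∀ (k : ℕ) (c : M), ContDiffOn ℝ ∞ (formInChart c (η k))
    ((chart n c).target ∩ (chart n c).symm ⁻¹' V)

theorem IsSmoothForm.smoothFormOn {η : Form n M} (hη : IsSmoothForm η) (V : Set M) :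
    SmoothFormOn V η := fun k c => (hη k c).mono Set.inter_subset_left

theorem SmoothFormOn.mono {V V' : Set M} {η : Form n M} (hη : SmoothFormOn V η) (h : V' ⊆ V) :
    SmoothFormOn V' η := fun k c =>
  (hη k c).mono (Set.inter_subset_inter_right _ (Set.preimage_mono h))

theorem SmoothFormOn.contDiffAt {V : Set M} (hV : IsOpen V) {η : Form n M}
    (hη : SmoothFormOn V η) (k : ℕ) {c : M} {y : Vec n} (hy : y ∈ (chart n c).target)
    (hy' : (chart n c).symm y ∈ V) : ContDiffAt ℝ ∞ (formInChart c (η k)) y :=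
  (hη k c).contDiffAt ((isOpen_overlap c hV).mem_nhds ⟨hy, hy'⟩)

theorem isSmoothForm_of_forall {η : Form n M}
    (h : ∀ x, ∃ V, IsOpen V ∧ x ∈ V ∧ SmoothFormOn V η) : IsSmoothForm η := fun k c y hy => by
  obtain ⟨V, hV, hx, hs⟩ := h ((chart n c).symm y)
  exact (hs.contDiffAt hV k hy hx).contDiffWithinAt

theorem formInChart_congr {k : ℕ} {θ θ' : ∀ x : M, TangentSpace 𝓘(ℝ, Vec n) x [⋀^Fin k]→L[ℝ] ℝ}
    {c : M} {y : Vec n} (h : val θ ((chart n c).symm y) = val θ' ((chart n c).symm y)) :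
    formInChart c θ y = formInChart c θ' y := by
  rw [formInChart_eq, formInChart_eq, h]

theorem SmoothFormOn.congr {V : Set M} {η ξ : Form n M} (hη : SmoothFormOn V η)
    (h : ∀ x ∈ V, ∀ k, ξ k x = η k x) : SmoothFormOn V ξ := fun k c =>
  (hη k c).congr fun _ hy => formInChart_congr (h _ hy.2 k)

theorem SmoothFormOn.sub {V : Set M} {η ξ : Form n M} (hη : SmoothFormOn V η)
    (hξ : SmoothFormOn V ξ) : SmoothFormOn V (η - ξ) := fun k c => (hη k c).sub (hξ k c)

theorem IsSmoothForm.add {η ξ : Form n M} (hη : IsSmoothForm η) (hξ : IsSmoothForm ξ) :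
    IsSmoothForm (η + ξ) := fun k c => (hη k c).add (hξ k c)

theorem isSmoothForm_zero : IsSmoothForm (0 : Form n M) := fun k _ =>
  (contDiffOn_const (c := (0 : Cov n k))).congr fun _ _ => rfl

/-- The product of a form and a function. -/
noncomputable def mulForm (χ : M → ℝ) (η : Form n M) : Form n M := fun k x => χ x • η k x

theorem extD_add {α β : Form n M} (hα : IsSmoothForm α) (hβ : IsSmoothForm β) :
    extD (α + β) = extD α + extD β := by
  funext k x
  cases k with
  | zero => exact (add_zero _).symm
  | succ k =>
    have hd : ∀ {α : Form n M}, IsSmoothForm α →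
        DifferentiableAt ℝ (formInChart x (α k)) (chart n x x) := fun {α} hα =>
      ((hα k x).contDiffAt ((isOpen_chart_target x).mem_nhds
        (mem_extChartAt_target x))).differentiableAt (by simp)
    have h := extDeriv_add (hd hα) (hd hβ)
    change (extDeriv (formInChart x (α k) + formInChart x (β k))
      (chart n x x)).compContinuousLinearMap (tD x x) = _
    rw [h]
    rfl

variable [IsManifold 𝓘(ℝ, Vec n) ∞ M]

theorem IsSmoothFun.mulForm {χ : M → ℝ} (hχ : ContMDiff 𝓘(ℝ, Vec n) 𝓘(ℝ, ℝ) ∞ χ) {V K : Set M}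
    (hV : IsOpen V) (hK : IsClosed K) (hKV : K ⊆ V) (h0 : ∀ x ∉ K, χ x = 0) {η : Form n M}
    (hη : SmoothFormOn V η) : IsSmoothForm (mulForm χ η) := fun k c y hy => by
  by_cases hx : (chart n c).symm y ∈ V
  · have h1 : ContDiffAt ℝ ∞ (fun z => χ ((chart n c).symm z)) y :=
      (hχ.comp_contMDiffOn (contMDiffOn_extChartAt_symm c)).contDiffOn.contDiffAt
        ((isOpen_chart_target c).mem_nhds hy)
    exact (h1.smul (hη.contDiffAt hV k hy hx)).contDiffWithinAt
  · have h1 : formInChart c (GradedForms.mulForm χ η k) =ᶠ[nhds y] fun _ => 0 := by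
      filter_upwards [(isOpen_overlap c hK.isOpen_compl).mem_nhds
        ⟨hy, fun h => hx (hKV h)⟩] with z hz
      have : val (GradedForms.mulForm χ η k) ((chart n c).symm z) = 0 := by
        change χ _ • val (η k) _ = 0
        rw [h0 _ hz.2, zero_smul]
      rw [formInChart_eq, this]
      rfl
    exact (contDiffAt_const.congr_of_eventuallyEq h1).contDiffWithinAt

/-- Smoothness in one chart that covers V suffices: in any other chart the form is a pullback under
a smooth transition map. -/
theorem smoothFormOn_of_chart {V : Set M} (hV : IsOpen V) {c : M}
    (hc : V ⊆ (chart n c).source) {η : Form n M} (h : ∀ k, ∀ y ∈ (chart n c).target ∩ (chart n c).symm ⁻¹' V,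
      ContDiffAt ℝ ∞ (formInChart c (η k)) y) : SmoothFormOn V η := fun k c' y hy => by
  have hx := hc hy.2
  have h1 := h k (trans c' c y) ⟨trans_mem_target c' c hx, by
    rw [Set.mem_preimage, symm_trans c' c hx]; exact hy.2⟩
  have hev : formInChart c' (η k) =ᶠ[nhds y] fun z =>
      (formInChart c (η k) (trans c' c z)).compContinuousLinearMap (fderiv ℝ (trans c' c) z) := by
    filter_upwards [(isOpen_overlap c' (isOpen_chart_source (n := n) c)).mem_nhds ⟨hy.1, hx⟩]
      with z hz
    exact formInChart_trans (η k) c' c hz.1 hz.2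
  refine ContDiffAt.contDiffWithinAt (ContDiffAt.congr_of_eventuallyEq ?_ hev)
  have hVc : ∀ z ∈ (chart n c').target ∩ (chart n c').symm ⁻¹' V,
      ContDiffAt ℝ ∞ (trans c' c) z := fun z hz => smoothAt_trans c' c hz.1 (hc hz.2)
  have hO := isOpen_overlap (n := n) c' hV
  refine (LocalFrame.smoothOn_compContinuousLinearMap
    (φ := fun z => formInChart c (η k) (trans c' c z)) (A := fderiv ℝ (trans c' c))
    (W := (chart n c').target ∩ (chart n c').symm ⁻¹' V) ?_ ?_).contDiffAt (hO.mem_nhds hy)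
  · intro z hz
    refine ((h k (trans c' c z) ⟨trans_mem_target c' c (hc hz.2), ?_⟩).comp z
      (hVc z hz)).contDiffWithinAt
    rw [Set.mem_preimage, symm_trans c' c (hc hz.2)]
    exact hz.2
  · exact ContDiffOn.fderiv_of_isOpen (m := ∞) (n := ∞)
      (fun z hz => (hVc z hz).contDiffWithinAt) hO (by simp)

namespace OrthoFrame

variable {g : Metric n M} (F : OrthoFrame g)

/-- The coefficients of a form in the frame. -/
noncomputable def tot (η : Form n M) (x : M) : Tot n := fun k =>
  (val (η k) x).compContinuousLinearMap (F.fr x)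

variable {F}

theorem tot_add (η ξ : Form n M) (x : M) : F.tot (η + ξ) x = F.tot η x + F.tot ξ x := rfl

theorem tot_sub (η ξ : Form n M) (x : M) : F.tot (η - ξ) x = F.tot η x - F.tot ξ x := rfl

theorem tot_mulForm (χ : M → ℝ) (η : Form n M) (x : M) :
    F.tot (mulForm χ η) x = χ x • F.tot η x := rfl

theorem tot_eq_zero {η : Form n M} {x : M} (h : ∀ k, η k x = 0) : F.tot η x = 0 := by
  funext k
  have : val (η k) x = 0 := h k
  rw [tot, this]
  rfl

theorem eq_of_tot_eq {η ξ : Form n M} {x : M} (hx : x ∈ F.U) (h : F.tot η x = F.tot ξ x) (k : ℕ) :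
    η k x = ξ k x := by
  have h1 : ∀ η : Form n M, val (η k) x =
      (F.tot η x k).compContinuousLinearMap ((F.frEquiv hx).symm : Vec n →L[ℝ] Vec n) := by
    intro η
    ext v
    change _ = val (η k) x fun l => F.fr x ((F.frEquiv hx).symm (v l))
    congr 1
    funext l
    exact ((F.frEquiv hx).apply_symm_apply (v l)).symm
  exact (h1 η).trans ((congrArg (fun t : Tot n => (t k).compContinuousLinearMap _) h).trans
    (h1 ξ).symm)

/-- A form in a frame and a chart. -/
noncomputable def rp (c : M) {η : Form n M} (hη : SmoothFormOn F.U η) : (F.inChart c).sec :=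
  (F.inChart c).rep (fun k => formInChart c (η k)) fun k => hη k c

theorem ev_rp {c : M} {η : Form n M} (hη : SmoothFormOn F.U η) {y : Vec n}
    (hy : y ∈ (F.inChart c).W) :
    (F.inChart c).ev y (F.rp c hη) = F.tot η ((chart n c).symm y) := by
  funext k
  exact ((F.inChart c).ev_rep (fun k => hη k c) hy k).trans (formInChart_comp_A _ hy)

theorem ev_d_rp {c : M} {η : Form n M} (hη : IsSmoothForm η) {y : Vec n}
    (hy : y ∈ (F.inChart c).W) :
    (F.inChart c).ev y ((F.inChart c).ops.d (F.rp c (hη.smoothFormOn _))) =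
      F.tot (extD η) ((chart n c).symm y) := by
  funext k
  refine ((F.inChart c).ev_d_rep (fun k => hη.smoothFormOn F.U k c) hy k).trans ?_
  rw [← formInChart_extD hη c k hy.1, formInChart_comp_A _ hy]
  rfl

theorem d_rp {c : M} {η : Form n M} (hη : IsSmoothForm η) :
    (F.inChart c).ops.d (F.rp c (hη.smoothFormOn _)) = F.rp c (hη.extD.smoothFormOn _) :=
  LocalFrame.sec_ext _ fun _ hy => (ev_d_rp hη hy).trans (ev_rp (hη.extD.smoothFormOn _) hy).symm

/-- The form is recovered from its frame coefficients by composing with the coframe, which is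
smooth. -/
theorem smoothFormOn_of_sec {c : M} (hc : F.U ⊆ (chart n c).source) {η : Form n M}
    (G : (F.inChart c).sec)
    (h : ∀ y ∈ (F.inChart c).W, F.tot η ((chart n c).symm y) = (F.inChart c).ev y G) :
    SmoothFormOn F.U η := by
  refine smoothFormOn_of_chart F.isOpen hc fun k y hy => ?_
  have h1 : ContDiffOn ℝ ∞ (fun y => ((G : Vec n → Tot n) y k).compContinuousLinearMap
      ((F.inChart c).B y)) (F.inChart c).W :=
    LocalFrame.smoothOn_compContinuousLinearMap (G.2.1 k) (F.inChart c).smooth_B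
  refine (h1.contDiffAt ((F.inChart c).isOpen.mem_nhds hy)).congr_of_eventuallyEq ?_
  filter_upwards [(F.inChart c).isOpen.mem_nhds hy] with z hz
  have h2 := congrFun (h z hz) k
  have h3 : (formInChart c (η k) z).compContinuousLinearMap ((F.inChart c).A z) =
      (G : Vec n → Tot n) z k := (formInChart_comp_A _ hz).trans h2
  rw [← h3]
  ext v
  change _ = formInChart c (η k) z fun l => (F.inChart c).A z ((F.inChart c).B z (v l))
  simp only [LocalFrame.A_B hz]

variable (F)

open Classical in
/-- The form with given coefficients in a frame and a chart. -/
noncomputable def toForm (c : M) (G : (F.inChart c).sec) : Form n M := fun k x =>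
  if hx : x ∈ F.U then
    (((G : Vec n → Tot n) (chart n c x) k).compContinuousLinearMap
      ((F.frEquiv hx).symm : Vec n →L[ℝ] Vec n) : Cov n k)
  else 0

theorem tot_toForm {c : M} (G : (F.inChart c).sec) {y : Vec n} (hy : y ∈ (F.inChart c).W) :
    F.tot (F.toForm c G) ((chart n c).symm y) = (F.inChart c).ev y G := by
  funext k
  ext v
  have h : val (F.toForm c G k) ((chart n c).symm y) =
      ((G : Vec n → Tot n) y k).compContinuousLinearMap
        ((F.frEquiv hy.2).symm : Vec n →L[ℝ] Vec n) := by
    refine (dif_pos hy.2).trans ?_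
    rw [(chart n c).right_inv hy.1]
  rw [tot, h]
  change (G : Vec n → Tot n) y k (fun l => (F.frEquiv hy.2).symm (F.fr _ (v l))) = _
  congr 1
  funext l
  exact (F.frEquiv hy.2).symm_apply_apply (v l)

theorem smooth_toForm {c : M} (hc : F.U ⊆ (chart n c).source) (G : (F.inChart c).sec) :
    SmoothFormOn F.U (F.toForm c G) :=
  smoothFormOn_of_sec hc G fun _ hy => F.tot_toForm G hy

/-- The restriction of a frame to a smaller open set. -/
def restrict {V : Set M} (hV : IsOpen V) : OrthoFrame g where
  U := F.U ∩ V
  isOpen := F.isOpen.inter hV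
  e := F.e
  smooth a x hx := F.smooth a x hx.1
  ortho x hx := F.ortho x hx.1

end OrthoFrame

end LocalForms

end GradedForms

namespace GradedForms

open MeasureTheory Bundle

/-! ## The codifferential -/

section Codifferential

variable {n : ℕ} {M : Type*} [TopologicalSpace M] [ChartedSpace (Vec n) M]

/-- Compact sets are closed in a Hausdorff space, so the form vanishes near x and its derivative
there is zero. -/
theorem extD_eq_zero_of_notMem [T2Space M] {α : Form n M} {K : Set M} (hK : IsCompact K)
    (h0 : ∀ (k : ℕ), ∀ x ∉ K, α k x = 0) (k : ℕ) {x : M} (hx : x ∉ K) : extD α k x = 0 := by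
  cases k with
  | zero => rfl
  | succ k =>
    have h1 : formInChart x (α k) =ᶠ[nhds (chart n x x)] fun _ => 0 := by
      filter_upwards [(isOpen_overlap (n := n) x hK.isClosed.isOpen_compl).mem_nhds
        ⟨mem_extChartAt_target x, by
          rw [Set.mem_preimage, (chart n x).left_inv (mem_extChartAt_source x)]; exact hx⟩] with z hz
      have : val (α k) ((chart n x).symm z) = 0 := h0 k _ hz.2
      rw [formInChart_eq, this]
      rfl
    change (extDeriv (formInChart x (α k))
      (chart n x x)).compContinuousLinearMap (tD x x) = (0 : Cov n (k + 1))
    rw [h1.extDeriv_eq]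
    have : extDeriv (fun _ : Vec n => (0 : Cov n k)) (chart n x x) = 0 := by
      rw [extDeriv, fderiv_const_apply]
      exact map_zero (ContinuousAlternatingMap.alternatizeUncurryFinCLM ℝ (Vec n) ℝ)
    rw [this]
    rfl

variable [IsManifold 𝓘(ℝ, Vec n) ∞ M] {g : Metric n M}

/-- The pointwise inner product of forms. -/
noncomputable def pair (g : Metric n M) (α β : Form n M) (x : M) : ℝ :=
  ∑ k ∈ Finset.range (n + 1), formInner g x (α k x) (β k x)

theorem OrthoFrame.pair_eq {F : OrthoFrame g} {x : M} (hx : x ∈ F.U) (α β : Form n M) :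
    pair g α β x = totInner (F.tot α x) (F.tot β x) :=
  Finset.sum_congr rfl fun k _ => F.formInner_eq hx (α k x) (β k x)

theorem totInner_zero_left (θ : Tot n) : totInner 0 θ = 0 := by
  rw [← LocalFrame.totInnerₗ_apply, map_zero, LinearMap.zero_apply]

theorem pair_eq_zero (hF : ∀ x : M, ∃ F : OrthoFrame g, x ∈ F.U) {α : Form n M} (β : Form n M)
    {x : M} (h : ∀ k, α k x = 0) : pair g α β x = 0 := by
  obtain ⟨F, hx⟩ := hF x
  rw [F.pair_eq hx, F.tot_eq_zero h, totInner_zero_left]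

theorem pair_congr {α α' β β' : Form n M} {x : M} (h : ∀ k, α k x = α' k x)
    (h' : ∀ k, β k x = β' k x) : pair g α β x = pair g α' β' x := by
  unfold pair
  simp only [h, h']

theorem continuousAt_pair (hF : ∀ x : M, ∃ F : OrthoFrame g, x ∈ F.U) {V : Set M} (hV : IsOpen V)
    {α β : Form n M} (hα : SmoothFormOn V α) (hβ : SmoothFormOn V β) {x : M} (hx : x ∈ V) :
    ContinuousAt (pair g α β) x := by
  obtain ⟨F₀, hx₀⟩ := hF x
  let F := F₀.restrict hV
  have hα' : SmoothFormOn F.U α := hα.mono Set.inter_subset_right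
  have hβ' : SmoothFormOn F.U β := hβ.mono Set.inter_subset_right
  have hxF : x ∈ F.U := ⟨hx₀, hx⟩
  have hs : (chart n x).symm (chart n x x) = x := (chart n x).left_inv (mem_extChartAt_source x)
  have hy : chart n x x ∈ (F.inChart x).W := ⟨mem_extChartAt_target x, by
    rw [Set.mem_preimage, hs]; exact hxF⟩
  have h1 := (((F.inChart x).smooth_totInner (F.rp x hα') (F.rp x hβ')).continuousOn.continuousAt
    ((F.inChart x).isOpen.mem_nhds hy)).comp (continuousAt_extChartAt (I := 𝓘(ℝ, Vec n)) x)
  refine h1.congr ?_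
  filter_upwards [F.isOpen.mem_nhds hxF, extChartAt_source_mem_nhds (I := 𝓘(ℝ, Vec n)) x]
    with z hz hzs
  have hl : (chart n x).symm (chart n x z) = z := (chart n x).left_inv hzs
  have hzW : chart n x z ∈ (F.inChart x).W := ⟨(chart n x).map_source hzs, by
    rw [Set.mem_preimage, hl]; exact hz⟩
  rw [F.pair_eq hz, Function.comp_apply, F.ev_rp hα' hzW, F.ev_rp hβ' hzW, hl]

/-- Outside V the first form vanishes near the point, so smoothness of the second is needed only on
V. -/
theorem continuous_pair [T2Space M] (hF : ∀ x : M, ∃ F : OrthoFrame g, x ∈ F.U) {V K : Set M}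
    (hV : IsOpen V) (hK : IsCompact K) (hKV : K ⊆ V) {α β : Form n M} (hα : IsSmoothForm α)
    (h0 : ∀ (k : ℕ), ∀ x ∉ K, α k x = 0) (hβ : SmoothFormOn V β) : Continuous (pair g α β) := by
  refine continuous_iff_continuousAt.2 fun x => ?_
  by_cases hx : x ∈ V
  · exact continuousAt_pair hF hV (hα.smoothFormOn V) hβ hx
  · refine (continuousAt_const (y := (0 : ℝ))).congr ?_
    filter_upwards [hK.isClosed.isOpen_compl.mem_nhds fun h => hx (hKV h)] with z hz
    exact (pair_eq_zero hF β fun k => h0 k z hz).symm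

theorem OrthoFrame.isCompact_image {F : OrthoFrame g} {c : M} (hc : F.U ⊆ (chart n c).source)
    {α : Form n M} (hα : IsSmoothForm α) {K : Set M} (hK : IsCompact K) (hKU : K ⊆ F.U)
    (h0 : ∀ (k : ℕ), ∀ x ∉ K, α k x = 0) :
    IsCompact (chart n c '' K) ∧ chart n c '' K ⊆ (F.inChart c).W ∧
      ∀ y ∉ chart n c '' K, (F.inChart c).ev y (F.rp c (hα.smoothFormOn F.U)) = 0 := by
  refine ⟨hK.image_of_continuousOn ((continuousOn_extChartAt c).mono (hKU.trans hc)), ?_, ?_⟩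
  · rintro _ ⟨x, hx, rfl⟩
    refine ⟨(chart n c).map_source (hc (hKU hx)), ?_⟩
    rw [Set.mem_preimage, (chart n c).left_inv (hc (hKU hx))]
    exact hKU hx
  · intro y hy
    by_cases hyW : y ∈ (F.inChart c).W
    · rw [F.ev_rp _ hyW]
      refine F.tot_eq_zero fun k => h0 k _ fun h => hy ⟨_, h, (chart n c).right_inv hyW.1⟩
    · exact (F.rp c (hα.smoothFormOn F.U)).2.2 y hyW

/-! ### Local formal duals: uniqueness and gluing -/

variable [SecondCountableTopology M] [Nonempty M] [MeasurableSpace M]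

/-- The formal dual of the exterior derivative on an open set. -/
def IsDualOn (g : Metric n M) (V : Set M) (η ξ : Form n M) : Prop :=
  SmoothFormOn V ξ ∧ ∀ (α : Form n M) (K : Set M), IsSmoothForm α → IsCompact K → K ⊆ V →
    (∀ (k : ℕ), ∀ x ∉ K, α k x = 0) → l2Inner g (extD α) η = l2Inner g α ξ

theorem IsDualOn.mono {V V' : Set M} {η ξ : Form n M} (h : IsDualOn g V η ξ) (hV : V' ⊆ V) :
    IsDualOn g V' η ξ :=
  ⟨h.1.mono hV, fun α K hα hK hKV h0 => h.2 α K hα hK (hKV.trans hV) h0⟩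

theorem isDualOn_univ_iff {η ξ : Form n M} :
    IsDualOn g Set.univ η ξ ↔ IsFormalDualAt g extD η ξ := by
  constructor
  · rintro ⟨h1, h2⟩
    refine ⟨isSmoothForm_of_forall fun x => ⟨_, isOpen_univ, Set.mem_univ x, h1⟩, ?_⟩
    rintro α hα ⟨K, hK, h0⟩
    exact h2 α K hα hK (Set.subset_univ K) h0
  · rintro ⟨h1, h2⟩
    exact ⟨h1.smoothFormOn _, fun α K hα hK _ h0 => h2 α hα ⟨K, hK, h0⟩⟩

variable [T2Space M] [BorelSpace M]

/-- Compact support in the frame domain reduces the integral to one chart, where the density and the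
inner product of forms take their orthonormal expressions. -/
theorem OrthoFrame.integral_pair (hF : ∀ x : M, ∃ F : OrthoFrame g, x ∈ F.U) (F : OrthoFrame g)
    {c : M} (hc : F.U ⊆ (chart n c).source) {α β : Form n M} (hα : IsSmoothForm α)
    (hβ : SmoothFormOn F.U β) {K : Set M} (hK : IsCompact K) (hKU : K ⊆ F.U)
    (h0 : ∀ (k : ℕ), ∀ x ∉ K, α k x = 0) :
    Integrable (pair g α β) (riemVolume g) ∧ ∫ x, pair g α β x ∂(riemVolume g) =
      ∫ y, (F.inChart c).dens y * totInner ((F.inChart c).ev y (F.rp c (hα.smoothFormOn F.U)))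
        ((F.inChart c).ev y (F.rp c hβ)) := by
  have h0' : ∀ x ∉ K, pair g α β x = 0 := fun x hx => pair_eq_zero hF β fun k => h0 k x hx
  obtain ⟨h1, h2⟩ := integral_riemVolume hF c (continuous_pair hF F.isOpen hK hKU hα h0 hβ) hK
    (hKU.trans hc) h0'
  refine ⟨h1, h2.trans ?_⟩
  rw [← integral_indicator (isOpen_chart_target c).measurableSet]
  congr 1
  funext y
  by_cases hyW : y ∈ (F.inChart c).W
  · rw [Set.indicator_of_mem hyW.1, F.density_eq hyW, F.pair_eq hyW.2, F.ev_rp _ hyW,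
      F.ev_rp _ hyW]
  · have : (F.inChart c).ev y (F.rp c (hα.smoothFormOn F.U)) = 0 :=
      (F.rp c (hα.smoothFormOn F.U)).2.2 y hyW
    rw [this, totInner_zero_left, mul_zero]
    by_cases hy : y ∈ (chart n c).target
    · rw [Set.indicator_of_mem hy, h0' _ fun h => hyW ⟨hy, hKU h⟩, mul_zero]
    · rw [Set.indicator_of_notMem hy]

/-- The explicit frame formula for the codifferential is a formal dual on the frame domain, by
integration by parts in the chart. -/
theorem OrthoFrame.isDualOn (hF : ∀ x : M, ∃ F : OrthoFrame g, x ∈ F.U) (F : OrthoFrame g)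
    {c : M} (hc : F.U ⊆ (chart n c).source) {η : Form n M} (hη : IsSmoothForm η) :
    IsDualOn g F.U η (F.toForm c ((F.inChart c).ops.δ (F.rp c (hη.smoothFormOn F.U)))) := by
  have hsm := F.smooth_toForm hc ((F.inChart c).ops.δ (F.rp c (hη.smoothFormOn F.U)))
  refine ⟨hsm, fun α K hα hK hKU h0 => ?_⟩
  have h1 := (F.integral_pair hF hc hα.extD (hη.smoothFormOn F.U) hK hKU
    fun k x hx => extD_eq_zero_of_notMem hK h0 k hx).2
  have h2 := (F.integral_pair hF hc hα hsm hK hKU h0).2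
  have h3 : F.rp c hsm = (F.inChart c).ops.δ (F.rp c (hη.smoothFormOn F.U)) :=
    LocalFrame.sec_ext _ fun y hy => (F.ev_rp hsm hy).trans (F.tot_toForm _ hy)
  obtain ⟨h4, h5, h6⟩ := F.isCompact_image hc hα hK hKU h0
  rw [← F.d_rp hα, (F.inChart c).integral_dens_mul_totInner_d _ _ h4 h5 h6, ← h3] at h1
  exact h1.trans h2.symm

/-- Testing with α = f(ξ - ξ'), f a bump function at x, gives ∫ f |ξ - ξ'|² = 0. The integrand is
continuous and nonnegative, so it vanishes at x, where f = 1. -/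
theorem IsDualOn.eq (hF : ∀ x : M, ∃ F : OrthoFrame g, x ∈ F.U) {V : Set M} (hV : IsOpen V)
    {η ξ ξ' : Form n M} (h : IsDualOn g V η ξ) (h' : IsDualOn g V η ξ') {x : M} (hx : x ∈ V)
    (k : ℕ) : ξ k x = ξ' k x := by
  obtain ⟨F₀, hx₀⟩ := hF x
  let F := F₀.restrict (hV.inter (isOpen_chart_source (n := n) x))
  have hxF : x ∈ F.U := ⟨hx₀, hx, mem_extChartAt_source x⟩
  have hc : F.U ⊆ (chart n x).source := fun z hz => hz.2.2
  have hUV : F.U ⊆ V := fun z hz => hz.2.1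
  obtain ⟨f, -, hf⟩ := (SmoothBumpFunction.nhds_basis_tsupport (I := 𝓘(ℝ, Vec n)) x).mem_iff.1
    (F.isOpen.mem_nhds hxF)
  have hK : IsCompact (tsupport f) := f.hasCompactSupport
  have hfK : ∀ z ∉ tsupport f, f z = 0 := fun z hz => image_eq_zero_of_notMem_tsupport hz
  have hζ : SmoothFormOn F.U (ξ - ξ') := (h.1.sub h'.1).mono hUV
  have hα : IsSmoothForm (mulForm f (ξ - ξ')) :=
    IsSmoothFun.mulForm f.contMDiff F.isOpen hK.isClosed hf hfK hζ
  have h0 : ∀ (k : ℕ), ∀ z ∉ tsupport f, mulForm f (ξ - ξ') k z = 0 := fun k z hz => by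
    rw [mulForm, hfK z hz, zero_smul]
  have hξ := F.integral_pair hF hc hα (h.1.mono hUV) hK hf h0
  have hξ' := F.integral_pair hF hc hα (h'.1.mono hUV) hK hf h0
  have hsub : pair g (mulForm f (ξ - ξ')) (ξ - ξ') =
      fun z => pair g (mulForm f (ξ - ξ')) ξ z - pair g (mulForm f (ξ - ξ')) ξ' z := by
    funext z
    obtain ⟨E, hz⟩ := hF z
    rw [E.pair_eq hz, E.pair_eq hz, E.pair_eq hz, E.tot_sub]
    simp only [← LocalFrame.totInnerₗ_apply, map_sub]
  have hzero : ∫ z, pair g (mulForm f (ξ - ξ')) (ξ - ξ') z ∂(riemVolume g) = 0 := by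
    rw [hsub, integral_sub hξ.1 hξ'.1, sub_eq_zero]
    exact (h.2 _ _ hα hK (hf.trans hUV) h0).symm.trans (h'.2 _ _ hα hK (hf.trans hUV) h0)
  rw [(F.integral_pair hF hc hα hζ hK hf h0).2] at hzero
  set u : Vec n → ℝ := fun y => (F.inChart x).dens y *
    totInner ((F.inChart x).ev y (F.rp x (hα.smoothFormOn F.U)))
      ((F.inChart x).ev y (F.rp x hζ)) with hu
  obtain ⟨h4, h5, h6⟩ := F.isCompact_image hc hα hK hf h0
  obtain ⟨hu1, hu2⟩ := contDiff_of_contDiffOn_of_compact (F.inChart x).isOpen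
    ((F.inChart x).smooth_dens.mul ((F.inChart x).smooth_totInner
      (F.rp x (hα.smoothFormOn F.U)) (F.rp x hζ))) h4 h5 fun y hy => by
        rw [h6 y hy, totInner_zero_left, mul_zero]
  have huW : ∀ y ∈ (F.inChart x).W, u y = (F.inChart x).dens y * (f ((chart n x).symm y) *
      totInner (F.tot (ξ - ξ') ((chart n x).symm y)) (F.tot (ξ - ξ') ((chart n x).symm y))) :=
    fun y hy => by
      rw [hu]
      simp only
      rw [F.ev_rp _ hy, F.ev_rp _ hy, F.tot_mulForm, totInner_smul_left]
  have hnn : 0 ≤ u := fun y => by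
    by_cases hy : y ∈ (F.inChart x).W
    · rw [huW y hy]
      exact mul_nonneg (F.inChart x |>.dens_pos hy).le
        (mul_nonneg f.nonneg (totInner_self_nonneg _))
    · have : y ∉ chart n x '' tsupport f := fun h => hy (h5 h)
      simp only [hu, h6 y this, totInner_zero_left, mul_zero]
      exact le_rfl
  have hs : (chart n x).symm (chart n x x) = x := (chart n x).left_inv (mem_extChartAt_source x)
  have hy : chart n x x ∈ (F.inChart x).W := ⟨mem_extChartAt_target x, by
    rw [Set.mem_preimage, hs]; exact hxF⟩
  have hux : u (chart n x x) = 0 := by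
    by_contra hne
    exact (hu1.continuous.integral_pos_of_hasCompactSupport_nonneg_nonzero (μ := volume) hu2 hnn
      hne).ne' hzero
  rw [huW _ hy, hs, f.eq_one, one_mul] at hux
  have htot := totInner_self_eq_zero
    ((mul_eq_zero.1 hux).resolve_left (F.inChart x |>.dens_pos hy).ne')
  rw [F.tot_sub, sub_eq_zero] at htot
  exact F.eq_of_tot_eq hxF htot k

/-- Uniqueness on overlaps makes the local duals agree, so they patch to one smooth form. Duality
against a general α follows by cutting α with a partition of unity subordinate to the frame domains.
-/
theorem exists_isDualOn_univ (hF : ∀ x : M, ∃ F : OrthoFrame g, x ∈ F.U) {η : Form n M}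
    (hη : IsSmoothForm η) : ∃ ξ, IsDualOn g Set.univ η ξ := by
  have hF' : ∀ x : M, ∃ F : OrthoFrame g, x ∈ F.U ∧ F.U ⊆ (chart n x).source := fun x => by
    obtain ⟨F, hx⟩ := hF x
    exact ⟨F.restrict (isOpen_chart_source (n := n) x), ⟨hx, mem_extChartAt_source x⟩,
      Set.inter_subset_right⟩
  choose F hxF hc using hF'
  let ζ : M → Form n M := fun x =>
    (F x).toForm x (((F x).inChart x).ops.δ ((F x).rp x (hη.smoothFormOn (F x).U)))
  have hζ : ∀ x, IsDualOn g (F x).U η (ζ x) := fun x => (F x).isDualOn hF (hc x) hη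
  let ξ : Form n M := fun k x => ζ x k x
  have hξ : ∀ x, ∀ z ∈ (F x).U, ∀ k, ξ k z = ζ x k z := fun x z hz k =>
    ((hζ z).mono Set.inter_subset_left).eq hF ((F z).isOpen.inter (F x).isOpen)
      ((hζ x).mono Set.inter_subset_right) ⟨hxF z, hz⟩ k
  have hsm : IsSmoothForm ξ := isSmoothForm_of_forall fun x =>
    ⟨(F x).U, (F x).isOpen, hxF x, (hζ x).1.congr (hξ x)⟩
  refine ⟨ξ, hsm.smoothFormOn _, fun α K hα hK _ h0 => ?_⟩
  have : LocallyCompactSpace M := ChartedSpace.locallyCompactSpace (Vec n) M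
  obtain ⟨ρ, hρ⟩ := SmoothPartitionOfUnity.exists_isSubordinate 𝓘(ℝ, Vec n) isClosed_univ
    (fun x => (F x).U) (fun x => (F x).isOpen) fun x _ => Set.mem_iUnion.2 ⟨x, hxF x⟩
  -- Local finiteness and compactness of K leave finitely many nonzero pieces of α, so only finite
  -- additivity of the integral is needed.
  have hfin := (ρ.locallyFinite.finite_nonempty_inter_compact hK)
  have hpiece : ∀ i, IsSmoothForm (mulForm (ρ i) α) ∧
      Integrable (pair g (extD (mulForm (ρ i) α)) η) (riemVolume g) ∧
      Integrable (pair g (mulForm (ρ i) α) ξ) (riemVolume g) ∧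
      l2Inner g (extD (mulForm (ρ i) α)) η = l2Inner g (mulForm (ρ i) α) ξ := fun i => by
    have hs : IsSmoothForm (mulForm (ρ i) α) :=
      IsSmoothFun.mulForm (ρ i).contMDiff isOpen_univ isClosed_univ (Set.subset_univ _)
        (fun x hx => absurd (Set.mem_univ x) hx) (hα.smoothFormOn _)
    have hKi : IsCompact (K ∩ tsupport (ρ i)) := hK.inter_right (isClosed_tsupport _)
    have hKU : K ∩ tsupport (ρ i) ⊆ (F i).U := fun x hx => hρ i hx.2
    have h0i : ∀ (k : ℕ), ∀ x ∉ K ∩ tsupport (ρ i), mulForm (ρ i) α k x = 0 := fun k x hx => by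
      by_cases hxK : x ∈ K
      · rw [mulForm, image_eq_zero_of_notMem_tsupport fun h => hx ⟨hxK, h⟩, zero_smul]
      · rw [mulForm, h0 k x hxK, smul_zero]
    refine ⟨hs, ((F i).integral_pair hF (hc i) hs.extD (hη.smoothFormOn _) hKi hKU
      fun k x hx => extD_eq_zero_of_notMem hKi h0i k hx).1,
      ((F i).integral_pair hF (hc i) hs (hsm.smoothFormOn _) hKi hKU h0i).1,
      ((hζ i).2 _ _ hs hKi hKU h0i).trans (integral_congr_ae (.of_forall fun x => ?_))⟩
    change pair g _ (ζ i) x = pair g _ ξ x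
    by_cases hx : x ∈ (F i).U
    · exact pair_congr (fun _ => rfl) fun k => (hξ i x hx k).symm
    · rw [pair_eq_zero hF _ fun k => h0i k x fun h => hx (hKU h),
        pair_eq_zero hF _ fun k => h0i k x fun h => hx (hKU h)]
  have hsum : ∀ s : Finset M, IsSmoothForm (∑ i ∈ s, mulForm (ρ i) α) ∧
      Integrable (pair g (extD (∑ i ∈ s, mulForm (ρ i) α)) η) (riemVolume g) ∧
      Integrable (pair g (∑ i ∈ s, mulForm (ρ i) α) ξ) (riemVolume g) ∧
      l2Inner g (extD (∑ i ∈ s, mulForm (ρ i) α)) η = l2Inner g (∑ i ∈ s, mulForm (ρ i) α) ξ := by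
    classical
    have hadd : ∀ β γ θ : Form n M, pair g (β + γ) θ = fun x => pair g β θ x + pair g γ θ x := by
      intro β γ θ
      funext x
      obtain ⟨E, hx⟩ := hF x
      rw [E.pair_eq hx, E.pair_eq hx, E.pair_eq hx, E.tot_add, totInner_add_left]
    intro s
    induction s using Finset.induction_on with
    | empty =>
      have hz : ∀ θ, pair g (0 : Form n M) θ = fun _ => 0 := fun θ =>
        funext fun x => pair_eq_zero hF θ fun _ => rfl
      have hdz : extD (0 : Form n M) = 0 := funext fun k => funext fun x =>
        extD_eq_zero_of_notMem isCompact_empty (fun _ _ _ => rfl) k (Set.notMem_empty x)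
      rw [Finset.sum_empty, hdz]
      refine ⟨isSmoothForm_zero, ?_, ?_, ?_⟩
      · rw [hz]; exact integrable_zero _ _ _
      · rw [hz]; exact integrable_zero _ _ _
      · exact (congrArg (fun u => ∫ x, u x ∂(riemVolume g)) (hz η)).trans
          (congrArg (fun u => ∫ x, u x ∂(riemVolume g)) (hz ξ)).symm
    | insert i s hi ih =>
      obtain ⟨a1, a2, a3, a4⟩ := hpiece i
      obtain ⟨b1, b2, b3, b4⟩ := ih
      rw [Finset.sum_insert hi, extD_add a1 b1]
      refine ⟨a1.add b1, ?_, ?_, ?_⟩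
      · rw [hadd]; exact a2.add b2
      · rw [hadd]; exact a3.add b3
      · change ∫ x, pair g _ η x ∂_ = ∫ x, pair g _ ξ x ∂_
        rw [hadd, hadd, integral_add a2 b2, integral_add a3 b3]
        exact congrArg₂ (· + ·) a4 b4
  have hα' : α = ∑ i ∈ hfin.toFinset, mulForm (ρ i) α := by
    funext k x
    rw [Finset.sum_apply, Finset.sum_apply]
    change α k x = ∑ i ∈ hfin.toFinset, ρ i x • α k x
    rw [← Finset.sum_smul]
    by_cases hx : x ∈ K
    · have h1 := ρ.sum_eq_one (Set.mem_univ x)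
      rw [finsum_eq_sum_of_support_subset _ (s := hfin.toFinset) fun i hi => by
        rw [Set.Finite.coe_toFinset]
        exact ⟨x, hi, hx⟩] at h1
      rw [h1, one_smul]
    · rw [h0 k x hx, smul_zero]
  rw [hα']
  exact (hsum _).2.2.2

theorem isFormalDualAt_codiff (hF : ∀ x : M, ∃ F : OrthoFrame g, x ∈ F.U) {η : Form n M}
    (hη : IsSmoothForm η) : IsFormalDualAt g extD η (codiff g η) := by
  have h : ∃ ξ, IsFormalDualAt g extD η ξ := by
    obtain ⟨ξ, hξ⟩ := exists_isDualOn_univ hF hη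
    exact ⟨ξ, isDualOn_univ_iff.1 hξ⟩
  rw [codiff, formalDual, dif_pos h]
  exact h.choose_spec

/-- The codifferential is defined by choice; uniqueness of duals on the frame domain identifies it
with the explicit formula. -/
theorem OrthoFrame.δ_rp (hF : ∀ x : M, ∃ F : OrthoFrame g, x ∈ F.U) {F : OrthoFrame g}
    {c : M} (hc : F.U ⊆ (chart n c).source) {η : Form n M} (hη : IsSmoothForm η) :
    (F.inChart c).ops.δ (F.rp c (hη.smoothFormOn F.U)) =
      F.rp c ((isFormalDualAt_codiff hF hη).1.smoothFormOn F.U) := by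
  refine LocalFrame.sec_ext _ fun y hy => ?_
  refine Eq.trans ?_ (F.ev_rp ((isFormalDualAt_codiff hF hη).1.smoothFormOn F.U) hy).symm
  refine (F.tot_toForm (c := c) ((F.inChart c).ops.δ (F.rp c (hη.smoothFormOn F.U))) hy).symm.trans
    (funext fun k => ?_)
  have h := (F.isDualOn hF hc hη).eq hF F.isOpen
    ((isDualOn_univ_iff.2 (isFormalDualAt_codiff hF hη)).mono (Set.subset_univ _)) hy.2 k
  exact congrArg (fun θ : Cov n k => θ.compContinuousLinearMap (F.fr ((chart n c).symm y))) h

end Codifferential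

end GradedForms

namespace GradedForms

open MeasureTheory Bundle

/-! ## The bigraded components of operators -/

section Components

variable {n : ℕ} {M : Type*} [TopologicalSpace M] [ChartedSpace (Vec n) M]

theorem IsSmoothForm.sum {ι : Type*} (s : Finset ι) {η : ι → Form n M}
    (h : ∀ i ∈ s, IsSmoothForm (η i)) : IsSmoothForm (∑ i ∈ s, η i) := by
  classical
  induction s using Finset.induction_on with
  | empty => exact isSmoothForm_zero
  | insert i s hi ih =>
    rw [Finset.sum_insert hi]
    exact (h i (Finset.mem_insert_self i s)).add
      (ih fun j hj => h j (Finset.mem_insert_of_mem hj))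

variable [IsManifold 𝓘(ℝ, Vec n) ∞ M] {g : Metric n M} {S : Splitting g}

theorem Splitting.prH_of_mem_H {x : M} {v : TangentSpace 𝓘(ℝ, Vec n) x} (hv : v ∈ S.H x) :
    S.prH x v = v := Submodule.projection_apply_left (S.isCompl x) ⟨v, hv⟩

theorem Splitting.prH_of_mem_V {x : M} {v : TangentSpace 𝓘(ℝ, Vec n) x} (hv : v ∈ S.V x) :
    S.prH x v = 0 := (Submodule.projection_apply_eq_zero_iff (S.isCompl x)).2 hv

theorem Splitting.prV_of_mem_V {x : M} {v : TangentSpace 𝓘(ℝ, Vec n) x} (hv : v ∈ S.V x) :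
    S.prV x v = v := Submodule.projection_apply_left (S.isCompl x).symm ⟨v, hv⟩

theorem Splitting.prV_of_mem_H {x : M} {v : TangentSpace 𝓘(ℝ, Vec n) x} (hv : v ∈ S.H x) :
    S.prV x v = 0 := (Submodule.projection_apply_eq_zero_iff (S.isCompl x).symm).2 hv

namespace AdaptedFrame

/-- The restriction of an adapted frame to a smaller open set. -/
def restrict (F : AdaptedFrame S) {V : Set M} (hV : IsOpen V) : AdaptedFrame S where
  toOrthoFrame := F.toOrthoFrame.restrict hV
  hs := F.hs
  mem_H x hx := F.mem_H x hx.1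
  mem_V x hx := F.mem_V x hx.1

variable (S) in
theorem exists_subset_source (x : M) :
    ∃ F : AdaptedFrame S, x ∈ F.U ∧ F.U ⊆ (chart n x).source := by
  obtain ⟨F, hx⟩ := S.exists_adaptedFrame x
  exact ⟨F.restrict (isOpen_chart_source (n := n) x), ⟨hx, mem_extChartAt_source x⟩,
    Set.inter_subset_right⟩

variable {F : AdaptedFrame S} {x : M}

theorem clm_ext_bvec {T T' : Vec n →L[ℝ] Vec n} (h : ∀ a, T (bvec a) = T' (bvec a)) : T = T' := by
  ext1 v
  exact (map_eq_sum_bvec T.toLinearMap v).trans ((Finset.sum_congr rfl fun a _ =>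
    congrArg (v a • ·) (h a)).trans (map_eq_sum_bvec T'.toLinearMap v).symm)

theorem prH_fr (hx : x ∈ F.U) (v : Vec n) :
    S.prH x (F.fr x v) = F.fr x (coordProj F.hs v) := by
  have h : (S.prH x : Vec n →L[ℝ] Vec n) ∘L F.fr x = F.fr x ∘L coordProj F.hs := by
    refine clm_ext_bvec fun a => ?_
    change S.prH x (F.fr x (bvec a)) = F.fr x (coordProj F.hs (bvec a))
    rw [coordProj_bvec, F.fr_bvec]
    split_ifs with ha
    · rw [F.fr_bvec]
      exact Splitting.prH_of_mem_H (F.mem_H x hx a ha)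
    · rw [map_zero]
      exact Splitting.prH_of_mem_V (F.mem_V x hx a ha)
  exact congrArg (fun T => T v) h

theorem prV_fr (hx : x ∈ F.U) (v : Vec n) :
    S.prV x (F.fr x v) = F.fr x (coordProj F.hsᶜ v) := by
  have h : (S.prV x : Vec n →L[ℝ] Vec n) ∘L F.fr x = F.fr x ∘L coordProj F.hsᶜ := by
    refine clm_ext_bvec fun a => ?_
    change S.prV x (F.fr x (bvec a)) = F.fr x (coordProj F.hsᶜ (bvec a))
    rw [coordProj_bvec, F.fr_bvec]
    split_ifs with ha
    · rw [F.fr_bvec]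
      exact Splitting.prV_of_mem_V (F.mem_V x hx a (Finset.mem_compl.1 ha))
    · rw [map_zero]
      exact Splitting.prV_of_mem_H (F.mem_H x hx a (by simpa using ha))
  exact congrArg (fun T => T v) h

/-- In an adapted frame the projections to H and V become coordinate projections, so geometric
bidegrees are slot counts. -/
theorem tot_part (hx : x ∈ F.U) (p q : ℤ) (η : Form n M) :
    F.tot (S.part p q η) x = partOp F.hs p q (F.tot η x) := by
  funext k
  ext v
  rw [partOp_apply, bigradedPart_apply]
  refine (bigradedMultilinear_apply (S.prH x) (S.prV x) p q (η k x) fun l => F.fr x (v l)).trans ?_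
  refine Finset.sum_congr rfl fun s _ => ?_
  change val (η k) x _ = val (η k) x _
  congr 1
  funext l
  dsimp only
  split_ifs
  · exact prH_fr hx (v l)
  · exact prV_fr hx (v l)

theorem smooth_part (p q : ℤ) {η : Form n M} (hη : IsSmoothForm η) :
    IsSmoothForm (S.part p q η) := isSmoothForm_of_forall fun x => by
  obtain ⟨F, hx, hc⟩ := exists_subset_source S x
  refine ⟨F.U, F.isOpen, hx, F.smoothFormOn_of_sec hc
    ((F.inChart x).partEnd F.hs p q (F.rp x (hη.smoothFormOn F.U))) fun y hy => ?_⟩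
  rw [LocalFrame.ev_partEnd, F.ev_rp _ hy, tot_part hy.2]

theorem partEnd_rp {c : M} (p q : ℤ) {η : Form n M} (hη : IsSmoothForm η) :
    (F.inChart c).partEnd F.hs p q (F.rp c (hη.smoothFormOn F.U)) =
      F.rp c ((smooth_part (S := S) p q hη).smoothFormOn F.U) :=
  LocalFrame.sec_ext _ fun y hy => by
    refine Eq.trans ?_ (F.ev_rp ((smooth_part (S := S) p q hη).smoothFormOn F.U) hy).symm
    rw [tot_part hy.2, ← F.ev_rp (hη.smoothFormOn F.U) hy]
    rfl

theorem smooth_component {T : Form n M → Form n M}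
    (hT : ∀ {η}, IsSmoothForm η → IsSmoothForm (T η)) (a b : ℤ) {η : Form n M} (hη : IsSmoothForm η) :
    IsSmoothForm (S.component T a b η) :=
  .sum _ fun _ _ => .sum _ fun _ _ => smooth_part _ _ (hT (smooth_part _ _ hη))

/-- Transfers the extraction of a component from the algebra of frame operators to operators on
global forms: once `T` acts in the frame as x + y + z with separated weights, its component acts as
x. -/
theorem rp_component {T : Form n M → Form n M}
    (hT : ∀ {η}, IsSmoothForm η → IsSmoothForm (T η)) {c : M} {Θ x y z : Module.End ℝ (F.inChart c).sec} {a b : ℤ} {w w' : ℝ}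
    (hΘ : ∀ {η} (hη : IsSmoothForm η),
      Θ (F.rp c (hη.smoothFormOn F.U)) = F.rp c ((hT hη).smoothFormOn F.U))
    (h : Θ = x + y + z) (hx : (F.inChart c).ops.HasWeight F.hs a x)
    (hx' : (F.inChart c).ops.HasWeight F.hsᶜ b x) (hy : (F.inChart c).ops.HasWeight F.hs w y)
    (hz : (F.inChart c).ops.HasWeight F.hs w' z) (hw : w ≠ a) (hw' : w' ≠ a)
    {η : Form n M} (hη : IsSmoothForm η) :
    F.rp c ((smooth_component (S := S) hT a b hη).smoothFormOn F.U) =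
      x (F.rp c (hη.smoothFormOn F.U)) := by
  refine LocalFrame.sec_ext _ fun u hu => ?_
  refine (F.ev_rp ((smooth_component (S := S) hT a b hη).smoothFormOn F.U) hu).trans ?_
  have h1 := congrArg (fun X : Module.End ℝ (F.inChart c).sec =>
    (F.inChart c).ev u (X (F.rp c (hη.smoothFormOn F.U))))
    (LocalFrame.sum_partEnd_mul hx hx' hy hz hw hw')
  refine Eq.trans ?_ h1
  have h2 : ∀ {ι : Type} (s : Finset ι) (ζ : ι → Form n M) (v : M),
      F.tot (∑ i ∈ s, ζ i) v = ∑ i ∈ s, F.tot (ζ i) v := fun s ζ v => by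
    classical
    induction s using Finset.induction_on with
    | empty => exact F.tot_eq_zero fun _ => rfl
    | insert i s hi ih => rw [Finset.sum_insert hi, Finset.sum_insert hi, F.tot_add, ih]
  simp only [Splitting.component, h2, LinearMap.sum_apply, map_sum, Module.End.mul_apply, ← h]
  refine Finset.sum_congr rfl fun p _ => Finset.sum_congr rfl fun q _ => ?_
  rw [partEnd_rp _ _ hη, hΘ (smooth_part _ _ hη), LocalFrame.ev_partEnd, F.ev_rp _ hu, tot_part hu.2]

end AdaptedFrame

end Components

end GradedForms

namespace GradedForms

open MeasureTheory Bundle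

/-! ## Totally geodesic Riemannian foliations in adapted frames -/

section Foliations

variable {n : ℕ} {M : Type*} [TopologicalSpace M] [ChartedSpace (Vec n) M]

theorem dirDeriv_zero_field (f : M → ℝ) (x : M) : dirDeriv (0 : VField n M) f x = 0 :=
  map_zero (mfderiv 𝓘(ℝ, Vec n) 𝓘(ℝ, ℝ) f x)

theorem dirDeriv_of_eventuallyEq_const (X : VField n M) {f : M → ℝ} {x : M} {r : ℝ}
    (h : f =ᶠ[nhds x] fun _ => r) : dirDeriv X f x = 0 := by
  rw [dirDeriv_congr X h, dirDeriv, mfderiv_const]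
  rfl

variable [IsManifold 𝓘(ℝ, Vec n) ∞ M] {g : Metric n M}

theorem raise_zero (g : Metric n M) (x : M) : raise g x (fun _ => 0) = 0 := by
  simp [raise]

theorem leviCivita_zero_left (g : Metric n M) (Y : VField n M) (x : M) :
    leviCivita g 0 Y x = 0 := by
  have h : ∀ Z, koszul g 0 Y Z x = 0 := fun Z => by
    have h1 : (fun y => g.inner y ((0 : VField n M) y) (Z y)) = fun _ => 0 := funext fun y => by
      rw [Pi.zero_apply, map_zero]; rfl
    have h2 : (fun y => g.inner y ((0 : VField n M) y) (Y y)) = fun _ => 0 := funext fun y => by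
      rw [Pi.zero_apply, map_zero]; rfl
    rw [koszul, dirDeriv_zero_field, h1, h2, dirDeriv_of_eventuallyEq_const Y .rfl,
      dirDeriv_of_eventuallyEq_const Z .rfl, VectorField.mlieBracket_zero_left,
      VectorField.mlieBracket_zero_left]
    simp
  simp only [leviCivita, h, raise_zero]

theorem leviCivita_zero_right (g : Metric n M) (X : VField n M) (x : M) :
    leviCivita g X 0 x = 0 := by
  have h : ∀ Z, koszul g X 0 Z x = 0 := fun Z => by
    have h1 : (fun y => g.inner y ((0 : VField n M) y) (Z y)) = fun _ => 0 := funext fun y => by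
      rw [Pi.zero_apply, map_zero]; rfl
    have h2 : (fun y => g.inner y (X y) ((0 : VField n M) y)) = fun _ => 0 := funext fun y => by
      rw [Pi.zero_apply, map_zero]
    rw [koszul, dirDeriv_zero_field, h1, h2, dirDeriv_of_eventuallyEq_const X .rfl,
      dirDeriv_of_eventuallyEq_const Z .rfl, VectorField.mlieBracket_zero_left,
      VectorField.mlieBracket_zero_right]
    simp
  simp only [leviCivita, h, raise_zero]

/-- Integrability and ∇̊g = 0 are conditions on global fields, so the frame is multiplied by a bump
function. The germ at x is unchanged, and pointwise multiples of frame vectors stay in H or V. -/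
theorem OrthoFrame.exists_extension [T2Space M] (F : OrthoFrame g) {x : M} (hx : x ∈ F.U) :
    ∃ X : Fin n → VField n M, (∀ a, IsSmoothVField (X a)) ∧ (∀ a, X a =ᶠ[nhds x] F.e a) ∧
      ∀ a z, (z ∈ F.U ∧ ∃ r : ℝ, X a z = r • F.e a z) ∨ X a z = 0 := by
  obtain ⟨f, -, hf⟩ := (SmoothBumpFunction.nhds_basis_tsupport (I := 𝓘(ℝ, Vec n)) x).mem_iff.1
    (F.isOpen.mem_nhds hx)
  refine ⟨fun a z => f z • F.e a z, fun a => ?_, fun a => ?_, fun a z => ?_⟩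
  · have := isManifold_one n M
    exact ContMDiffOn.smul_section_of_tsupport f.contMDiff.contMDiffOn F.isOpen hf
      fun z hz => (F.smooth a z hz).contMDiffWithinAt
  · filter_upwards [f.eventuallyEq_one] with z hz
    rw [hz, Pi.one_apply, one_smul]
  · by_cases hz : z ∈ F.U
    · exact .inl ⟨hz, f z, rfl⟩
    · refine .inr ?_
      dsimp only
      rw [image_eq_zero_of_notMem_tsupport fun h => hz (hf h), zero_smul]

variable {S : Splitting g}

/-! ### The connection on mixed arguments -/

namespace Splitting

variable {A Z : VField n M}

theorem hor_eq_self (h : ∀ x, Z x ∈ S.H x) : S.hor Z = Z := funext fun x => S.prH_of_mem_H (h x)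

theorem hor_eq_zero (h : ∀ x, Z x ∈ S.V x) : S.hor Z = 0 := funext fun x => S.prH_of_mem_V (h x)

theorem ver_eq_self (h : ∀ x, Z x ∈ S.V x) : S.ver Z = Z := funext fun x => S.prV_of_mem_V (h x)

theorem ver_eq_zero (h : ∀ x, Z x ∈ S.H x) : S.ver Z = 0 := funext fun x => S.prV_of_mem_H (h x)

/-- Both Levi-Civita terms have a zero argument and one bracket is zero, so a single projected
bracket survives. -/
theorem connection_of_vertical_horizontal (hA : ∀ x, A x ∈ S.V x) (hZ : ∀ x, Z x ∈ S.H x)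
    (x : M) :
    S.connection A Z x = S.prH x (VectorField.mlieBracket 𝓘(ℝ, Vec n) A Z x) := by
  rw [connection, hor_eq_zero hA, hor_eq_self hZ, ver_eq_self hA, ver_eq_zero hZ,
    leviCivita_zero_left, leviCivita_zero_right, VectorField.mlieBracket_zero_left]
  simp

theorem connection_of_horizontal_vertical (hA : ∀ x, A x ∈ S.H x) (hZ : ∀ x, Z x ∈ S.V x)
    (x : M) :
    S.connection A Z x = S.prV x (VectorField.mlieBracket 𝓘(ℝ, Vec n) A Z x) := by
  rw [connection, hor_eq_self hA, hor_eq_zero hZ, ver_eq_zero hA, ver_eq_self hZ,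
    leviCivita_zero_left, leviCivita_zero_right, VectorField.mlieBracket_zero_left]
  simp

theorem inner_prH_left (x : M) (v : TangentSpace 𝓘(ℝ, Vec n) x) {w : TangentSpace 𝓘(ℝ, Vec n) x}
    (hw : w ∈ S.H x) : g.inner x (S.prH x v) w = g.inner x v w := by
  obtain ⟨p, hp, q, hq, rfl⟩ := Submodule.mem_sup.1
    ((S.isCompl x).sup_eq_top ▸ Submodule.mem_top : v ∈ S.H x ⊔ S.V x)
  rw [map_add, S.prH_of_mem_H hp, S.prH_of_mem_V hq, add_zero, map_add, add_apply,
    g.symm x q w, S.orthogonal x w hw q hq, add_zero]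

theorem inner_prV_left (x : M) (v : TangentSpace 𝓘(ℝ, Vec n) x) {w : TangentSpace 𝓘(ℝ, Vec n) x}
    (hw : w ∈ S.V x) : g.inner x (S.prV x v) w = g.inner x v w := by
  obtain ⟨p, hp, q, hq, rfl⟩ := Submodule.mem_sup.1
    ((S.isCompl x).sup_eq_top ▸ Submodule.mem_top : v ∈ S.H x ⊔ S.V x)
  rw [map_add, S.prV_of_mem_H hp, S.prV_of_mem_V hq, zero_add, map_add, add_apply,
    S.orthogonal x p hp w hw, zero_add]

end Splitting

/-! ### Vanishing and skewness of the structure functions -/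

namespace AdaptedFrame

variable {F : AdaptedFrame S} {x : M}

theorem br_eq_of_eventuallyEq {X : Fin n → VField n M} (hX : ∀ a, X a =ᶠ[nhds x] F.e a)
    (a b c : Fin n) : F.br a b c x =
      g.inner x (VectorField.mlieBracket 𝓘(ℝ, Vec n) (X a) (X b) x) (X c x) := by
  rw [(hX a).mlieBracket_vectorField_eq (hX b), (hX c).eq_of_nhds]
  rfl

theorem dirDeriv_inner_eq_zero (hx : x ∈ F.U) {X : Fin n → VField n M}
    (hX : ∀ a, X a =ᶠ[nhds x] F.e a) (A : VField n M) (b c : Fin n) :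
    dirDeriv A (fun z => g.inner z (X b z) (X c z)) x = 0 := by
  refine dirDeriv_of_eventuallyEq_const A (r := if b = c then 1 else 0) ?_
  filter_upwards [hX b, hX c, F.isOpen.mem_nhds hx] with z hb hc hz
  rw [hb, hc, F.ortho z hz]

theorem ops_C_eq_neg (c : M) {i j k : Fin n} (h : ∀ x ∈ F.U, F.br i j k x = -F.br i k j x) :
    (F.inChart c).ops.C i j k = -(F.inChart c).ops.C i k j :=
  (F.inChart c).end_ext fun G y hy => by
    rw [LinearMap.neg_apply, map_neg, LocalFrame.ev_C, LocalFrame.ev_C, OrthoFrame.sc_inChart hy,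
      OrthoFrame.sc_inChart hy, h _ hy.2, neg_smul]

variable [T2Space M]

variable (F) in
theorem exists_extension (hx : x ∈ F.U) :
    ∃ X : Fin n → VField n M, (∀ a, IsSmoothVField (X a)) ∧ (∀ a, X a =ᶠ[nhds x] F.e a) ∧
      (∀ a ∈ F.hs, ∀ z, X a z ∈ S.H z) ∧ ∀ a ∉ F.hs, ∀ z, X a z ∈ S.V z := by
  obtain ⟨X, h1, h2, h3⟩ := F.toOrthoFrame.exists_extension hx
  refine ⟨X, h1, h2, fun a ha z => ?_, fun a ha z => ?_⟩
  · obtain ⟨hz, r, hr⟩ | h := h3 a z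
    · exact hr ▸ (S.H z).smul_mem r (F.mem_H z hz a ha)
    · exact h ▸ (S.H z).zero_mem
  · obtain ⟨hz, r, hr⟩ | h := h3 a z
    · exact hr ▸ (S.V z).smul_mem r (F.mem_V z hz a ha)
    · exact h ▸ (S.V z).zero_mem

theorem br_eq_zero (hV : IsIntegrable S.V) (hx : x ∈ F.U) {a b c : Fin n} (ha : a ∉ F.hs)
    (hb : b ∉ F.hs) (hc : c ∈ F.hs) : F.br a b c x = 0 := by
  obtain ⟨X, h1, h2, h3, h4⟩ := F.exists_extension hx
  rw [br_eq_of_eventuallyEq h2, g.symm]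
  exact S.orthogonal x _ (h3 c hc x) _ (hV _ _ (h1 a) (h1 b) (h4 a ha) (h4 b hb) x)

/-- Evaluate ∇̊g = 0 with a vertical and b, c horizontal. The inner products of frame members are
constant, so the left side is zero, and ∇̊ is the projected bracket. Geometrically, the transverse
metric is invariant along the leaves. -/
theorem br_skew_horizontal (hS : S.IsMetric) (hx : x ∈ F.U) {a b c : Fin n} (ha : a ∉ F.hs)
    (hb : b ∈ F.hs) (hc : c ∈ F.hs) : F.br a b c x = -F.br a c b x := by
  obtain ⟨X, h1, h2, h3, h4⟩ := F.exists_extension hx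
  have h := hS _ _ _ (h1 a) (h1 b) (h1 c) x
  rw [dirDeriv_inner_eq_zero hx h2, S.connection_of_vertical_horizontal (h4 a ha) (h3 b hb),
    S.connection_of_vertical_horizontal (h4 a ha) (h3 c hc), S.inner_prH_left x _ (h3 c hc x),
    g.symm x (X b x), S.inner_prH_left x _ (h3 b hb x), ← br_eq_of_eventuallyEq h2,
    ← br_eq_of_eventuallyEq h2] at h
  exact eq_neg_of_add_eq_zero_left h.symm

/-- The same evaluation with the types exchanged. Geometrically, horizontal flows preserve the leaf
metric, which is total geodesy of the leaves. -/
theorem br_skew_vertical (hS : S.IsMetric) (hx : x ∈ F.U) {a b c : Fin n} (ha : a ∈ F.hs)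
    (hb : b ∉ F.hs) (hc : c ∉ F.hs) : F.br a b c x = -F.br a c b x := by
  obtain ⟨X, h1, h2, h3, h4⟩ := F.exists_extension hx
  have h := hS _ _ _ (h1 a) (h1 b) (h1 c) x
  rw [dirDeriv_inner_eq_zero hx h2, S.connection_of_horizontal_vertical (h3 a ha) (h4 b hb),
    S.connection_of_horizontal_vertical (h3 a ha) (h4 c hc), S.inner_prV_left x _ (h4 c hc x),
    g.symm x (X b x), S.inner_prV_left x _ (h4 b hb x), ← br_eq_of_eventuallyEq h2,
    ← br_eq_of_eventuallyEq h2] at h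
  exact eq_neg_of_add_eq_zero_left h.symm

variable (c : M)

theorem ops_C_eq_zero (hV : IsIntegrable S.V) : ∀ i ∈ F.hsᶜ, ∀ j ∈ F.hsᶜ, ∀ k ∈ F.hs,
    (F.inChart c).ops.C i j k = 0 := fun i hi j hj k hk =>
  (F.inChart c).end_ext fun G y hy => by
    rw [LocalFrame.ev_C, OrthoFrame.sc_inChart hy,
      br_eq_zero hV hy.2 (Finset.mem_compl.1 hi) (Finset.mem_compl.1 hj) hk, zero_smul]
    exact (map_zero ((F.inChart c).ev y)).symm

theorem isSkew_horizontal (hS : S.IsMetric) : (F.inChart c).ops.IsSkew F.hs :=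
  fun _ hi _ hj _ hk => ops_C_eq_neg c fun _ hx =>
    br_skew_vertical hS hx hi (Finset.mem_compl.1 hj) (Finset.mem_compl.1 hk)

theorem isSkew_vertical (hS : S.IsMetric) : (F.inChart c).ops.IsSkew F.hsᶜ :=
  fun _ hi _ hj _ hk => ops_C_eq_neg c fun _ hx =>
    br_skew_horizontal hS hx (Finset.mem_compl.1 hi) (by simpa using hj) (by simpa using hk)

end AdaptedFrame

end Foliations

end GradedForms

namespace GradedForms

open MeasureTheory Bundle

/-! ## Commutation relations on totally geodesic Riemannian foliations -/

section Commutation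

variable {n : ℕ} {M : Type*} [TopologicalSpace M] [ChartedSpace (Vec n) M]
  [IsManifold 𝓘(ℝ, Vec n) ∞ M] {g : Metric n M} {S : Splitting g}

namespace AdaptedFrame

theorem hor_grad_eq {F : AdaptedFrame S} {x : M} (hx : x ∈ F.U) (f : M → ℝ) :
    (S.hor (grad g f) x : Vec n) = ∑ a ∈ F.hs, dirDeriv (F.e a) f x • F.vec a x := by
  let P : Vec n →L[ℝ] Vec n := S.prH x
  have hP : ∀ a, P (F.vec a x) = if a ∈ F.hs then F.vec a x else 0 := fun a => by
    split_ifs with ha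
    · exact S.prH_of_mem_H (F.mem_H x hx a ha)
    · exact S.prH_of_mem_V (F.mem_V x hx a ha)
  refine (congrArg P (F.grad_eq hx f)).trans ?_
  simp only [map_sum, map_smul, hP, smul_ite, smul_zero, Finset.sum_ite_mem, Finset.univ_inter]

theorem subLaplacian_eq {F : AdaptedFrame S} {c : M} {y : Vec n} (hy : y ∈ (F.inChart c).W)
    {f : M → ℝ} (hf : ContDiffOn ℝ ∞ (fun z => f ((chart n c).symm z)) (F.inChart c).W) :
    S.subLaplacian f ((chart n c).symm y) =
      (F.inChart c).lapFun F.hs (fun z => f ((chart n c).symm z)) y :=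
  F.divergence_partial_grad hy hf F.hs fun _ hx => hor_grad_eq hx f

theorem exists_orthoFrame (S : Splitting g) (x : M) : ∃ F : OrthoFrame g, x ∈ F.U :=
  (S.exists_adaptedFrame x).imp' AdaptedFrame.toOrthoFrame fun _ h => h

/-- An identity between smooth forms may be checked on their coefficients in adapted frames, whose
domains cover M. -/
theorem eq_neg_of_rp {η ξ : Form n M} (hη : IsSmoothForm η) (hξ : IsSmoothForm ξ)
    (h : ∀ (F : AdaptedFrame S) (c : M), F.U ⊆ (chart n c).source →
      F.rp c (hη.smoothFormOn F.U) = -F.rp c (hξ.smoothFormOn F.U)) : η = -ξ := by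
  funext k x
  obtain ⟨F, hx, hc⟩ := exists_subset_source S x
  have hs : (chart n x).symm (chart n x x) = x := (chart n x).left_inv (mem_extChartAt_source x)
  have hy : chart n x x ∈ (F.inChart x).W := ⟨mem_extChartAt_target x, by
    rw [Set.mem_preimage, hs]; exact hx⟩
  have h1 := congrArg ((F.inChart x).ev (chart n x x)) (h F x hc)
  rw [map_neg, F.ev_rp _ hy, F.ev_rp _ hy, hs] at h1
  exact F.eq_of_tot_eq hx (ξ := -ξ) h1 k

variable [T2Space M]

theorem dPart_anticomm (F : AdaptedFrame S) (c : M) (hV : IsIntegrable S.V) :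
    (F.inChart c).ops.dPart F.hs * (F.inChart c).ops.dPart F.hsᶜ +
      (F.inChart c).ops.dPart F.hsᶜ * (F.inChart c).ops.dPart F.hs = 0 :=
  FrameOps.dPart_anticomm (ops_C_eq_zero c hV) (F.inChart c).d_mul_d

variable {F : AdaptedFrame S} {c : M}

theorem rp_d_one_zero (hV : IsIntegrable S.V) {η : Form n M} (hη : IsSmoothForm η) :
    F.rp c ((smooth_component (S := S) IsSmoothForm.extD 1 0 hη).smoothFormOn F.U) =
      (F.inChart c).ops.dPart F.hs (F.rp c (hη.smoothFormOn F.U)) :=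
  rp_component IsSmoothForm.extD (fun hη => F.d_rp hη) (FrameOps.d_eq (ops_C_eq_zero c hV))
    (FrameOps.hasWeight_dPart.congr (by norm_num))
    (by
      -- The weight with respect to vertical indices is obtained from the complement statement
      -- applied to the complement itself.
      have := FrameOps.hasWeight_dPart_compl (F := (F.inChart c).ops) (S := F.hsᶜ)
      rw [compl_compl] at this
      exact this.congr (by norm_num))
    FrameOps.hasWeight_dPart_compl FrameOps.hasWeight_dCross (by norm_num) (by norm_num) hη

theorem rp_d_zero_one (hV : IsIntegrable S.V) {η : Form n M} (hη : IsSmoothForm η) :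
    F.rp c ((smooth_component (S := S) IsSmoothForm.extD 0 1 hη).smoothFormOn F.U) =
      (F.inChart c).ops.dPart F.hsᶜ (F.rp c (hη.smoothFormOn F.U)) :=
  rp_component IsSmoothForm.extD (fun hη => F.d_rp hη)
    ((FrameOps.d_eq (ops_C_eq_zero c hV)).trans (by rw [add_comm (FrameOps.dPart _ F.hs)]))
    (FrameOps.hasWeight_dPart_compl.congr (by norm_num))
    (FrameOps.hasWeight_dPart.congr (by norm_num))
    FrameOps.hasWeight_dPart FrameOps.hasWeight_dCross (by norm_num) (by norm_num) hη

section Codifferential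

variable [SecondCountableTopology M] [Nonempty M] [MeasurableSpace M] [BorelSpace M]

theorem smooth_codiff (S : Splitting g) {η : Form n M} (hη : IsSmoothForm η) : IsSmoothForm (codiff g η) :=
  (isFormalDualAt_codiff (exists_orthoFrame S) hη).1

theorem rp_δ_neg_one_zero (hV : IsIntegrable S.V) (hS : S.IsMetric)
    (hc : F.U ⊆ (chart n c).source) {η : Form n M} (hη : IsSmoothForm η) :
    F.rp c ((smooth_component (S := S) (smooth_codiff S) (-1) 0 hη).smoothFormOn F.U) =
      (F.inChart c).ops.δPart F.hs (F.rp c (hη.smoothFormOn F.U)) :=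
  rp_component (smooth_codiff S) (fun hη => F.δ_rp (exists_orthoFrame S) hc hη)
    (FrameOps.δ_eq (ops_C_eq_zero c hV) (isSkew_horizontal c hS) (isSkew_vertical c hS))
    (FrameOps.hasWeight_δPart.congr (by norm_num))
    (by
      have := FrameOps.hasWeight_δPart_compl (F := (F.inChart c).ops) (S := F.hsᶜ)
      rw [compl_compl] at this
      exact this.congr (by norm_num))
    FrameOps.hasWeight_δPart_compl FrameOps.hasWeight_δCross (by norm_num) (by norm_num) hη

theorem rp_δ_zero_neg_one (hV : IsIntegrable S.V) (hS : S.IsMetric)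
    (hc : F.U ⊆ (chart n c).source) {η : Form n M} (hη : IsSmoothForm η) :
    F.rp c ((smooth_component (S := S) (smooth_codiff S) 0 (-1) hη).smoothFormOn F.U) =
      (F.inChart c).ops.δPart F.hsᶜ (F.rp c (hη.smoothFormOn F.U)) :=
  rp_component (smooth_codiff S) (fun hη => F.δ_rp (exists_orthoFrame S) hc hη)
    ((FrameOps.δ_eq (ops_C_eq_zero c hV) (isSkew_horizontal c hS) (isSkew_vertical c hS)).trans
      (by rw [add_comm (FrameOps.δPart _ F.hs)]))
    (FrameOps.hasWeight_δPart_compl.congr (by norm_num))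
    (FrameOps.hasWeight_δPart.congr (by norm_num))
    FrameOps.hasWeight_δPart FrameOps.hasWeight_δCross (by norm_num) (by norm_num) hη

end Codifferential

end AdaptedFrame

open AdaptedFrame

/-- In each adapted frame the two components act as `δPart F.hs` and `dPart F.hsᶜ`, which
anticommute by the swap argument. -/
theorem Splitting.δ_neg_one_zero_d_zero_one [T2Space M] [SecondCountableTopology M] [Nonempty M]
    [MeasurableSpace M] [BorelSpace M] (hV : IsIntegrable S.V) (hS : S.IsMetric) {η : Form n M}
    (hη : IsSmoothForm η) : S.δ (-1) 0 (S.d 0 1 η) = -S.d 0 1 (S.δ (-1) 0 η) := by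
  change S.component (codiff g) (-1) 0 (S.component extD 0 1 η) =
    -S.component extD 0 1 (S.component (codiff g) (-1) 0 η)
  have h1 := smooth_component (S := S) IsSmoothForm.extD 0 1 hη
  have h2 := smooth_component (S := S) (smooth_codiff S) (-1) 0 hη
  refine eq_neg_of_rp (S := S) (smooth_component (smooth_codiff S) (-1) 0 h1)
    (smooth_component IsSmoothForm.extD 0 1 h2) fun F c hc => ?_
  rw [rp_δ_neg_one_zero hV hS hc h1, rp_d_zero_one hV hη, rp_d_zero_one hV h2,
    rp_δ_neg_one_zero hV hS hc hη]
  exact congrArg (fun T : Module.End ℝ (F.inChart c).sec => T _) (eq_neg_of_add_eq_zero_left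
    (FrameOps.δPart_dPart_compl_anticomm (isSkew_horizontal c hS) (isSkew_vertical c hS)
      (F.dPart_anticomm c hV)))

theorem Splitting.δ_zero_neg_one_d_one_zero [T2Space M] [SecondCountableTopology M] [Nonempty M]
    [MeasurableSpace M] [BorelSpace M] (hV : IsIntegrable S.V) (hS : S.IsMetric) {η : Form n M}
    (hη : IsSmoothForm η) : S.δ 0 (-1) (S.d 1 0 η) = -S.d 1 0 (S.δ 0 (-1) η) := by
  change S.component (codiff g) 0 (-1) (S.component extD 1 0 η) =
    -S.component extD 1 0 (S.component (codiff g) 0 (-1) η)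
  have h1 := smooth_component (S := S) IsSmoothForm.extD 1 0 hη
  have h2 := smooth_component (S := S) (smooth_codiff S) 0 (-1) hη
  refine eq_neg_of_rp (S := S) (smooth_component (smooth_codiff S) 0 (-1) h1)
    (smooth_component IsSmoothForm.extD 1 0 h2) fun F c hc => ?_
  rw [rp_δ_zero_neg_one hV hS hc h1, rp_d_one_zero hV hη, rp_d_one_zero hV h2,
    rp_δ_zero_neg_one hV hS hc hη]
  exact congrArg (fun T : Module.End ℝ (F.inChart c).sec => T _) (eq_neg_of_add_eq_zero_left
    (FrameOps.δPart_compl_dPart_anticomm (isSkew_horizontal c hS) (isSkew_vertical c hS)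
      (F.dPart_anticomm c hV)))

theorem Splitting.subLaplacian_laplacian [T2Space M] (hV : IsIntegrable S.V) (hS : S.IsMetric)
    {f : M → ℝ} (hf : IsSmoothFun (n := n) f) :
    S.subLaplacian (laplacian g f) = laplacian g (S.subLaplacian f) := by
  funext x
  obtain ⟨F, hx, -⟩ := exists_subset_source S x
  have hs : (chart n x).symm (chart n x x) = x := (chart n x).left_inv (mem_extChartAt_source x)
  have hy : chart n x x ∈ (F.inChart x).W := ⟨mem_extChartAt_target x, by
    rw [Set.mem_preimage, hs]; exact hx⟩
  have hW := (F.inChart x).isOpen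
  have h0 : ContDiffOn ℝ ∞ (fun z => f ((chart n x).symm z)) (F.inChart x).W :=
    (hf.inChart x).mono Set.inter_subset_left
  have h1 : ∀ y ∈ (F.inChart x).W, laplacian g f ((chart n x).symm y) =
      (F.inChart x).lapFun Finset.univ (fun z => f ((chart n x).symm z)) y :=
    fun y hy => F.laplacian_eq hy h0
  have h2 : ∀ y ∈ (F.inChart x).W, S.subLaplacian f ((chart n x).symm y) =
      (F.inChart x).lapFun F.hs (fun z => f ((chart n x).symm z)) y :=
    fun y hy => subLaplacian_eq hy h0
  -- The local formula shows that the inner Laplacian is smooth on the frame domain, which is what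
  -- allows the formula to be applied a second time.
  have h3 := subLaplacian_eq hy ((LocalFrame.smooth_lapFun Finset.univ h0).congr h1)
  have h4 := F.laplacian_eq hy ((LocalFrame.smooth_lapFun F.hs h0).congr h2)
  rw [hs] at h3 h4
  rw [h3, h4, LocalFrame.lapFun_congr _ (Filter.eventuallyEq_of_mem (hW.mem_nhds hy) h1),
    LocalFrame.lapFun_congr _ (Filter.eventuallyEq_of_mem (hW.mem_nhds hy) h2)]
  exact LocalFrame.lapFun_univ_comm (isSkew_horizontal x hS) (isSkew_vertical x hS)
    (F.dPart_anticomm x hV) h0 hy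

end Commutation

end GradedForms

theorem mainTheorem12 {n : ℕ} {M : Type*} [TopologicalSpace M] [T2Space M]
    [SecondCountableTopology M] [ConnectedSpace M]
    [ChartedSpace (EuclideanSpace ℝ (Fin n)) M]
    [IsManifold 𝓘(ℝ, EuclideanSpace ℝ (Fin n)) ∞ M]
    [MeasurableSpace M] [BorelSpace M]
    (g : GradedForms.Metric n M) (S : GradedForms.Splitting g)
    (hV : GradedForms.IsIntegrable S.V) (hS : S.IsMetric) :
    (∀ η : GradedForms.Form n M, GradedForms.IsSmoothForm η →
      GradedForms.IsFormalDualAt g GradedForms.extD η (GradedForms.codiff g η)) ∧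
    (∀ η : GradedForms.Form n M, GradedForms.IsSmoothForm η →
      S.δ (-1) 0 (S.d 0 1 η) = -S.d 0 1 (S.δ (-1) 0 η) ∧
      S.δ 0 (-1) (S.d 1 0 η) = -S.d 1 0 (S.δ 0 (-1) η)) ∧
    (∀ f : M → ℝ, GradedForms.IsSmoothFun (n := n) f →
      S.subLaplacian (GradedForms.laplacian g f) =
        GradedForms.laplacian g (S.subLaplacian f)) :=
  ⟨fun _ hη => GradedForms.isFormalDualAt_codiff (GradedForms.AdaptedFrame.exists_orthoFrame S) hη,
    fun _ hη => ⟨S.δ_neg_one_zero_d_zero_one hV hS hη, S.δ_zero_neg_one_d_one_zero hV hS hη⟩,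
    fun _ hf => S.subLaplacian_laplacian hV hS hf⟩
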